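/- **Theorem 2.4.** Fix $\alpha\in(1,2)$. Let $(\xi,\eta)$ be a symmetric $\alpha$-stable pair with integral representation $(\xi,\eta)=\big(\int_S f\,dM,\int_S g\,dM\big)$ in law, where $(S,\mu)$ is a measure space, $f,g\in L^\alpha(S,\mu)$ and $M$ is a symmetric $\alpha$-stable random measure with control measure $\mu$; that is, $$E e^{i(u\xi+v\eta)}=e^{-\|uf+vg\|_\alpha^\alpha}\quad (u,v\in\mathbb R),\qquad \|h\|_\alpha=\Big(\int_S|h|^\alpha\,d\mu\Big)^{1/\alpha}.$$ Write $\|\xi\|_\alpha=\|f\|_\alpha$, $\|\eta\|_\alpha=\|g\|_\alpha$ and $$[\xi,\eta]_1=\int_S|f|^{\alpha-1}|g|\,d\mu+\int_S|g|^{\alpha-1}|f|\,d\mu,\qquad [\xi,\eta]_2=\int_S|fg|^{\alpha/2}\,d\mu .$$ Assume that for some $\varepsilon_1,\varepsilon_2>0$: * (A1) $\|f\|_\alpha^{\alpha/2}\|g\|_\alpha^{\alpha/2}-\int_S|fg|^{\alpha/2}\,d\mu\ \ge\ \varepsilon_1\|f\|_\alpha^{\alpha/2}\|g\|_\alpha^{\alpha/2}$;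 * (A2) $\|uf+vg\|_\alpha^\alpha\ \ge\ \varepsilon_2\big(\|uf\|_\alpha^\alpha+\|vg\|_\alpha^\alpha\big)$ for all $u,v\in\mathbb R$. Let $K,L:\mathbb R\to\mathbb R$ be Borel functions, each satisfying the following conditions (stated for $K$) for some $\beta\in(0,\alpha/2)$ and $x_0>0$, which may be different for $K$ and $L$: * (K1) there is a constant $c$ with $|K(x)|\le c|x|^\beta$ for $|x|>x_0$; * (K2) $K(x)/x$ is monotone on $(x_0,\infty)$ and monotone on $(-\infty,-x_0)$ (on each half-line either non-increasing or non-decreasing); * (K3) there are finitely many points $x_1,\dots,x_p\in[-x_0,x_0]$ such that $K$ is bounded on $[-x_0,x_0]$ outside every neighbourhood of $\{x_1,\dots,x_p\}$, and $K$ is integrable on some neighbourhood of each $x_j$. Then $K(\xi)$, $L(\eta)$ and $K(\xi)L(\eta)$ are integrable, so that $\operatorname{Cov}(K(\xi),L(\eta))$ is well defined, and $$|\operatorname{Cov}(K(\xi),L(\eta))|\le C\,\big([\xi,\eta]_1+[\xi,\eta]_2\big),$$ where the constant $C$ depends only on $\alpha,\varepsilon_1,\varepsilon_2,K,L,\|\xi\|_\alpha$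 and $\|\eta\|_\alpha$. -/

import Mathlib

open MeasureTheory ProbabilityTheory Set Topology

namespace StableCov

/-- The quantity `‖f‖_α = (∫ |f|^α dμ)^(1/α)`. -/
noncomputable def aNorm {S : Type*} [MeasurableSpace S] (α : ℝ) (μ : Measure S)
    (f : S → ℝ) : ℝ :=
  (∫ s, |f s| ^ α ∂μ) ^ (1 / α)

/-- `(ξ, η)` is a symmetric `α`-stable pair with the integral representation
`(∫ f dM, ∫ g dM)`, `M` being a symmetric `α`-stable random measure with control measure `μ`,
and `f, g ∈ L^α(S, μ)`.  The representation is an identity in law, so it is expressed by the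
joint characteristic function `E exp(i(uξ + vη)) = exp(-‖uf + vg‖_α^α)`. -/
structure IsStablePair {Ω S : Type*} [MeasurableSpace Ω] [MeasurableSpace S] (α : ℝ)
    (P : Measure Ω) (ξ η : Ω → ℝ) (μ : Measure S) (f g : S → ℝ) : Prop where
  aemeasurable_fst : AEMeasurable ξ P
  aemeasurable_snd : AEMeasurable η P
  memLp_fst : MemLp f (ENNReal.ofReal α) μ
  memLp_snd : MemLp g (ENNReal.ofReal α) μ
  charFun_eq : ∀ u v : ℝ,
    ∫ ω, Complex.exp (Complex.I * ((u * ξ ω + v * η ω : ℝ) : ℂ)) ∂P =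
      Complex.exp ((-(aNorm α μ (fun s => u * f s + v * g s) ^ α) : ℝ) : ℂ)

/-- `[ξ, η]₁* = ∫ |f|^(α-1) |g| dμ`. -/
noncomputable def dep1Star {S : Type*} [MeasurableSpace S] (α : ℝ) (μ : Measure S)
    (f g : S → ℝ) : ℝ :=
  ∫ s, |f s| ^ (α - 1) * |g s| ∂μ

/-- `[ξ, η]₁ = [ξ, η]₁* + [η, ξ]₁*`. -/
noncomputable def dep1 {S : Type*} [MeasurableSpace S] (α : ℝ) (μ : Measure S)
    (f g : S → ℝ) : ℝ :=
  dep1Star α μ f g + dep1Star α μ g f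

/-- `[ξ, η]₂ = ∫ |f g|^(α/2) dμ`. -/
noncomputable def dep2 {S : Type*} [MeasurableSpace S] (α : ℝ) (μ : Measure S)
    (f g : S → ℝ) : ℝ :=
  ∫ s, |f s * g s| ^ (α / 2) ∂μ

/-- `‖f‖_α^(α/2) ‖g‖_α^(α/2) - ∫ |f g|^(α/2) dμ ≥ ε₁ ‖f‖_α^(α/2) ‖g‖_α^(α/2)`. -/
def AssumptionA1 {S : Type*} [MeasurableSpace S] (α : ℝ) (μ : Measure S)
    (f g : S → ℝ) (ε₁ : ℝ) : Prop :=
  ε₁ * (aNorm α μ f ^ (α / 2) * aNorm α μ g ^ (α / 2)) ≤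
    aNorm α μ f ^ (α / 2) * aNorm α μ g ^ (α / 2) - ∫ s, |f s * g s| ^ (α / 2) ∂μ

/-- `‖uf + vg‖_α^α ≥ ε₂ (‖uf‖_α^α + ‖vg‖_α^α)` for all real `u, v`. -/
def AssumptionA2 {S : Type*} [MeasurableSpace S] (α : ℝ) (μ : Measure S)
    (f g : S → ℝ) (ε₂ : ℝ) : Prop :=
  ∀ u v : ℝ,
    ε₂ * (aNorm α μ (fun s => u * f s) ^ α + aNorm α μ (fun s => v * g s) ^ α) ≤
      aNorm α μ (fun s => u * f s + v * g s) ^ α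

/-- Growth: `|K(x)| ≤ const |x|^β` for `|x| > x₀`. -/
def AssumptionK1 (K : ℝ → ℝ) (β x₀ : ℝ) : Prop :=
  ∃ c : ℝ, ∀ x : ℝ, x₀ < |x| → |K x| ≤ c * |x| ^ β

/-- Tails: `K(x)/x` is monotone on `(x₀, ∞)` and monotone on `(-∞, -x₀)`, in either
direction on each of the two half-lines. -/
def AssumptionK2 (K : ℝ → ℝ) (x₀ : ℝ) : Prop :=
  (MonotoneOn (fun x => K x / x) (Ioi x₀) ∨ AntitoneOn (fun x => K x / x) (Ioi x₀)) ∧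
  (MonotoneOn (fun x => K x / x) (Iio (-x₀)) ∨ AntitoneOn (fun x => K x / x) (Iio (-x₀)))

/-- Local behaviour: there are finitely many points of `[-x₀, x₀]` such that `K` is bounded on
`[-x₀, x₀]` outside every neighbourhood of these points, and `K` is integrable on some
neighbourhood of each of them. -/
def AssumptionK3 (K : ℝ → ℝ) (x₀ : ℝ) : Prop :=
  ∃ F : Finset ℝ,
    (∀ p ∈ F, |p| ≤ x₀ ∧ IntegrableAtFilter K (𝓝 p) volume) ∧
    ∀ δ > 0, ∃ B : ℝ, ∀ x : ℝ, |x| ≤ x₀ → (∀ p ∈ F, δ ≤ |x - p|) → |K x| ≤ B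

/-- `K` is a (Borel) function satisfying the three conditions above with some exponent
`β ∈ (0, α/2)` and some `x₀ > 0`. -/
def Admissible (α : ℝ) (K : ℝ → ℝ) : Prop :=
  Measurable K ∧ ∃ β x₀ : ℝ, 0 < β ∧ β < α / 2 ∧ 0 < x₀ ∧
    AssumptionK1 K β x₀ ∧ AssumptionK2 K x₀ ∧ AssumptionK3 K x₀

end StableCov

/-!
The law of the pair is determined by its spectral measure `Γ` on the unit sphere of the supremum
norm, the image of `max(|f|, |g|)^α • μ` under the normalised pair `(f, g)`.  The pair
with independent components and the same marginals has as spectral measure the sum `Γ₀` of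
the two coordinate projections of `Γ` (`indepSpectral`).  The covariance is the integral of
`K(x) L(y)` against the difference `h_Γ - h_{Γ₀}` of the densities, and this difference is
estimated along the segment `Γ_t = t Γ + (1 - t) Γ₀` of spectral measures.

* *Derivative along the segment.*  With `κ` the Lévy measure of `Γ`, the difference of the two
  exponents at `u` is the `κ`-integral of a mixed second difference of `cos` in the directions of
  the two axes (`integral_mixedCos`).  On the density side this gives
  `h_Γ - h_{Γ₀} = ∫₀¹ ∫ Δ_{x₁,x₂} h_{Γ_t} dκ(x) dt`, up to symmetrisation in `x`, where `Δ` is the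
  mixed difference `mixedDiff` (`lintegral_stableDensity_sub_le`).

* *Uniform bounds for stable densities.*  The density `h_{Γ_t}` is the convolution of the density
  of the small jumps with the compound Poisson law of the large jumps.  The former is smooth and
  decays fast, with bounds that depend only on the mass of `Γ_t` and on a lower bound of its
  exponent (`exists_norm_iteratedFDeriv_small_le`); by `AssumptionA2`, the lower bound holds for all
  the `Γ_t` at once.  The latter integrates `(1 + |x|)^β (1 + |y|)^β`, as `2β < α`.  Therefore
  `∫ |K(x) L(y)| |Δ_{a,b} h_{Γ_t}|` is at most a constant times
  `min(1, |a|) (1 + |a|)^β min(1, |b|) (1 + |b|)^β` (`exists_lintegral_stableDensity_le`).  The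
  functions `K` and `L` enter through their growth, at most like `|x|^β`, and their local
  integrability (`Admissible.isTame`).

* *Integration over the jumps.*  In polar coordinates `x = r θ` one of the coordinates of `θ` is
  `±1`.  Bounding the jump size of the other coordinate by a multiple of `|r θ_i|^(α/2)` leaves an
  integral over `r` that converges at `0` since `1 + α/2 > α` and at infinity since
  `β + α/2 < α`, and the integral over `θ` is `∫ |θ₁ θ₂|^(α/2) dΓ = ∫ |f g|^(α/2) dμ`
  (`lintegral_jumpSize_le`, `lintegral_spectralMeasure_dep2`).

If one of the scale parameters vanishes, then that component is almost surely zero, the covariance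
vanishes, and the other component is integrable by a one-dimensional version of the density
argument (`IsTame.integrable_of_charFun`).
-/

namespace StableCov

/-! ### Smoothness of Lévy exponents -/

section CosineTransform

open scoped RealInnerProductSpace ContDiff

variable {V : Type} [NormedAddCommGroup V] [InnerProductSpace ℝ V] [FiniteDimensional ℝ V]
  [MeasurableSpace V] [BorelSpace V]

/-- Differentiation under the integral sign for integrals of the form `∫ g ⟪x, u⟫ • B x ∂κ`. -/
lemma hasFDerivAt_integral_comp_inner {F : Type} [NormedAddCommGroup F] [NormedSpace ℝ F]
    {κ : Measure V} {g g' : ℝ → ℝ} (hg : ∀ z, HasDerivAt g (g' z) z) (hg' : Continuous g')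
    {B : V → F} (hB : Continuous B) (u₀ : V)
    (hint : Integrable (fun x => g ⟪x, u₀⟫ • B x) κ) {bound : V → ℝ} (hbi : Integrable bound κ)
    (hb : ∀ x, ∀ u ∈ Metric.ball u₀ 1, |g' ⟪x, u⟫| * (‖x‖ * ‖B x‖) ≤ bound x) :
    HasFDerivAt (fun u => ∫ x, g ⟪x, u⟫ • B x ∂κ)
      (∫ x, g' ⟪x, u₀⟫ • (innerSL ℝ x).smulRight (B x) ∂κ) u₀ := by
  have hgc : Continuous g := continuous_iff_continuousAt.2 fun z => (hg z).continuousAt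
  have : SecondCountableTopology V := inferInstance
  have : SecondCountableTopologyEither V (V →L[ℝ] F) := ⟨.inl inferInstance⟩
  refine hasFDerivAt_integral_of_dominated_of_fderiv_le (μ := κ)
    (F' := fun u x => g' ⟪x, u⟫ • (innerSL ℝ x).smulRight (B x)) (bound := bound)
    (Metric.ball_mem_nhds u₀ one_pos) ?_ hint ?_ ?_ hbi ?_
  · refine Filter.Eventually.of_forall fun u => Continuous.aestronglyMeasurable ?_
    fun_prop
  · refine Continuous.aestronglyMeasurable ?_
    have h1 : Continuous fun x : V => (innerSL ℝ x).smulRight (B x) :=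
      ((ContinuousLinearMap.smulRightL ℝ V F).continuous₂).comp
        ((innerSL ℝ).continuous.prodMk hB)
    fun_prop
  · refine Filter.Eventually.of_forall fun x u hu => ?_
    refine le_trans (le_of_eq ?_) (hb x u hu)
    rw [norm_smul, ContinuousLinearMap.norm_smulRight_apply, innerSL_apply_norm, Real.norm_eq_abs]
  · refine Filter.Eventually.of_forall fun x u _ => ?_
    have h1 : HasFDerivAt (fun u : V => ⟪x, u⟫) (innerSL ℝ x) u := (innerSL ℝ x).hasFDerivAt
    have h2 := ((hg ⟪x, u⟫).comp_hasFDerivAt u h1).smul_const (B x)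
    refine h2.congr_fderiv ?_
    ext v
    simp [mul_smul]

/-- The phase-shifted cosine transform of the vector-valued measure `B • κ`. -/
noncomputable def cosTransform {F : Type} [NormedAddCommGroup F] [NormedSpace ℝ F]
    (κ : Measure V) (a : ℝ) (B : V → F) (u : V) : F :=
  ∫ x, Real.cos (⟪x, u⟫ + a) • B x ∂κ

lemma hasFDerivAt_cosTransform {F : Type} [NormedAddCommGroup F] [NormedSpace ℝ F]
    {κ : Measure V} (a : ℝ) {B : V → F} (hB : Continuous B)
    (hint : ∀ n : ℕ, Integrable (fun x => ‖x‖ ^ n * ‖B x‖) κ) (u : V) :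
    HasFDerivAt (cosTransform κ a B)
      (cosTransform κ (a + Real.pi / 2) (fun x => (innerSL ℝ x).smulRight (B x)) u) u := by
  refine hasFDerivAt_integral_comp_inner (g := fun z => Real.cos (z + a))
    (g' := fun z => Real.cos (z + (a + Real.pi / 2))) ?_ (by fun_prop) hB u ?_
    (bound := fun x => ‖x‖ * ‖B x‖) (by simpa using hint 1) ?_
  · intro z
    rw [← add_assoc, Real.cos_add_pi_div_two]
    simpa using (Real.hasDerivAt_cos (z + a)).comp_add_const z a
  · refine (by simpa using hint 0 : Integrable (fun x => ‖B x‖) κ).mono'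
      (Continuous.aestronglyMeasurable (by fun_prop)) (Filter.Eventually.of_forall fun x => ?_)
    rw [norm_smul, Real.norm_eq_abs]
    exact mul_le_of_le_one_left (norm_nonneg _) (Real.abs_cos_le_one _)
  · intro x u _
    exact mul_le_of_le_one_left (by positivity) (Real.abs_cos_le_one _)

lemma contDiff_cosTransform (n : ℕ) : ∀ {F : Type} [NormedAddCommGroup F] [NormedSpace ℝ F]
    {κ : Measure V} (a : ℝ) {B : V → F} (_ : Continuous B)
    (_ : ∀ n : ℕ, Integrable (fun x => ‖x‖ ^ n * ‖B x‖) κ),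
    ContDiff ℝ n (cosTransform κ a B) ∧
      ∀ u, ‖iteratedFDeriv ℝ n (cosTransform κ a B) u‖ ≤ ∫ x, ‖x‖ ^ n * ‖B x‖ ∂κ := by
  induction n with
  | zero =>
    intro F _ _ κ a B hB hint
    refine ⟨?_, fun u => ?_⟩
    · simp only [Nat.cast_zero, contDiff_zero]
      exact continuous_iff_continuousAt.2 fun u =>
        (hasFDerivAt_cosTransform a hB hint u).continuousAt
    · rw [norm_iteratedFDeriv_zero]
      refine norm_integral_le_of_norm_le (hint 0) (Filter.Eventually.of_forall fun x => ?_)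
      rw [norm_smul, Real.norm_eq_abs, pow_zero, one_mul]
      exact mul_le_of_le_one_left (norm_nonneg _) (Real.abs_cos_le_one _)
  | succ n ih =>
    intro F _ _ κ a B hB hint
    have hB' : Continuous fun x : V => (innerSL ℝ x).smulRight (B x) :=
      ((ContinuousLinearMap.smulRightL ℝ V F).continuous₂).comp
        ((innerSL ℝ).continuous.prodMk hB)
    have hnorm : ∀ (k : ℕ) (x : V), ‖x‖ ^ k * ‖(innerSL ℝ x).smulRight (B x)‖ =
        ‖x‖ ^ (k + 1) * ‖B x‖ := fun k x => by
      rw [ContinuousLinearMap.norm_smulRight_apply, innerSL_apply_norm]; ring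
    have hint' : ∀ k : ℕ, Integrable (fun x => ‖x‖ ^ k * ‖(innerSL ℝ x).smulRight (B x)‖) κ :=
      fun k => by simpa only [hnorm] using hint (k + 1)
    obtain ⟨h1, h2⟩ := ih (a + Real.pi / 2) hB' hint'
    have hd := hasFDerivAt_cosTransform a hB hint
    have hfd : fderiv ℝ (cosTransform κ a B) = cosTransform κ (a + Real.pi / 2)
        (fun x => (innerSL ℝ x).smulRight (B x)) := funext fun u => (hd u).fderiv
    refine ⟨?_, fun u => ?_⟩
    · rw [Nat.cast_succ, contDiff_succ_iff_fderiv]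
      refine ⟨fun u => (hd u).differentiableAt, by simp, ?_⟩
      rw [hfd]; exact h1
    · rw [← norm_iteratedFDeriv_fderiv, hfd]
      simpa only [hnorm] using h2 u

/-- The Lévy exponent `∫ (1 - cos ⟪x, u⟫) dκ(x)` of a symmetric Lévy measure `κ`. -/
noncomputable def levyExp (κ : Measure V) (u : V) : ℝ := ∫ x, (1 - Real.cos ⟪x, u⟫) ∂κ

lemma one_sub_cos_le_sq (z : ℝ) : 1 - Real.cos z ≤ z ^ 2 := by
  nlinarith [Real.one_sub_sq_div_two_le_cos (x := z)]

lemma integrable_one_sub_cos {V : Type} [NormedAddCommGroup V] [InnerProductSpace ℝ V]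
    [MeasurableSpace V] [OpensMeasurableSpace V] [SecondCountableTopology V] {κ : Measure V}
    (h2 : Integrable (fun x => ‖x‖ ^ 2) κ) (u : V) :
    Integrable (fun x => 1 - Real.cos ⟪x, u⟫) κ := by
  refine (h2.mul_const (‖u‖ ^ 2)).mono' (Continuous.aestronglyMeasurable (by fun_prop))
    (Filter.Eventually.of_forall fun x => ?_)
  rw [Real.norm_eq_abs, abs_of_nonneg (sub_nonneg.2 (Real.cos_le_one _)), ← mul_pow]
  refine (one_sub_cos_le_sq _).trans ?_
  rw [← sq_abs ⟪x, u⟫]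
  gcongr
  exact abs_real_inner_le_norm x u

/-- The Lévy exponent of a measure with moments of all orders `≥ 2` is smooth.  Its second
derivative is a cosine transform, which is why the mass of `κ` and its first moment near the
origin may be infinite. -/
lemma contDiff_levyExp {κ : Measure V} {D : ℝ} (hD : 1 ≤ D)
    (hint : ∀ n : ℕ, Integrable (fun x => ‖x‖ ^ (n + 2)) κ)
    (hmom : ∀ n : ℕ, ∫ x, ‖x‖ ^ (n + 2) ∂κ ≤ D ^ (n + 2)) (n : ℕ) :
    ContDiff ℝ (n + 2 : ℕ) (levyExp κ) ∧ ∀ u, ∀ i, 1 ≤ i → i ≤ n + 2 →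
      ‖iteratedFDeriv ℝ i (levyExp κ) u‖ ≤ (D ^ 2 * (1 + ‖u‖)) ^ i := by
  have h2 : Integrable (fun x => ‖x‖ ^ 2) κ := hint 0
  have hsm : ∀ {F : Type} [NormedAddCommGroup F] [NormedSpace ℝ F] {B : V → F}, Continuous B →
      Continuous fun x : V => (innerSL ℝ x).smulRight (B x) := fun {F} _ _ {B} hB =>
    ((ContinuousLinearMap.smulRightL ℝ V F).continuous₂).comp ((innerSL ℝ).continuous.prodMk hB)
  let B₁ : V → V →L[ℝ] ℝ := fun x => (innerSL ℝ x).smulRight (1 : ℝ)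
  let B₂ : V → V →L[ℝ] V →L[ℝ] ℝ := fun x => (innerSL ℝ x).smulRight (B₁ x)
  have hB₁ : Continuous B₁ := hsm continuous_const
  have hB₂ : Continuous B₂ := hsm hB₁
  have nB₁ : ∀ x, ‖B₁ x‖ = ‖x‖ := fun x => by
    simp only [B₁]
    rw [ContinuousLinearMap.norm_smulRight_apply, innerSL_apply_norm]; simp
  have nB₂ : ∀ x, ‖B₂ x‖ = ‖x‖ ^ 2 := fun x => by
    simp only [B₂]
    rw [ContinuousLinearMap.norm_smulRight_apply, innerSL_apply_norm, nB₁]; ring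
  have hsin : ∀ x u : V, |Real.sin ⟪x, u⟫| ≤ ‖x‖ * ‖u‖ := fun x u =>
    (Real.abs_sin_le_abs).trans (abs_real_inner_le_norm x u)
  have d1 : ∀ u, HasFDerivAt (levyExp κ) (∫ x, Real.sin ⟪x, u⟫ • B₁ x ∂κ) u := fun u => by
    have := hasFDerivAt_integral_comp_inner (κ := κ) (g := fun z => 1 - Real.cos z)
      (g' := Real.sin) (B := fun _ => (1 : ℝ))
      (fun z => by simpa using (Real.hasDerivAt_cos z).const_sub 1) Real.continuous_sin
      continuous_const u (by simpa using integrable_one_sub_cos h2 u)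
      (bound := fun x => ‖x‖ ^ 2 * (‖u‖ + 1)) (h2.mul_const _) (fun x v hv => by
        have hv' : ‖v‖ ≤ ‖u‖ + 1 := by
          have := norm_sub_norm_le v u
          rw [Metric.mem_ball, dist_eq_norm] at hv
          linarith
        have : |Real.sin ⟪x, v⟫| ≤ ‖x‖ * (‖u‖ + 1) := (hsin x v).trans (by gcongr)
        simp only [norm_one, mul_one]
        nlinarith [norm_nonneg x])
    simp only [smul_eq_mul, mul_one] at this
    exact this
  have d2 : ∀ u, HasFDerivAt (fun u => ∫ x, Real.sin ⟪x, u⟫ • B₁ x ∂κ) (cosTransform κ 0 B₂ u) u :=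
    fun u => by
    have := hasFDerivAt_integral_comp_inner (κ := κ) (g := Real.sin)
      (g' := Real.cos) (B := B₁) Real.hasDerivAt_sin Real.continuous_cos hB₁ u
      ((h2.mul_const ‖u‖).mono' (Continuous.aestronglyMeasurable (by fun_prop))
        (Filter.Eventually.of_forall fun x => by
          rw [norm_smul, nB₁, Real.norm_eq_abs]
          nlinarith [hsin x u, norm_nonneg x]))
      (bound := fun x => ‖x‖ ^ 2) h2 (fun x v _ => by
        rw [nB₁, ← pow_two]
        exact mul_le_of_le_one_left (by positivity) (Real.abs_cos_le_one _))
    simpa [cosTransform] using this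
  have f1 : fderiv ℝ (levyExp κ) = fun u => ∫ x, Real.sin ⟪x, u⟫ • B₁ x ∂κ :=
    funext fun u => (d1 u).fderiv
  have f2 : fderiv ℝ (fderiv ℝ (levyExp κ)) = cosTransform κ 0 B₂ := by
    rw [f1]; exact funext fun u => (d2 u).fderiv
  have hm : ∀ k : ℕ, (fun x : V => ‖x‖ ^ k * ‖B₂ x‖) = fun x => ‖x‖ ^ (k + 2) := fun k => by
    funext x; rw [nB₂]; ring
  have hct := fun k : ℕ => contDiff_cosTransform k (F := V →L[ℝ] V →L[ℝ] ℝ) (κ := κ) (B := B₂) 0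
    hB₂ (fun k => by rw [hm]; exact hint k)
  refine ⟨?_, fun u i hi _ => ?_⟩
  · have e : ((n + 2 : ℕ) : ℕ∞ω) = (n : ℕ∞ω) + 1 + 1 := by
      push_cast; rw [add_assoc]; norm_num
    rw [e, contDiff_succ_iff_fderiv]
    refine ⟨fun u => (d1 u).differentiableAt, by simp, ?_⟩
    rw [contDiff_succ_iff_fderiv]
    refine ⟨fun u => ?_, by simp, ?_⟩
    · rw [f1]; exact (d2 u).differentiableAt
    · rw [f2]; exact (hct n).1
  · have hD1 : 1 ≤ D ^ 2 := one_le_pow₀ hD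
    have hu := norm_nonneg u
    obtain ⟨j, rfl⟩ := Nat.exists_eq_add_of_le' hi
    rcases j with _ | j
    · rw [← norm_iteratedFDeriv_fderiv, norm_iteratedFDeriv_zero, f1]
      calc ‖∫ x, Real.sin ⟪x, u⟫ • B₁ x ∂κ‖ ≤ ∫ x, ‖x‖ ^ 2 * ‖u‖ ∂κ :=
            norm_integral_le_of_norm_le (h2.mul_const _) (Filter.Eventually.of_forall fun x => by
              rw [norm_smul, nB₁, Real.norm_eq_abs]
              nlinarith [hsin x u, norm_nonneg x])
        _ ≤ D ^ 2 * ‖u‖ := by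
            rw [integral_mul_const]
            exact mul_le_mul_of_nonneg_right (hmom 0) hu
        _ ≤ (D ^ 2 * (1 + ‖u‖)) ^ (0 + 1) := by
            rw [zero_add, pow_one]; nlinarith
    · rw [← norm_iteratedFDeriv_fderiv, ← norm_iteratedFDeriv_fderiv, f2]
      calc _ ≤ _ := (hct j).2 u
        _ ≤ D ^ (j + 2) := by rw [hm]; exact hmom j
        _ ≤ (D ^ 2 * (1 + ‖u‖)) ^ (j + 2) := by
            gcongr
            nlinarith

end CosineTransform

/-! ### Densities of infinitely divisible laws, and mixed differences -/

section SmoothDensity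

open scoped RealInnerProductSpace ContDiff FourierTransform Nat

variable {V : Type} [NormedAddCommGroup V] [InnerProductSpace ℝ V] [FiniteDimensional ℝ V]
  [MeasurableSpace V] [BorelSpace V]

lemma exists_pow_mul_exp_neg_le (m : ℕ) {c : ℝ} (hc : 0 < c) :
    ∃ S : ℝ, 0 ≤ S ∧ ∀ r : ℝ, 0 ≤ r → (1 + r) ^ m * Real.exp (-(c * r)) ≤ S := by
  refine ⟨m ! / c ^ m * Real.exp c, by positivity, fun r hr => ?_⟩
  have h := Real.pow_div_factorial_le_exp (c * (1 + r)) (by positivity) m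
  rw [mul_pow, mul_add, mul_one, Real.exp_add, div_le_iff₀ (by positivity)] at h
  have h2 : Real.exp (-(c * r)) * Real.exp (c * r) = 1 := by rw [← Real.exp_add]; simp
  rw [div_mul_eq_mul_div, le_div_iff₀ (by positivity)]
  calc (1 + r) ^ m * Real.exp (-(c * r)) * c ^ m
      = c ^ m * (1 + r) ^ m * Real.exp (-(c * r)) := by ring
    _ ≤ Real.exp c * Real.exp (c * r) * m ! * Real.exp (-(c * r)) := by gcongr
    _ = Real.exp c * m ! * (Real.exp (-(c * r)) * Real.exp (c * r)) := by ring
    _ = m ! * Real.exp c := by rw [h2]; ring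

/-- The characteristic function `exp (-levyExp κ)`, as a complex-valued function. -/
noncomputable def levyCF (κ : Measure V) (u : V) : ℂ := (Real.exp (-levyExp κ u) : ℝ)

lemma norm_iteratedFDeriv_levyCF_le {κ : Measure V} {D : ℝ} (hD : 1 ≤ D)
    (hint : ∀ n : ℕ, Integrable (fun x => ‖x‖ ^ (n + 2)) κ)
    (hmom : ∀ n : ℕ, ∫ x, ‖x‖ ^ (n + 2) ∂κ ≤ D ^ (n + 2)) (n : ℕ) :
    ContDiff ℝ n (levyCF κ) ∧ ∀ u, ‖iteratedFDeriv ℝ n (levyCF κ) u‖ ≤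
      n ! * Real.exp (-levyExp κ u) * (D ^ 2 * (1 + ‖u‖)) ^ n := by
  obtain ⟨hc, hb⟩ := contDiff_levyExp hD hint hmom n
  replace hc : ContDiff ℝ n (levyExp κ) := hc.of_le (by exact_mod_cast Nat.le_add_right n 2)
  have hce : ContDiff ℝ n (Real.exp ∘ (fun u => -levyExp κ u)) := Real.contDiff_exp.comp hc.neg
  have e : levyCF κ = Complex.ofRealLI ∘ (Real.exp ∘ (fun u => -levyExp κ u)) := rfl
  refine ⟨?_, fun u => ?_⟩
  · rw [e]; exact Complex.ofRealLI.toContinuousLinearMap.contDiff.comp hce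
  · rw [e, LinearIsometry.norm_iteratedFDeriv_comp_left Complex.ofRealLI hce.contDiffAt le_rfl]
    refine norm_iteratedFDeriv_comp_le (N := n) Real.contDiff_exp hc.neg le_rfl u
      (fun i _ => ?_) (fun i hi hin => ?_)
    · rw [norm_iteratedFDeriv_eq_norm_iteratedDeriv, iteratedDeriv_eq_iterate,
        Real.iter_deriv_exp, Real.norm_eq_abs, Real.abs_exp]
    · have : (fun u => -levyExp κ u) = -levyExp κ := rfl
      rw [this, iteratedFDeriv_neg, Pi.neg_apply, norm_neg]
      exact hb u i hi (by omega)

/-- If the Lévy exponents of a family of measures with uniformly bounded moments of orders `≥ 2`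
grow at least linearly, uniformly over the family, then the densities are smooth and
decay fast together with all their derivatives, again uniformly. -/
lemma exists_norm_fourier_levyCF_le {A c D : ℝ} (hc : 0 < c) (hD : 1 ≤ D) (n k : ℕ) :
    ∃ C : ℝ, ∀ κ : Measure V, (∀ n : ℕ, Integrable (fun x => ‖x‖ ^ (n + 2)) κ) →
      (∀ n : ℕ, ∫ x, ‖x‖ ^ (n + 2) ∂κ ≤ D ^ (n + 2)) →
      (∀ u, Real.exp (-levyExp κ u) ≤ A * Real.exp (-(c * ‖u‖))) →
      (Integrable (levyCF κ) ∧ ContDiff ℝ k (𝓕 (levyCF κ)) ∧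
        ∀ w, ‖w‖ ^ n * ‖iteratedFDeriv ℝ k (𝓕 (levyCF κ)) w‖ ≤ C) := by
  let d := Module.finrank ℝ V + 1
  choose S hS0 hS using fun m : ℕ => exists_pow_mul_exp_neg_le m hc
  let J : ℝ := ∫ v : V, (1 + ‖v‖) ^ (-(d : ℝ))
  have hJ : Integrable (fun v : V => (1 + ‖v‖) ^ (-(d : ℝ))) :=
    integrable_one_add_norm (by simp [d])
  let T : ℕ → ℕ → ℝ := fun p q => q ! * A * (D ^ 2) ^ q * S (p + q + d)
  refine ⟨(2 * Real.pi) ^ k * (2 * k + 2) ^ n *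
      ∑ p ∈ Finset.range (k + 1) ×ˢ Finset.range (n + 1), T p.1 p.2 * J, ?_⟩
  intro κ hint hmom hdec
  have hA : 0 ≤ A := by
    have := (Real.exp_pos _).le.trans (hdec 0)
    simpa using this
  have hcd : ∀ q : ℕ, ContDiff ℝ q (levyCF κ) := fun q =>
    (norm_iteratedFDeriv_levyCF_le hD hint hmom q).1
  have hcd' : ContDiff ℝ ((⊤ : ℕ∞) : ℕ∞ω) (levyCF κ) := contDiff_infty.2 hcd
  have key : ∀ (p q : ℕ) (v : V), ‖v‖ ^ p * ‖iteratedFDeriv ℝ q (levyCF κ) v‖ ≤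
      T p q * (1 + ‖v‖) ^ (-(d : ℝ)) := by
    intro p q v
    have hv := norm_nonneg v
    have h1 : 0 < 1 + ‖v‖ := by positivity
    rw [Real.rpow_neg h1.le, Real.rpow_natCast, ← div_eq_mul_inv, le_div_iff₀ (by positivity)]
    calc ‖v‖ ^ p * ‖iteratedFDeriv ℝ q (levyCF κ) v‖ * (1 + ‖v‖) ^ d
        ≤ (1 + ‖v‖) ^ p * (q ! * (A * Real.exp (-(c * ‖v‖))) * (D ^ 2 * (1 + ‖v‖)) ^ q) *
          (1 + ‖v‖) ^ d := by
          gcongr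
          · linarith
          · refine ((norm_iteratedFDeriv_levyCF_le hD hint hmom q).2 v).trans ?_
            gcongr
            exact hdec v
      _ = q ! * A * (D ^ 2) ^ q * ((1 + ‖v‖) ^ (p + q + d) * Real.exp (-(c * ‖v‖))) := by
          rw [mul_pow, pow_add, pow_add]; ring
      _ ≤ T p q := by
          simp only [T]
          gcongr
          exact hS _ _ hv
  have hI : ∀ p q : ℕ, Integrable (fun v : V => ‖v‖ ^ p * ‖iteratedFDeriv ℝ q (levyCF κ) v‖) :=
    fun p q => by
    refine (hJ.const_mul (T p q)).mono' (Continuous.aestronglyMeasurable ?_)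
      (Filter.Eventually.of_forall fun v => ?_)
    · exact (continuous_norm.pow p).mul ((hcd q).continuous_iteratedFDeriv le_rfl).norm
    · rw [Real.norm_eq_abs, abs_of_nonneg (by positivity)]
      exact key p q v
  refine ⟨?_, ?_, fun w => ?_⟩
  · have := hI 0 0
    simp only [pow_zero, one_mul, norm_iteratedFDeriv_zero] at this
    exact (integrable_norm_iff (hcd 0).continuous.aestronglyMeasurable).1 this
  · refine Real.contDiff_fourier (N := k) fun m _ => ?_
    have := hI m 0
    simpa only [norm_iteratedFDeriv_zero] using this
  · refine (Real.pow_mul_norm_iteratedFDeriv_fourier_le (K := ⊤) (N := ⊤) hcd'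
      (fun p q _ _ => hI p q) (by simp) (by simp) w).trans ?_
    gcongr with p _
    have e : T p.1 p.2 * J = ∫ v : V, T p.1 p.2 * (1 + ‖v‖) ^ (-(d : ℝ)) := by
      rw [integral_const_mul]
    rw [e]
    exact integral_mono (hI _ _) (hJ.const_mul _) fun v => key _ _ v

end SmoothDensity

section MixedDifference

/-- The Euclidean plane. -/
abbrev Plane := WithLp 2 (ℝ × ℝ)

/-- The point of the plane with coordinates `x` and `y`. -/
abbrev pt (x y : ℝ) : Plane := WithLp.toLp 2 (x, y)

lemma plane_ext {z w : Plane} (h1 : z.fst = w.fst) (h2 : z.snd = w.snd) : z = w :=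
  WithLp.ofLp_injective 2 (Prod.ext h1 h2)

/-- The Cauchy weight `1 / (1 + x²)`. -/
noncomputable def cauchyWeight (x : ℝ) : ℝ := (1 + x ^ 2)⁻¹

lemma cauchyWeight_pos (x : ℝ) : 0 < cauchyWeight x := by unfold cauchyWeight; positivity

lemma continuous_cauchyWeight : Continuous cauchyWeight := by
  unfold cauchyWeight
  exact (by fun_prop : Continuous fun x : ℝ => 1 + x ^ 2).inv₀ fun x => by positivity

lemma cauchyWeight_le_one (x : ℝ) : cauchyWeight x ≤ 1 := by
  unfold cauchyWeight
  exact inv_le_one_of_one_le₀ (by nlinarith [sq_nonneg x])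

lemma cauchyWeight_le_of_abs_sub_le {x t : ℝ} (h : |t - x| ≤ 1) :
    cauchyWeight t ≤ 3 * cauchyWeight x := by
  unfold cauchyWeight
  rw [← div_eq_mul_inv, le_div_iff₀ (by positivity), inv_mul_le_iff₀ (by positivity)]
  have := (sq_le_one_iff_abs_le_one (t - x)).2 h
  nlinarith [sq_nonneg (2 * t - x)]

lemma norm_sub_le_min_mul_cauchyWeight {f f' : ℝ → ℂ} (hf : ∀ x, HasDerivAt f (f' x) x) {A : ℝ}
    (h0 : ∀ x, ‖f x‖ ≤ A * cauchyWeight x) (h1 : ∀ x, ‖f' x‖ ≤ A * cauchyWeight x) (x a : ℝ) :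
    ‖f (x + a) - f x‖ ≤ 3 * A * min 1 |a| * (cauchyWeight x + cauchyWeight (x + a)) := by
  have hA : 0 ≤ A := by
    have := (norm_nonneg _).trans (h0 0)
    exact nonneg_of_mul_nonneg_left this (cauchyWeight_pos 0)
  have g1 := cauchyWeight_pos x
  have g2 := cauchyWeight_pos (x + a)
  rcases le_total |a| 1 with ha | ha
  · rw [min_eq_right ha]
    have := (convex_uIcc x (x + a)).norm_image_sub_le_of_norm_hasDerivWithin_le (f := f) (f' := f')
      (C := 3 * A * cauchyWeight x) (fun t _ => (hf t).hasDerivWithinAt) (fun t ht => by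
        have : |t - x| ≤ 1 := by
          refine (abs_sub_left_of_mem_uIcc ht).trans ?_
          simpa using ha
        calc ‖f' t‖ ≤ A * cauchyWeight t := h1 t
          _ ≤ A * (3 * cauchyWeight x) := by
              gcongr; exact cauchyWeight_le_of_abs_sub_le this
          _ = _ := by ring) left_mem_uIcc right_mem_uIcc
    refine this.trans ?_
    rw [show x + a - x = a by ring, Real.norm_eq_abs]
    have : 0 ≤ A * |a| * cauchyWeight (x + a) := by positivity
    nlinarith
  · rw [min_eq_left ha]
    have := norm_sub_le (f (x + a)) (f x)
    nlinarith [h0 x, h0 (x + a), mul_nonneg hA g1.le, mul_nonneg hA g2.le]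

/-- The mixed second difference of `h` at `z` with horizontal step `a.1` and vertical step
`a.2`. -/
noncomputable def mixedDiff (h : Plane → ℂ) (a z : Plane) : ℂ :=
  h (z + a) - h (z + pt a.fst 0) - h (z + pt 0 a.snd) + h z

/-- A mixed second difference gains a factor `min 1 |a₁| * min 1 |a₂|` if the function and its
partial derivatives up to the mixed one decay like the product of Cauchy weights. -/
lemma norm_mixedDiff_le {p : Plane → ℂ} (hp : ContDiff ℝ 2 p) {C : ℝ}
    (hb : ∀ k ≤ 2, ∀ z : Plane, ‖iteratedFDeriv ℝ k p z‖ ≤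
      C * cauchyWeight z.fst * cauchyWeight z.snd) (a z : Plane) :
    ‖mixedDiff p a z‖ ≤ 9 * C * (min 1 |a.fst| * min 1 |a.snd|) *
      ((cauchyWeight z.fst + cauchyWeight (z.fst + a.fst)) *
        (cauchyWeight z.snd + cauchyWeight (z.snd + a.snd))) := by
  have n1 : ‖pt 1 0‖ = 1 := by
    simp
  have n2 : ‖pt 0 1‖ = 1 := by
    simp
  have hp1 : ContDiff ℝ 1 (fderiv ℝ p) := hp.fderiv_right (by norm_num)
  have dp : ∀ z, HasFDerivAt p (fderiv ℝ p z) z := fun z =>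
    (hp.differentiable (by norm_num) z).hasFDerivAt
  have dp1 : ∀ z, HasFDerivAt (fderiv ℝ p) (fderiv ℝ (fderiv ℝ p) z) z := fun z =>
    (hp1.differentiable (by norm_num) z).hasFDerivAt
  have hx : ∀ x y : ℝ, HasDerivAt (fun x => pt x y) (pt 1 0) x := fun x y => by
    have h1 : (fun x => pt x y) = fun x => x • pt 1 0 + pt 0 y := by
      funext x; exact plane_ext (by simp) (by simp)
    rw [h1]
    simpa using ((hasDerivAt_id x).smul_const (pt 1 0)).add_const (pt 0 y)
  have hy : ∀ x y : ℝ, HasDerivAt (fun y => pt x y) (pt 0 1) y := fun x y => by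
    have h1 : (fun y => pt x y) = fun y => y • pt 0 1 + pt x 0 := by
      funext x; exact plane_ext (by simp) (by simp)
    rw [h1]
    simpa using ((hasDerivAt_id y).smul_const (pt 0 1)).add_const (pt x 0)
  have b0 : ∀ x y, ‖p (pt x y)‖ ≤ C * cauchyWeight x * cauchyWeight y := fun x y => by
    simpa using hb 0 (by norm_num) (pt x y)
  have b1 : ∀ x y, ‖fderiv ℝ p (pt x y)‖ ≤ C * cauchyWeight x * cauchyWeight y := fun x y => by
    simpa [← norm_iteratedFDeriv_fderiv] using hb 1 (by norm_num) (pt x y)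
  have b2 : ∀ x y, ‖fderiv ℝ (fderiv ℝ p) (pt x y)‖ ≤ C * cauchyWeight x * cauchyWeight y :=
    fun x y => by
    have := hb 2 le_rfl (pt x y)
    rw [← norm_iteratedFDeriv_fderiv, ← norm_iteratedFDeriv_fderiv] at this
    simpa using this
  obtain ⟨x, y⟩ := z
  obtain ⟨a, b⟩ := a
  have e : mixedDiff p (WithLp.toLp 2 (a, b)) (WithLp.toLp 2 (x, y)) =
      (p (pt (x + a) (y + b)) - p (pt (x + a) y)) - (p (pt x (y + b)) - p (pt x y)) := by
    simp only [mixedDiff, pt, WithLp.toLp_fst, WithLp.toLp_snd, ← WithLp.toLp_add, Prod.mk_add_mk,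
      add_zero]
    ring
  have step : ∀ x, ‖p (pt x (y + b)) - p (pt x y)‖ ≤
      3 * (C * cauchyWeight x) * min 1 |b| * (cauchyWeight y + cauchyWeight (y + b)) := fun x =>
    norm_sub_le_min_mul_cauchyWeight (f := fun y => p (pt x y))
      (f' := fun y => fderiv ℝ p (pt x y) (pt 0 1))
      (fun y => (dp _).comp_hasDerivAt y (hy x y)) (b0 x)
      (fun y => (ContinuousLinearMap.le_opNorm _ _).trans (by rw [n2, mul_one]; exact b1 x y)) y b
  have step' : ∀ x, ‖fderiv ℝ p (pt x (y + b)) (pt 1 0) - fderiv ℝ p (pt x y) (pt 1 0)‖ ≤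
      3 * (C * cauchyWeight x) * min 1 |b| * (cauchyWeight y + cauchyWeight (y + b)) := fun x =>
    norm_sub_le_min_mul_cauchyWeight (f := fun y => fderiv ℝ p (pt x y) (pt 1 0))
      (f' := fun y => fderiv ℝ (fderiv ℝ p) (pt x y) (pt 0 1) (pt 1 0))
      (fun y => by
        have := ((dp1 _).comp_hasDerivAt y (hy x y)).clm_apply (hasDerivAt_const y (pt 1 0))
        simpa using this)
      (fun y => (ContinuousLinearMap.le_opNorm _ _).trans (by rw [n1, mul_one]; exact b1 x y))
      (fun y => (ContinuousLinearMap.le_opNorm _ _).trans (by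
        rw [n1, mul_one]
        exact (ContinuousLinearMap.le_opNorm _ _).trans (by rw [n2, mul_one]; exact b2 x y))) y b
  rw [e]
  have := norm_sub_le_min_mul_cauchyWeight (f := fun x => p (pt x (y + b)) - p (pt x y))
    (f' := fun x => fderiv ℝ p (pt x (y + b)) (pt 1 0) - fderiv ℝ p (pt x y) (pt 1 0))
    (A := 3 * C * min 1 |b| * (cauchyWeight y + cauchyWeight (y + b)))
    (fun x => ((dp _).comp_hasDerivAt x (hx x _)).sub ((dp _).comp_hasDerivAt x (hx x y)))
    (fun x => (step x).trans_eq (by ring)) (fun x => (step' x).trans_eq (by ring)) x a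
  refine this.trans_eq ?_
  simp only [WithLp.toLp_fst, WithLp.toLp_snd]
  ring

end MixedDifference

/-! ### Compound Poisson laws -/

section CompoundPoisson

open scoped RealInnerProductSpace Nat ENNReal

variable {V : Type} [NormedAddCommGroup V] [InnerProductSpace ℝ V] [FiniteDimensional ℝ V]
  [MeasurableSpace V] [BorelSpace V]

/-- The convolution powers of a measure. -/
noncomputable def convPow (κ : Measure V) : ℕ → Measure V
  | 0 => Measure.dirac 0
  | n + 1 => κ.conv (convPow κ n)

instance isFiniteMeasure_convPow (κ : Measure V) [IsFiniteMeasure κ] (n : ℕ) :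
    IsFiniteMeasure (convPow κ n) := by
  induction n with
  | zero => unfold convPow; infer_instance
  | succ n ih => unfold convPow; infer_instance

lemma charFun_convPow (κ : Measure V) [IsFiniteMeasure κ] (n : ℕ) (u : V) :
    charFun (convPow κ n) u = charFun κ u ^ n := by
  induction n with
  | zero => simp [convPow, charFun_dirac]
  | succ n ih => rw [convPow, charFun_conv, ih, pow_succ']

lemma lintegral_convPow_le (κ : Measure V) [IsFiniteMeasure κ] {w : V → ℝ≥0∞} (hw : Measurable w)
    (hw0 : w 0 ≤ 1) (hws : ∀ x y, w (x + y) ≤ w x * w y) (n : ℕ) :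
    ∫⁻ x, w x ∂(convPow κ n) ≤ (∫⁻ x, w x ∂κ) ^ n := by
  induction n with
  | zero => simpa [convPow, lintegral_dirac' _ hw] using hw0
  | succ n ih =>
    rw [convPow, Measure.lintegral_conv hw]
    calc ∫⁻ x, ∫⁻ y, w (x + y) ∂(convPow κ n) ∂κ
        ≤ ∫⁻ x, ∫⁻ y, w x * w y ∂(convPow κ n) ∂κ := by gcongr; exact hws _ _
      _ = (∫⁻ x, w x ∂κ) * ∫⁻ y, w y ∂(convPow κ n) := by
          simp_rw [lintegral_const_mul _ hw]
          rw [lintegral_mul_const _ hw]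
      _ ≤ (∫⁻ x, w x ∂κ) ^ (n + 1) := by rw [pow_succ']; gcongr

/-- The compound Poisson law with Lévy measure `κ`. -/
noncomputable def compoundPoisson (κ : Measure V) : Measure V :=
  ENNReal.ofReal (Real.exp (-κ.real univ)) •
    Measure.sum fun n : ℕ => ENNReal.ofReal (1 / n !) • convPow κ n

/-- Submultiplicative weights that are integrable for the Lévy measure are integrable for the
compound Poisson law. -/
lemma lintegral_compoundPoisson_le (κ : Measure V) [IsFiniteMeasure κ] {w : V → ℝ≥0∞}
    (hw : Measurable w) (hw0 : w 0 ≤ 1) (hws : ∀ x y, w (x + y) ≤ w x * w y) {W : ℝ} (hW : 0 ≤ W)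
    (hκ : ∫⁻ x, w x ∂κ ≤ ENNReal.ofReal W) :
    ∫⁻ x, w x ∂(compoundPoisson κ) ≤ ENNReal.ofReal (Real.exp W) := by
  have hs : HasSum (fun n : ℕ => W ^ n / n !) (Real.exp W) := by
    rw [Real.exp_eq_exp_ℝ]; exact NormedSpace.expSeries_div_hasSum_exp W
  rw [compoundPoisson, lintegral_smul_measure, lintegral_sum_measure, smul_eq_mul]
  calc _ ≤ 1 * ∑' n : ℕ, ENNReal.ofReal (W ^ n / n !) := by
        gcongr with n
        · exact ENNReal.ofReal_le_one.2 (Real.exp_le_one_iff.2 (by simp))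
        · rw [lintegral_smul_measure, smul_eq_mul, div_eq_mul_one_div (W ^ n), mul_comm (W ^ n),
            ENNReal.ofReal_mul (by positivity), ENNReal.ofReal_pow hW]
          exact mul_le_mul_right ((lintegral_convPow_le κ hw hw0 hws n).trans (by gcongr)) _
    _ = ENNReal.ofReal (Real.exp W) := by
        rw [one_mul, ← ENNReal.ofReal_tsum_of_nonneg (fun n => by positivity) hs.summable,
          hs.tsum_eq]

instance isFiniteMeasure_compoundPoisson (κ : Measure V) [IsFiniteMeasure κ] :
    IsFiniteMeasure (compoundPoisson κ) := by
  refine ⟨?_⟩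
  have := lintegral_compoundPoisson_le κ (w := fun _ => 1) measurable_const le_rfl (by simp)
    (W := κ.real univ) (by simp) (by simp)
  rw [lintegral_one] at this
  exact this.trans_lt ENNReal.ofReal_lt_top

lemma charFun_compoundPoisson (κ : Measure V) [IsFiniteMeasure κ] (u : V) :
    charFun (compoundPoisson κ) u = Complex.exp (charFun κ u - κ.real univ) := by
  have hfin : IsFiniteMeasure
      (Measure.sum fun n : ℕ => ENNReal.ofReal (1 / n !) • convPow κ n) := by
    have h1 : (ENNReal.ofReal (Real.exp (-κ.real univ))) ≠ 0 := by
      simpa using Real.exp_pos _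
    have h2 := measure_lt_top (compoundPoisson κ) univ
    rw [compoundPoisson, Measure.smul_apply, smul_eq_mul] at h2
    exact ⟨ENNReal.lt_top_of_mul_ne_top_right h2.ne h1⟩
  have hint : Integrable (fun x : V => Complex.exp (⟪x, u⟫ * Complex.I))
      (Measure.sum fun n : ℕ => ENNReal.ofReal (1 / n !) • convPow κ n) :=
    (integrable_const (1 : ℝ)).mono' (Continuous.aestronglyMeasurable (by fun_prop))
      (Filter.Eventually.of_forall fun x => by rw [Complex.norm_exp_ofReal_mul_I])
  have h1 := hasSum_integral_measure hint
  have h2 : HasSum (fun n : ℕ => charFun κ u ^ n / n !) (Complex.exp (charFun κ u)) := by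
    rw [Complex.exp_eq_exp_ℂ]; exact NormedSpace.expSeries_div_hasSum_exp _
  have h3 : (fun n : ℕ => ∫ x, Complex.exp (⟪x, u⟫ * Complex.I)
      ∂(ENNReal.ofReal (1 / n !) • convPow κ n)) = fun n : ℕ => charFun κ u ^ n / n ! := by
    funext n
    rw [integral_smul_measure, ← charFun_apply, charFun_convPow,
      ENNReal.toReal_ofReal (by positivity), Complex.real_smul]
    push_cast; ring
  rw [h3] at h1
  rw [charFun_apply, compoundPoisson, integral_smul_measure, h1.unique h2,
    ENNReal.toReal_ofReal (Real.exp_pos _).le, Complex.real_smul, Complex.ofReal_exp,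
    ← Complex.exp_add]
  congr 1
  push_cast; ring

end CompoundPoisson

/-! ### The Lévy measure of a stable law -/

section LevyMeasure

open scoped RealInnerProductSpace ENNReal

lemma integrableOn_one_sub_cos_mul_rpow {α : ℝ} (hα : 0 < α) (hα' : α < 2) :
    IntegrableOn (fun r : ℝ => (1 - Real.cos r) * r ^ (-1 - α)) (Ioi 0) := by
  have hm : Measurable fun r : ℝ => (1 - Real.cos r) * r ^ (-1 - α) := by fun_prop
  rw [← Ioc_union_Ioi_eq_Ioi zero_le_one]
  refine IntegrableOn.union ?_ ?_
  · have h1 : IntegrableOn (fun r : ℝ => r ^ (1 - α)) (Ioc 0 1) :=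
      (intervalIntegrable_iff_integrableOn_Ioc_of_le zero_le_one).1
        (intervalIntegral.intervalIntegrable_rpow' (by linarith))
    refine h1.mono' hm.aestronglyMeasurable
      ((ae_restrict_iff' measurableSet_Ioc).2 (Filter.Eventually.of_forall fun r hr => ?_))
    have hc := sub_nonneg.2 (Real.cos_le_one r)
    have hp := Real.rpow_nonneg hr.1.le (-1 - α)
    rw [Real.norm_eq_abs, abs_of_nonneg (mul_nonneg hc hp)]
    calc (1 - Real.cos r) * r ^ (-1 - α) ≤ r ^ 2 * r ^ (-1 - α) := by
          gcongr; exact one_sub_cos_le_sq r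
      _ = r ^ (1 - α) := by
          rw [← Real.rpow_natCast, ← Real.rpow_add hr.1]; congr 1; push_cast; ring
  · have h1 : IntegrableOn (fun r : ℝ => 2 * r ^ (-1 - α)) (Ioi 1) :=
      (integrableOn_Ioi_rpow_of_lt (by linarith) one_pos).const_mul 2
    refine h1.mono' hm.aestronglyMeasurable
      ((ae_restrict_iff' measurableSet_Ioi).2 (Filter.Eventually.of_forall fun r hr => ?_))
    have hc := sub_nonneg.2 (Real.cos_le_one r)
    have hp := Real.rpow_nonneg (zero_le_one.trans (le_of_lt hr)) (-1 - α)
    rw [Real.norm_eq_abs, abs_of_nonneg (mul_nonneg hc hp)]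
    gcongr
    linarith [Real.neg_one_le_cos r]

/-- The normalising constant `∫ (1 - cos r) r^(-1-α) dr` over the half-line. -/
noncomputable def levyConst (α : ℝ) : ℝ := ∫ r in Ioi (0 : ℝ), (1 - Real.cos r) * r ^ (-1 - α)

lemma levyConst_pos {α : ℝ} (hα : 0 < α) (hα' : α < 2) : 0 < levyConst α := by
  rw [levyConst, integral_pos_iff_support_of_nonneg_ae _
    (integrableOn_one_sub_cos_mul_rpow hα hα')]
  · rw [Measure.restrict_apply' measurableSet_Ioi]
    refine lt_of_lt_of_le (b := volume (Ioo (0 : ℝ) 1)) (by simp) (measure_mono fun r hr => ?_)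
    refine ⟨?_, hr.1⟩
    rw [Function.mem_support]
    have h1 : Real.cos r < 1 := by
      have := Real.cos_lt_cos_of_nonneg_of_le_pi le_rfl
        (hr.2.le.trans (by linarith [Real.pi_gt_three])) hr.1
      simpa using this
    exact mul_ne_zero (by linarith) (Real.rpow_pos_of_pos hr.1 _).ne'
  · refine (ae_restrict_iff' measurableSet_Ioi).2 (Filter.Eventually.of_forall fun r hr => ?_)
    exact mul_nonneg (sub_nonneg.2 (Real.cos_le_one r)) (Real.rpow_nonneg (le_of_lt hr) _)

/-- The radial part of the Lévy measure of an `α`-stable law, normalised such that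
`∫ (1 - cos (r z)) = |z|^α`. -/
noncomputable def radialLevy (α : ℝ) : Measure ℝ :=
  (volume.restrict (Ioi 0)).withDensity fun r => ENNReal.ofReal (r ^ (-1 - α) / levyConst α)

instance sFinite_radialLevy (α : ℝ) : SFinite (radialLevy α) := by
  unfold radialLevy; infer_instance

lemma ae_radialLevy_pos (α : ℝ) : ∀ᵐ r ∂(radialLevy α), 0 < r :=
  (withDensity_absolutelyContinuous _ _).ae_le (ae_restrict_mem measurableSet_Ioi)

lemma integral_radialLevy_one_sub_cos {α : ℝ} (hα : 0 < α) (hα' : α < 2) (z : ℝ) :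
    ∫ r, (1 - Real.cos (r * z)) ∂(radialLevy α) = |z| ^ α := by
  have hI := levyConst_pos hα hα'
  have hz : ∀ r, Real.cos (r * z) = Real.cos (r * |z|) := fun r => by
    rcases abs_cases z with h | h <;> simp [h.1]
  simp_rw [hz]
  rcases (abs_nonneg z).eq_or_lt' with h | h
  · rw [h]; simp [Real.zero_rpow hα.ne']
  rw [radialLevy, integral_withDensity_eq_integral_toReal_smul (by fun_prop) (by simp)]
  have h1 := integral_comp_mul_right_Ioi (fun r => (1 - Real.cos r) * r ^ (-1 - α)) 0 h
  rw [zero_mul, ← levyConst] at h1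
  calc _ = ∫ r in Ioi (0 : ℝ), (|z| ^ (1 + α) / levyConst α) *
        ((1 - Real.cos (r * |z|)) * (r * |z|) ^ (-1 - α)) := by
        refine setIntegral_congr_fun measurableSet_Ioi fun r hr => ?_
        have hr : 0 < r := hr
        simp only [smul_eq_mul]
        rw [ENNReal.toReal_ofReal (by positivity), Real.mul_rpow hr.le h.le,
          show (-1 - α : ℝ) = -(1 + α) by ring, Real.rpow_neg h.le]
        field_simp
    _ = |z| ^ α := by
        rw [integral_const_mul, h1, smul_eq_mul, Real.rpow_add h, Real.rpow_one]
        field_simp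

/-- Power functions with exponent above `α` near the origin and below `α` at infinity have
finite integral with respect to the radial Lévy measure. -/
lemma lintegral_radialLevy_lt_top {α s t : ℝ} (hs : α < s) (ht : t < α) :
    ∫⁻ r, ENNReal.ofReal (if r ≤ 1 then r ^ s else r ^ t) ∂(radialLevy α) < ⊤ := by
  have hmes : Measurable fun r : ℝ => ENNReal.ofReal (if r ≤ 1 then r ^ s else r ^ t) :=
    (Measurable.ite measurableSet_Iic (by fun_prop) (by fun_prop)).ennreal_ofReal
  rw [radialLevy, lintegral_withDensity_eq_lintegral_mul _ (by fun_prop) hmes,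
    ← Ioc_union_Ioi_eq_Ioi zero_le_one]
  refine (lintegral_union_le _ _ _).trans_lt (ENNReal.add_lt_top.2 ⟨?_, ?_⟩)
  · have h1 : IntegrableOn (fun r : ℝ => r ^ (s - 1 - α) / levyConst α) (Ioc 0 1) :=
      ((intervalIntegrable_iff_integrableOn_Ioc_of_le zero_le_one).1
        (intervalIntegral.intervalIntegrable_rpow' (by linarith))).div_const _
    refine lt_of_le_of_lt ?_ h1.lintegral_lt_top
    refine setLIntegral_mono' measurableSet_Ioc fun r hr => ?_
    rw [Pi.mul_apply, if_pos hr.2, mul_comm, ← ENNReal.ofReal_mul (Real.rpow_nonneg hr.1.le _),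
      ← mul_div_assoc, ← Real.rpow_add hr.1]
    apply le_of_eq; congr 3; ring
  · have h1 : IntegrableOn (fun r : ℝ => r ^ (t - 1 - α) / levyConst α) (Ioi 1) :=
      (integrableOn_Ioi_rpow_of_lt (by linarith) one_pos).div_const _
    refine lt_of_le_of_lt ?_ h1.lintegral_lt_top
    refine setLIntegral_mono' measurableSet_Ioi fun r hr => ?_
    have h0 : (0 : ℝ) < r := one_pos.trans hr
    rw [Pi.mul_apply, if_neg (not_le.2 hr), mul_comm,
      ← ENNReal.ofReal_mul (Real.rpow_nonneg h0.le _), ← mul_div_assoc, ← Real.rpow_add h0]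
    apply le_of_eq; congr 3; ring

/-- The polar product of a radial measure and a spectral measure. -/
noncomputable def polar (ν : Measure ℝ) (Γ : Measure Plane) : Measure Plane :=
  (ν.prod Γ).map fun p => p.1 • p.2

lemma lintegral_polar {ν : Measure ℝ} [SFinite ν] {Γ : Measure Plane} [SFinite Γ]
    {F : Plane → ℝ≥0∞} (hF : Measurable F) :
    ∫⁻ x, F x ∂(polar ν Γ) = ∫⁻ θ, ∫⁻ r, F (r • θ) ∂ν ∂Γ := by
  rw [polar, lintegral_map hF (by fun_prop), lintegral_prod_symm]
  fun_prop

instance sFinite_polar (ν : Measure ℝ) [SFinite ν] (Γ : Measure Plane) [SFinite Γ] :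
    SFinite (polar ν Γ) := by
  unfold polar; infer_instance

lemma polar_add {ν₁ ν₂ : Measure ℝ} [SFinite ν₁] [SFinite ν₂] {Γ : Measure Plane} [SFinite Γ] :
    polar (ν₁ + ν₂) Γ = polar ν₁ Γ + polar ν₂ Γ := by
  unfold polar
  rw [Measure.add_prod, Measure.map_add _ _ (by fun_prop)]

/-- The restriction of the radial Lévy measure to jumps of size at most one. -/
noncomputable def radialSmall (α : ℝ) : Measure ℝ := (radialLevy α).restrict (Iic 1)

/-- The restriction of the radial Lévy measure to jumps of size larger than one. -/
noncomputable def radialLarge (α : ℝ) : Measure ℝ := (radialLevy α).restrict (Ioi 1)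

instance sFinite_radialSmall (α : ℝ) : SFinite (radialSmall α) := by
  unfold radialSmall; infer_instance

instance sFinite_radialLarge (α : ℝ) : SFinite (radialLarge α) := by
  unfold radialLarge; infer_instance

lemma radialLevy_eq_add (α : ℝ) : radialLevy α = radialSmall α + radialLarge α := by
  unfold radialSmall radialLarge
  rw [← compl_Iic, Measure.restrict_add_restrict_compl measurableSet_Iic]

/-- The constant `∫ (r^s ∧ r^t)` (switching at `r = 1`) of the radial Lévy measure. -/
noncomputable def radialMoment (α s t : ℝ) : ℝ :=
  (∫⁻ r, ENNReal.ofReal (if r ≤ 1 then r ^ s else r ^ t) ∂(radialLevy α)).toReal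

lemma lintegral_radial_le {α s t : ℝ} (hs : α < s) (ht : t < α) {F : ℝ → ℝ≥0∞} {A : ℝ≥0∞}
    (h1 : ∀ r, 0 < r → r ≤ 1 → F r ≤ A * ENNReal.ofReal (r ^ s))
    (h2 : ∀ r, 1 < r → F r ≤ A * ENNReal.ofReal (r ^ t)) :
    ∫⁻ r, F r ∂(radialLevy α) ≤ A * ENNReal.ofReal (radialMoment α s t) := by
  rw [radialMoment, ENNReal.ofReal_toReal (lintegral_radialLevy_lt_top hs ht).ne,
    ← lintegral_const_mul]
  · refine lintegral_mono_ae ((ae_radialLevy_pos α).mono fun r hr => ?_)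
    split_ifs with h
    · exact h1 r hr h
    · exact h2 r (not_le.1 h)
  · exact (Measurable.ite measurableSet_Iic (by fun_prop) (by fun_prop)).ennreal_ofReal

/-- The exponent `∫ |⟪θ, u⟫|^α dΓ(θ)` of the symmetric `α`-stable law with spectral
measure `Γ`. -/
noncomputable def stableExp (α : ℝ) (Γ : Measure Plane) (u : Plane) : ℝ :=
  ∫ θ, |⟪θ, u⟫| ^ α ∂Γ

lemma norm_le_two_of_abs_le_one {θ : Plane} (h1 : |θ.fst| ≤ 1) (h2 : |θ.snd| ≤ 1) : ‖θ‖ ≤ 2 := by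
  have h := WithLp.prod_norm_sq_eq_of_L2 θ
  rw [Real.norm_eq_abs, Real.norm_eq_abs] at h
  nlinarith [abs_nonneg θ.fst, abs_nonneg θ.snd, norm_nonneg θ]

lemma integrable_one_sub_cos_polar {α : ℝ} (hα : 0 < α) (hα' : α < 2) {Γ : Measure Plane}
    [IsFiniteMeasure Γ] (hΓ : ∀ᵐ θ ∂Γ, |θ.fst| ≤ 1 ∧ |θ.snd| ≤ 1) (u : Plane) :
    Integrable (fun x => 1 - Real.cos ⟪x, u⟫) (polar (radialLevy α) Γ) := by
  refine ⟨Continuous.aestronglyMeasurable (by fun_prop), ?_⟩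
  rw [hasFiniteIntegral_iff_ofReal
    (Filter.Eventually.of_forall fun x => sub_nonneg.2 (Real.cos_le_one _)),
    lintegral_polar (by fun_prop)]
  have h2 : ∀ᵐ θ ∂Γ, ∫⁻ r, ENNReal.ofReal (1 - Real.cos ⟪r • θ, u⟫) ∂(radialLevy α) ≤
      ENNReal.ofReal (2 + (2 * ‖u‖) ^ 2) * ENNReal.ofReal (radialMoment α 2 0) := by
    filter_upwards [hΓ] with θ hθ
    have hn := norm_le_two_of_abs_le_one hθ.1 hθ.2
    refine lintegral_radial_le hα' hα (fun r hr _ => ?_) (fun r hr => ?_)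
    · rw [← ENNReal.ofReal_mul (by positivity)]
      refine ENNReal.ofReal_le_ofReal ((one_sub_cos_le_sq _).trans ?_)
      have h3 : |⟪r • θ, u⟫| ≤ r * (2 * ‖u‖) := by
        refine (abs_real_inner_le_norm _ _).trans ?_
        rw [norm_smul, Real.norm_eq_abs, abs_of_pos hr, mul_assoc]
        gcongr
      rw [← sq_abs, Real.rpow_two]
      calc |⟪r • θ, u⟫| ^ 2 ≤ (r * (2 * ‖u‖)) ^ 2 := by gcongr
        _ ≤ (2 + (2 * ‖u‖) ^ 2) * r ^ 2 := by nlinarith [sq_nonneg r]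
    · rw [Real.rpow_zero, ENNReal.ofReal_one, mul_one]
      refine ENNReal.ofReal_le_ofReal ?_
      nlinarith [Real.neg_one_le_cos ⟪r • θ, u⟫, sq_nonneg (2 * ‖u‖)]
  refine (lintegral_mono_ae h2).trans_lt ?_
  rw [lintegral_const]
  exact ENNReal.mul_lt_top (ENNReal.mul_lt_top ENNReal.ofReal_lt_top ENNReal.ofReal_lt_top)
    (measure_lt_top _ _)

lemma levyExp_polar_radialLevy {α : ℝ} (hα : 0 < α) (hα' : α < 2) {Γ : Measure Plane}
    [IsFiniteMeasure Γ] (hΓ : ∀ᵐ θ ∂Γ, |θ.fst| ≤ 1 ∧ |θ.snd| ≤ 1) (u : Plane) :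
    levyExp (polar (radialLevy α) Γ) u = stableExp α Γ u := by
  have h := integrable_one_sub_cos_polar hα hα' hΓ u
  unfold polar at h
  have h' : Integrable (fun p : ℝ × Plane => 1 - Real.cos ⟪p.1 • p.2, u⟫)
      ((radialLevy α).prod Γ) := h.comp_measurable (by fun_prop)
  rw [levyExp, polar, integral_map (by fun_prop) h.aestronglyMeasurable,
    integral_prod_symm _ h', stableExp]
  congr 1
  funext θ
  rw [← integral_radialLevy_one_sub_cos hα hα']
  simp only [real_inner_smul_left]

lemma stableExp_eq_levyExp_add {α : ℝ} (hα : 0 < α) (hα' : α < 2) {Γ : Measure Plane}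
    [IsFiniteMeasure Γ] (hΓ : ∀ᵐ θ ∂Γ, |θ.fst| ≤ 1 ∧ |θ.snd| ≤ 1) (u : Plane) :
    stableExp α Γ u = levyExp (polar (radialSmall α) Γ) u +
      levyExp (polar (radialLarge α) Γ) u := by
  have h := integrable_one_sub_cos_polar hα hα' hΓ u
  rw [← levyExp_polar_radialLevy hα hα' hΓ]
  rw [radialLevy_eq_add, polar_add] at h ⊢
  exact integral_add_measure (h.mono_measure (Measure.le_add_right le_rfl))
    (h.mono_measure (Measure.le_add_left le_rfl))

end LevyMeasure

/-! ### Splitting into small and large jumps -/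

section UniformDensity

open scoped RealInnerProductSpace ENNReal ContDiff FourierTransform

/-- A spectral measure in the unit square with mass at most `M` whose stable exponent dominates
`c` times the one of a pair of independent components. -/
structure IsSpectral (α M c : ℝ) (Γ : Measure Plane) : Prop where
  mass : Γ univ ≤ ENNReal.ofReal M
  bdd : ∀ᵐ θ ∂Γ, |θ.fst| ≤ 1 ∧ |θ.snd| ≤ 1
  lower : ∀ u : Plane, c * (|u.fst| ^ α + |u.snd| ^ α) ≤ stableExp α Γ u

lemma IsSpectral.isFiniteMeasure {α M c : ℝ} {Γ : Measure Plane} (h : IsSpectral α M c Γ) :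
    IsFiniteMeasure Γ := ⟨h.mass.trans_lt ENNReal.ofReal_lt_top⟩

lemma lintegral_radialSmall_le {α s : ℝ} (hα : 0 < α) (hs : α < s) {F : ℝ → ℝ≥0∞} {A : ℝ≥0∞}
    (h1 : ∀ r, 0 < r → r ≤ 1 → F r ≤ A * ENNReal.ofReal (r ^ s)) :
    ∫⁻ r, F r ∂(radialSmall α) ≤ A * ENNReal.ofReal (radialMoment α s 0) := by
  rw [radialSmall, ← lintegral_indicator measurableSet_Iic]
  refine lintegral_radial_le hs hα (fun r hr hr1 => ?_) (fun r hr => ?_)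
  · rw [indicator_of_mem (mem_Iic.2 hr1)]; exact h1 r hr hr1
  · rw [indicator_of_notMem (by simpa using hr)]; simp

lemma lintegral_radialLarge_le {α t : ℝ} (ht : t < α) {F : ℝ → ℝ≥0∞} {A : ℝ≥0∞}
    (h1 : ∀ r, 1 < r → F r ≤ A * ENNReal.ofReal (r ^ t)) :
    ∫⁻ r, F r ∂(radialLarge α) ≤ A * ENNReal.ofReal (radialMoment α (α + 1) t) := by
  rw [radialLarge, ← lintegral_indicator measurableSet_Ioi]
  refine lintegral_radial_le (by linarith) ht (fun r hr hr1 => ?_) (fun r hr => ?_)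
  · rw [indicator_of_notMem (by simpa using hr1)]; simp
  · rw [indicator_of_mem (mem_Ioi.2 hr)]; exact h1 r hr

lemma radialMoment_nonneg (α s t : ℝ) : 0 ≤ radialMoment α s t := ENNReal.toReal_nonneg

/-- The part of the Lévy measure with jumps of size at most one, dilated by `2π` so as to match
the normalisation of the Fourier transform. -/
noncomputable def smallLevy (α : ℝ) (Γ : Measure Plane) : Measure Plane :=
  (polar (radialSmall α) Γ).map fun x => (2 * Real.pi) • x

lemma levyExp_smallLevy (α : ℝ) (Γ : Measure Plane) (u : Plane) :
    levyExp (smallLevy α Γ) u = levyExp (polar (radialSmall α) Γ) ((2 * Real.pi) • u) := by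
  unfold levyExp smallLevy
  rw [integral_map (by fun_prop) (Continuous.aestronglyMeasurable (by fun_prop))]
  simp only [real_inner_smul_left, real_inner_smul_right]

lemma lintegral_smallLevy_le {α M c : ℝ} (hα : 0 < α) (hα' : α < 2) {Γ : Measure Plane}
    (hΓ : IsSpectral α M c Γ) (n : ℕ) :
    ∫⁻ x, ENNReal.ofReal (‖x‖ ^ (n + 2)) ∂(smallLevy α Γ) ≤
      ENNReal.ofReal ((4 * Real.pi * max 1 (radialMoment α 2 0 * M)) ^ (n + 2)) := by
  have := hΓ.isFiniteMeasure
  have hpi := Real.pi_pos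
  have hm := radialMoment_nonneg α 2 0
  rw [smallLevy, lintegral_map (by fun_prop) (by fun_prop), lintegral_polar (by fun_prop)]
  calc ∫⁻ θ, ∫⁻ r, ENNReal.ofReal (‖(2 * Real.pi) • r • θ‖ ^ (n + 2)) ∂(radialSmall α) ∂Γ
      ≤ ∫⁻ _, ENNReal.ofReal ((4 * Real.pi) ^ (n + 2)) *
          ENNReal.ofReal (radialMoment α 2 0) ∂Γ := by
        refine lintegral_mono_ae (hΓ.bdd.mono fun θ hθ => ?_)
        refine lintegral_radialSmall_le hα hα' fun r hr hr1 => ?_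
        rw [← ENNReal.ofReal_mul (by positivity)]
        refine ENNReal.ofReal_le_ofReal ?_
        have hn := norm_le_two_of_abs_le_one hθ.1 hθ.2
        rw [norm_smul, norm_smul, Real.norm_eq_abs, Real.norm_eq_abs, abs_of_pos hr,
          abs_of_pos (by positivity)]
        calc (2 * Real.pi * (r * ‖θ‖)) ^ (n + 2) ≤ (2 * Real.pi * (r * 2)) ^ (n + 2) := by gcongr
          _ = (4 * Real.pi) ^ (n + 2) * (r ^ n * r ^ 2) := by rw [← pow_add, ← mul_pow]; ring
          _ ≤ (4 * Real.pi) ^ (n + 2) * (1 * r ^ 2) := by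
              gcongr; exact pow_le_one₀ hr.le hr1
          _ = _ := by rw [one_mul, Real.rpow_two]
    _ ≤ ENNReal.ofReal ((4 * Real.pi) ^ (n + 2)) * ENNReal.ofReal (radialMoment α 2 0) *
          ENNReal.ofReal M := by
        rw [lintegral_const]; gcongr; exact hΓ.mass
    _ ≤ _ := by
        rw [mul_assoc, ← ENNReal.ofReal_mul hm, ← ENNReal.ofReal_mul (by positivity),
          mul_pow (4 * Real.pi) (max _ _)]
        refine ENNReal.ofReal_le_ofReal ?_
        gcongr
        exact (le_max_right _ _).trans (le_self_pow₀ (le_max_left _ _) (by omega))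

lemma polar_radialLarge_univ_le {α M c : ℝ} (hα : 0 < α) {Γ : Measure Plane}
    (hΓ : IsSpectral α M c Γ) :
    polar (radialLarge α) Γ univ ≤ ENNReal.ofReal (radialMoment α (α + 1) 0 * M) := by
  have := hΓ.isFiniteMeasure
  rw [← lintegral_one, lintegral_polar measurable_const,
    ENNReal.ofReal_mul (radialMoment_nonneg _ _ _)]
  calc ∫⁻ _, ∫⁻ _, (1 : ℝ≥0∞) ∂(radialLarge α) ∂Γ
      ≤ ∫⁻ _, 1 * ENNReal.ofReal (radialMoment α (α + 1) 0) ∂Γ := by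
        refine lintegral_mono fun θ => lintegral_radialLarge_le hα fun r hr => ?_
        simp
    _ ≤ _ := by
        rw [lintegral_const, one_mul]; gcongr; exact hΓ.mass

lemma IsSpectral.isFiniteMeasure_large {α M c : ℝ} (hα : 0 < α) {Γ : Measure Plane}
    (hΓ : IsSpectral α M c Γ) : IsFiniteMeasure (polar (radialLarge α) Γ) :=
  ⟨(polar_radialLarge_univ_le hα hΓ).trans_lt ENNReal.ofReal_lt_top⟩

lemma IsSpectral.mass_nonneg {α M c : ℝ} (hα : 0 < α) (hc : 0 < c) {Γ : Measure Plane}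
    (hΓ : IsSpectral α M c Γ) : 0 ≤ M := by
  by_contra hM
  have h0 : Γ = 0 := by
    have := hΓ.mass
    rw [ENNReal.ofReal_of_nonpos (not_le.1 hM).le] at this
    exact Measure.measure_univ_eq_zero.1 (le_antisymm this bot_le)
  have := hΓ.lower (pt 1 0)
  simp [h0, stableExp, Real.zero_rpow hα.ne'] at this
  linarith

lemma levyExp_le_two_mul {κ : Measure Plane} [IsFiniteMeasure κ] (u : Plane) :
    levyExp κ u ≤ 2 * κ.real univ := by
  unfold levyExp
  calc ∫ x, (1 - Real.cos ⟪x, u⟫) ∂κ ≤ ∫ _, (2 : ℝ) ∂κ := by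
        refine integral_mono_of_nonneg
          (Filter.Eventually.of_forall fun x => sub_nonneg.2 (Real.cos_le_one _))
          (integrable_const _) (Filter.Eventually.of_forall fun x => ?_)
        simp only
        linarith [Real.neg_one_le_cos ⟪x, u⟫]
    _ = 2 * κ.real univ := by rw [integral_const, smul_eq_mul, mul_comm]

lemma abs_sub_one_le_rpow {α : ℝ} (hα : 1 ≤ α) (x : ℝ) : |x| - 1 ≤ |x| ^ α := by
  rcases le_total |x| 1 with h | h
  · exact (sub_nonpos.2 h).trans (Real.rpow_nonneg (abs_nonneg _) _)
  · have := Real.rpow_le_rpow_of_exponent_le h hα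
    rw [Real.rpow_one] at this
    linarith

lemma norm_le_abs_add_abs (u : Plane) : ‖u‖ ≤ |u.fst| + |u.snd| := by
  have h := WithLp.prod_norm_sq_eq_of_L2 u
  rw [Real.norm_eq_abs, Real.norm_eq_abs] at h
  refine abs_le_of_sq_le_sq' ?_ (by positivity) |>.2
  nlinarith [abs_nonneg u.fst, abs_nonneg u.snd]

lemma IsSpectral.le_stableExp_two_pi_smul {α M c : ℝ} (hα : 1 ≤ α) (hc : 0 < c)
    {Γ : Measure Plane} (hΓ : IsSpectral α M c Γ) (u : Plane) :
    c * ‖u‖ - 2 * c ≤ stableExp α Γ ((2 * Real.pi) • u) := by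
  have h4 := hΓ.lower ((2 * Real.pi) • u)
  have h5 := norm_le_abs_add_abs u
  have h6 : ∀ x : ℝ, |x| - 1 ≤ |2 * Real.pi * x| ^ α := fun x => by
    refine le_trans ?_ (abs_sub_one_le_rpow hα _)
    rw [abs_mul (2 * Real.pi), abs_of_pos Real.two_pi_pos]
    nlinarith [abs_nonneg x, Real.pi_gt_three]
  have h7 := h6 u.fst
  have h8 := h6 u.snd
  simp only [WithLp.smul_fst, WithLp.smul_snd, smul_eq_mul] at h4
  nlinarith

lemma exp_neg_levyExp_smallLevy_le {α M c : ℝ} (hα : 1 < α) (hα' : α < 2) (hc : 0 < c)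
    {Γ : Measure Plane} (hΓ : IsSpectral α M c Γ) (u : Plane) :
    Real.exp (-levyExp (smallLevy α Γ) u) ≤
      Real.exp (2 * (radialMoment α (α + 1) 0 * M) + 2 * c) * Real.exp (-(c * ‖u‖)) := by
  have hα0 : 0 < α := by linarith
  have := hΓ.isFiniteMeasure
  have := hΓ.isFiniteMeasure_large hα0
  have hM := hΓ.mass_nonneg hα0 hc
  have hm := radialMoment_nonneg α (α + 1) 0
  rw [levyExp_smallLevy, ← Real.exp_add]
  refine Real.exp_le_exp.2 ?_
  have h1 := stableExp_eq_levyExp_add hα0 hα' hΓ.bdd ((2 * Real.pi) • u)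
  have h2 := levyExp_le_two_mul (κ := polar (radialLarge α) Γ) ((2 * Real.pi) • u)
  have h3 : (polar (radialLarge α) Γ).real univ ≤ radialMoment α (α + 1) 0 * M :=
    ENNReal.toReal_le_of_le_ofReal (by positivity) (polar_radialLarge_univ_le hα0 hΓ)
  have h4 := hΓ.le_stableExp_two_pi_smul hα.le hc u
  linarith

/-- The densities of the small-jump parts, and their derivatives up to order two, decay like a
product of Cauchy weights, uniformly over all spectral measures with the same parameters. -/
lemma exists_norm_iteratedFDeriv_small_le {α M c : ℝ} (hα : 1 < α) (hα' : α < 2) (hc : 0 < c) :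
    ∃ B : ℝ, ∀ Γ : Measure Plane, IsSpectral α M c Γ →
      Integrable (levyCF (smallLevy α Γ)) ∧ ContDiff ℝ 2 (𝓕 (levyCF (smallLevy α Γ))) ∧
      ∀ k ≤ 2, ∀ z : Plane, ‖iteratedFDeriv ℝ k (𝓕 (levyCF (smallLevy α Γ))) z‖ ≤
        B * cauchyWeight z.fst * cauchyWeight z.snd := by
  have hα0 : 0 < α := by linarith
  let D : ℝ := 4 * Real.pi * max 1 (radialMoment α 2 0 * M)
  have hD : 1 ≤ D := by
    have h1 := le_max_left 1 (radialMoment α 2 0 * M)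
    have h2 := Real.pi_gt_three
    simp only [D]; nlinarith
  choose C hC using fun n k : ℕ => exists_norm_fourier_levyCF_le (V := Plane)
    (A := Real.exp (2 * (radialMoment α (α + 1) 0 * M) + 2 * c)) hc hD n k
  refine ⟨2 * ∑ k ∈ Finset.range 3, (|C 0 k| + |C 4 k|), fun Γ hΓ => ?_⟩
  have hmom := fun n => lintegral_smallLevy_le hα0 hα' hΓ n
  have hint : ∀ n : ℕ, Integrable (fun x : Plane => ‖x‖ ^ (n + 2)) (smallLevy α Γ) := fun n => by
    refine ⟨Continuous.aestronglyMeasurable (by fun_prop), ?_⟩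
    rw [hasFiniteIntegral_iff_ofReal (Filter.Eventually.of_forall fun x => by positivity)]
    exact (hmom n).trans_lt ENNReal.ofReal_lt_top
  have hmom' : ∀ n : ℕ, ∫ x : Plane, ‖x‖ ^ (n + 2) ∂(smallLevy α Γ) ≤ D ^ (n + 2) := fun n => by
    rw [integral_eq_lintegral_of_nonneg_ae (Filter.Eventually.of_forall fun x => by positivity)
      (Continuous.aestronglyMeasurable (by fun_prop))]
    exact ENNReal.toReal_le_of_le_ofReal (by positivity) (hmom n)
  have key := fun n k => hC n k (smallLevy α Γ) hint hmom'
    (exp_neg_levyExp_smallLevy_le hα hα' hc hΓ)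
  refine ⟨(key 0 0).1, (key 0 2).2.1, fun k hk z => ?_⟩
  have h0 := (key 0 k).2.2 z
  have h4 := (key 4 k).2.2 z
  rw [pow_zero, one_mul] at h0
  have hs : |C 0 k| + |C 4 k| ≤ ∑ k ∈ Finset.range 3, (|C 0 k| + |C 4 k|) :=
    Finset.single_le_sum (f := fun k => |C 0 k| + |C 4 k|) (fun i _ => by positivity)
      (Finset.mem_range.2 (by omega))
  have hn := WithLp.prod_norm_sq_eq_of_L2 z
  rw [Real.norm_eq_abs, Real.norm_eq_abs, sq_abs, sq_abs] at hn
  unfold cauchyWeight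
  rw [← div_eq_mul_inv, ← div_eq_mul_inv, le_div_iff₀ (by positivity), le_div_iff₀ (by positivity)]
  set X := ‖iteratedFDeriv ℝ k (𝓕 (levyCF (smallLevy α Γ))) z‖
  have hX : 0 ≤ X := norm_nonneg _
  have hprod : (1 + z.snd ^ 2) * (1 + z.fst ^ 2) ≤ 2 * (1 + ‖z‖ ^ 4) := by
    have e : ‖z‖ ^ 4 = (z.fst ^ 2 + z.snd ^ 2) ^ 2 := by rw [← hn]; ring
    rw [e]
    nlinarith [sq_nonneg (z.fst ^ 2 - 1), sq_nonneg (z.snd ^ 2 - 1), sq_nonneg (z.fst * z.snd),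
      sq_nonneg (z.fst ^ 2 - z.snd ^ 2), sq_nonneg (z.fst ^ 2 + z.snd ^ 2 - 1)]
  calc X * (1 + z.snd ^ 2) * (1 + z.fst ^ 2) = X * ((1 + z.snd ^ 2) * (1 + z.fst ^ 2)) := by ring
    _ ≤ X * (2 * (1 + ‖z‖ ^ 4)) := by gcongr
    _ = 2 * (X + ‖z‖ ^ 4 * X) := by ring
    _ ≤ 2 * (|C 0 k| + |C 4 k|) := by
        gcongr
        · exact h0.trans (le_abs_self _)
        · exact h4.trans (le_abs_self _)
    _ ≤ _ := by gcongr

/-- The symmetrised Lévy measure of the jumps of size larger than one. -/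
noncomputable def largeLevy (α : ℝ) (Γ : Measure Plane) : Measure Plane :=
  (2⁻¹ : ℝ≥0∞) • (polar (radialLarge α) Γ + (polar (radialLarge α) Γ).map fun x => -x)

lemma IsSpectral.isFiniteMeasure_largeLevy {α M c : ℝ} (hα : 0 < α) {Γ : Measure Plane}
    (hΓ : IsSpectral α M c Γ) : IsFiniteMeasure (largeLevy α Γ) := by
  have := hΓ.isFiniteMeasure_large hα
  unfold largeLevy
  exact Measure.smul_finite _ (by simp)

lemma lintegral_largeLevy {α : ℝ} {Γ : Measure Plane} {w : Plane → ℝ≥0∞}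
    (hw : Measurable w) (hw' : ∀ x, w (-x) = w x) :
    ∫⁻ x, w x ∂(largeLevy α Γ) = ∫⁻ x, w x ∂(polar (radialLarge α) Γ) := by
  rw [largeLevy, lintegral_smul_measure, lintegral_add_measure, lintegral_map hw (by fun_prop)]
  simp only [hw', smul_eq_mul]
  rw [← two_mul, ← mul_assoc, ENNReal.inv_mul_cancel (by simp) (by simp), one_mul]

/-- The characteristic function of the compound Poisson law of the (symmetrised) large jumps. -/
lemma charFun_compoundPoisson_largeLevy {α M c : ℝ} (hα : 0 < α) {Γ : Measure Plane}
    (hΓ : IsSpectral α M c Γ) (u : Plane) :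
    charFun (compoundPoisson (largeLevy α Γ)) u =
      (Real.exp (-levyExp (polar (radialLarge α) Γ) u) : ℝ) := by
  have := hΓ.isFiniteMeasure_large hα
  have := hΓ.isFiniteMeasure_largeLevy hα
  set κ := polar (radialLarge α) Γ with hκ
  have hmass : (largeLevy α Γ).real univ = κ.real univ := by
    have := lintegral_largeLevy (α := α) (Γ := Γ) (w := fun _ => 1) measurable_const (by simp)
    rw [lintegral_one, lintegral_one] at this
    rw [Measure.real, Measure.real, this]
  have hcos : Integrable (fun x : Plane => Real.cos ⟪x, u⟫) κ :=
    (integrable_const (1 : ℝ)).mono' (Continuous.aestronglyMeasurable (by fun_prop))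
      (Filter.Eventually.of_forall fun x => Real.abs_cos_le_one _)
  have hre : (charFun κ u).re = ∫ x, Real.cos ⟪x, u⟫ ∂κ := by
    rw [charFun_apply]
    have hi : Integrable (fun x : Plane => Complex.exp (⟪x, u⟫ * Complex.I)) κ :=
      (integrable_const (1 : ℝ)).mono' (Continuous.aestronglyMeasurable (by fun_prop))
        (Filter.Eventually.of_forall fun x => by rw [Complex.norm_exp_ofReal_mul_I])
    have := integral_re hi
    simp only [RCLike.re_eq_complex_re, Complex.exp_ofReal_mul_I_re] at this
    exact this.symm
  have hcf : charFun (largeLevy α Γ) u = ((charFun κ u).re : ℂ) := by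
    have hi : ∀ m : Measure Plane, IsFiniteMeasure m →
        Integrable (fun x : Plane => Complex.exp (⟪x, u⟫ * Complex.I)) m := fun m _ =>
      (integrable_const (1 : ℝ)).mono' (Continuous.aestronglyMeasurable (by fun_prop))
        (Filter.Eventually.of_forall fun x => by rw [Complex.norm_exp_ofReal_mul_I])
    have hneg : charFun (κ.map fun x => -x) u = charFun κ (-u) := by
      rw [charFun_apply, charFun_apply, integral_map (by fun_prop)
        (Continuous.aestronglyMeasurable (by fun_prop))]
      simp
    rw [charFun_apply, largeLevy, integral_smul_measure,
      integral_add_measure (hi _ inferInstance) (hi _ inferInstance), ← charFun_apply,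
      ← charFun_apply, hneg, charFun_neg, Complex.add_conj]
    simp [hκ]
  rw [charFun_compoundPoisson, hcf, hmass, hre, ← Complex.ofReal_sub, ← Complex.ofReal_exp, levyExp,
    integral_sub (integrable_const _) hcos, integral_const, smul_eq_mul, mul_one, neg_sub]

/-- The characteristic function of the stable law with spectral measure `Γ`, at `2π u`. -/
noncomputable def stableCF (α : ℝ) (Γ : Measure Plane) (u : Plane) : ℂ :=
  (Real.exp (-stableExp α Γ ((2 * Real.pi) • u)) : ℝ)

lemma stableCF_eq_mul {α M c : ℝ} (hα : 0 < α) (hα' : α < 2) {Γ : Measure Plane}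
    (hΓ : IsSpectral α M c Γ) (u : Plane) :
    stableCF α Γ u = levyCF (smallLevy α Γ) u *
      charFun (compoundPoisson (largeLevy α Γ)) ((2 * Real.pi) • u) := by
  have := hΓ.isFiniteMeasure
  rw [charFun_compoundPoisson_largeLevy hα hΓ, levyCF, levyExp_smallLevy, stableCF,
    stableExp_eq_levyExp_add hα hα' hΓ.bdd, neg_add, Real.exp_add, Complex.ofReal_mul]

lemma fourier_mul_charFun {f : Plane → ℂ} (hf : Integrable f) (Λ : Measure Plane)
    [IsFiniteMeasure Λ] (z : Plane) :
    𝓕 (fun u => f u * charFun Λ ((2 * Real.pi) • u)) z = ∫ y, 𝓕 f (z - y) ∂Λ := by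
  simp only [Real.fourier_eq', charFun_apply, smul_eq_mul]
  rw [integral_integral_swap]
  · refine integral_congr_ae (Filter.Eventually.of_forall fun u => ?_)
    simp only
    rw [← mul_assoc, ← integral_const_mul]
    refine integral_congr_ae (Filter.Eventually.of_forall fun y => ?_)
    simp only
    rw [mul_right_comm, ← Complex.exp_add]
    congr 2
    rw [inner_sub_right, real_inner_smul_right, real_inner_comm u y]
    push_cast; ring
  · have h1 : Integrable (fun q : Plane × Plane => (1 : ℂ) * f q.2) (Λ.prod volume) :=
      (integrable_const (1 : ℂ)).mul_prod hf
    refine h1.norm.mono' ?_ (Filter.Eventually.of_forall fun q => ?_)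
    · have h2 : AEStronglyMeasurable (fun q : Plane × Plane => f q.2) (Λ.prod volume) :=
        hf.aestronglyMeasurable.comp_snd
      refine AEStronglyMeasurable.mul (Continuous.aestronglyMeasurable ?_) h2
      fun_prop
    · simp only [Function.uncurry]
      rw [norm_mul, Complex.norm_exp_ofReal_mul_I, norm_mul, norm_one]

end UniformDensity

/-! ### Tame functions and their pairing with stable densities -/

section Tame

open scoped RealInnerProductSpace ENNReal ContDiff FourierTransform

/-- A function all of whose translates are integrable against the Cauchy weight, with
an integral growing at most like `(1 + |a|)^β` in the translation parameter `a`. -/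
structure IsTame (β C : ℝ) (K : ℝ → ℝ) : Prop where
  measurable : Measurable K
  nonneg : 0 ≤ C
  lintegral_le : ∀ a, ∫⁻ x, ‖K (x + a)‖ₑ * ENNReal.ofReal (cauchyWeight x) ≤
    ENNReal.ofReal (C * (1 + |a|) ^ β)

lemma IsTame.mono {β β' C : ℝ} {K : ℝ → ℝ} (h : IsTame β C K) (hβ : β ≤ β') : IsTame β' C K :=
  ⟨h.measurable, h.nonneg, fun a => (h.lintegral_le a).trans (ENNReal.ofReal_le_ofReal
    (mul_le_mul_of_nonneg_left (Real.rpow_le_rpow_of_exponent_le (by simp) hβ) h.nonneg))⟩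

lemma one_add_abs_add_rpow_le {β : ℝ} (hβ : 0 ≤ β) (x y : ℝ) :
    (1 + |x + y|) ^ β ≤ (1 + |x|) ^ β * (1 + |y|) ^ β := by
  rw [← Real.mul_rpow (by positivity) (by positivity)]
  refine Real.rpow_le_rpow (by positivity) ?_ hβ
  nlinarith [abs_add_le x y, abs_nonneg x, abs_nonneg y, mul_nonneg (abs_nonneg x) (abs_nonneg y)]

lemma cauchyWeight_mul_rpow_le {β : ℝ} (x : ℝ) :
    (1 + |x|) ^ β * cauchyWeight x ≤ 2 * (1 + ‖x‖) ^ (-(2 - β)) := by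
  have h : 0 < 1 + |x| := by positivity
  have e : (1 + |x|) ^ (-(2 - β)) = (1 + |x|) ^ β * ((1 + |x|) ^ 2)⁻¹ := by
    rw [show -(2 - β) = β + -(2 : ℕ) by push_cast; ring, Real.rpow_add h, Real.rpow_neg h.le,
      Real.rpow_natCast]
  rw [Real.norm_eq_abs, e, cauchyWeight, mul_left_comm]
  gcongr
  rw [← div_eq_mul_inv, le_div_iff₀ (by positivity), inv_mul_le_iff₀ (by positivity)]
  nlinarith [sq_abs x, sq_nonneg (|x| - 1)]

lemma integrable_one_add_norm_rpow {β : ℝ} (hβ : β < 1) :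
    Integrable (fun x : ℝ => (1 + ‖x‖) ^ (-(2 - β))) :=
  integrable_one_add_norm (by simp; linarith)

lemma isTame_one : ∃ C, IsTame 0 C (fun _ => 1) := by
  refine ⟨∫ x : ℝ, 2 * (1 + ‖x‖) ^ (-(2 - (0 : ℝ))), measurable_const,
    integral_nonneg fun x => by positivity, fun a => ?_⟩
  have hi := (integrable_one_add_norm_rpow (β := 0) (by norm_num)).const_mul 2
  rw [Real.rpow_zero, mul_one, ofReal_integral_eq_lintegral_ofReal hi
    (Filter.Eventually.of_forall fun x => by positivity)]
  refine lintegral_mono fun x => ?_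
  simp only [enorm_one, one_mul]
  refine ENNReal.ofReal_le_ofReal ?_
  simpa using cauchyWeight_mul_rpow_le (β := 0) x

lemma integrableOn_of_assumptionK3 {K : ℝ → ℝ} (hK : Measurable K) {x₀ : ℝ}
    (h : AssumptionK3 K x₀) : IntegrableOn K (Icc (-x₀) x₀) := by
  obtain ⟨F, hF, hB⟩ := h
  have h1 : ∀ p ∈ F, ∃ δ > 0, IntegrableOn K (Metric.ball p δ) := fun p hp => by
    obtain ⟨s, hs, hi⟩ := (hF p hp).2
    obtain ⟨δ, hδ, hsub⟩ := Metric.mem_nhds_iff.1 hs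
    exact ⟨δ, hδ, hi.mono_set hsub⟩
  choose! δ hδ hi using h1
  obtain ⟨ε, hε, hεδ⟩ : ∃ ε > 0, ∀ p ∈ F, ε ≤ δ p := by
    rcases F.eq_empty_or_nonempty with rfl | hne
    · exact ⟨1, one_pos, by simp⟩
    · refine ⟨F.inf' hne δ, ?_, fun p hp => Finset.inf'_le _ hp⟩
      rw [gt_iff_lt, Finset.lt_inf'_iff]
      exact hδ
  obtain ⟨B, hB⟩ := hB ε hε
  have h2 : IntegrableOn K (⋃ p ∈ F, Metric.ball p (δ p)) :=
    (integrableOn_finset_iUnion).2 fun p hp => hi p hp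
  have h3 : IntegrableOn K (Icc (-x₀) x₀ \ ⋃ p ∈ F, Metric.ball p (δ p)) := by
    have hms : MeasurableSet (Icc (-x₀) x₀ \ ⋃ p ∈ F, Metric.ball p (δ p)) :=
      measurableSet_Icc.diff (F.measurableSet_biUnion fun p _ => measurableSet_ball)
    refine Measure.integrableOn_of_bounded (M := B) ?_ hK.aestronglyMeasurable
      ((ae_restrict_iff' hms).2 (Filter.Eventually.of_forall fun x hx => ?_))
    · exact ((measure_mono sdiff_subset).trans_lt measure_Icc_lt_top).ne
    · refine hB x (abs_le.2 hx.1) fun p hp => ?_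
      by_contra hlt
      refine hx.2 (mem_iUnion₂.2 ⟨p, hp, ?_⟩)
      rw [Metric.mem_ball, Real.dist_eq]
      exact (not_le.1 hlt).trans_le (hεδ p hp)
  exact (h2.union h3).mono_set fun x hx => by
    by_cases hm : x ∈ ⋃ p ∈ F, Metric.ball p (δ p)
    · exact Or.inl hm
    · exact Or.inr ⟨hx, hm⟩

/-- Admissible functions are tame, by their growth and their local integrability. -/
lemma Admissible.isTame {α : ℝ} (hα : α < 2) {K : ℝ → ℝ} (h : Admissible α K) :
    ∃ β C, 0 < β ∧ β < α / 2 ∧ IsTame β C K := by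
  obtain ⟨hK, β, x₀, hβ, hβα, -, ⟨c, hc⟩, -, h3⟩ := h
  have hloc := integrableOn_of_assumptionK3 hK h3
  let J : ℝ := ∫ x in Icc (-x₀) x₀, ‖K x‖
  let I : ℝ := ∫ x : ℝ, 2 * (1 + ‖x‖) ^ (-(2 - β))
  have hJ : 0 ≤ J := integral_nonneg fun x => norm_nonneg _
  have hI : 0 ≤ I := integral_nonneg fun x => by positivity
  have hIi := (integrable_one_add_norm_rpow (β := β) (by linarith)).const_mul 2
  refine ⟨β, J + |c| * I, hβ, hβα, hK, by positivity, fun a => ?_⟩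
  have hone : 1 ≤ (1 + |a|) ^ β := Real.one_le_rpow (by simp) hβ.le
  have hpt : ∀ x, ‖K (x + a)‖ₑ * ENNReal.ofReal (cauchyWeight x) ≤
      (Icc (-x₀) x₀).indicator (fun y => ‖K y‖ₑ) (x + a) +
        ENNReal.ofReal (|c| * (1 + |a|) ^ β) *
          ENNReal.ofReal (2 * (1 + ‖x‖) ^ (-(2 - β))) := fun x => by
    by_cases hx : x + a ∈ Icc (-x₀) x₀
    · rw [indicator_of_mem hx]
      refine le_add_right (mul_le_of_le_one_right' ?_)
      exact ENNReal.ofReal_le_one.2 (cauchyWeight_le_one x)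
    · rw [indicator_of_notMem hx, zero_add, ← ofReal_norm,
        ← ENNReal.ofReal_mul (norm_nonneg _), ← ENNReal.ofReal_mul (by positivity)]
      refine ENNReal.ofReal_le_ofReal ?_
      have hx' : x₀ < |x + a| := by
        rw [← not_le, abs_le]; exact hx
      have h1 : ‖K (x + a)‖ ≤ |c| * ((1 + |x|) ^ β * (1 + |a|) ^ β) := by
        refine (hc _ hx').trans ?_
        have h2 : |x + a| ^ β ≤ (1 + |x|) ^ β * (1 + |a|) ^ β :=
          (Real.rpow_le_rpow (abs_nonneg _) (by simp) hβ.le).trans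
            (one_add_abs_add_rpow_le hβ.le x a)
        have h3 : 0 ≤ |x + a| ^ β := Real.rpow_nonneg (abs_nonneg _) _
        exact (mul_le_mul_of_nonneg_right (le_abs_self c) h3).trans
          (mul_le_mul_of_nonneg_left h2 (abs_nonneg c))
      calc ‖K (x + a)‖ * cauchyWeight x
          ≤ |c| * ((1 + |x|) ^ β * (1 + |a|) ^ β) * cauchyWeight x :=
            mul_le_mul_of_nonneg_right h1 (cauchyWeight_pos x).le
        _ = |c| * (1 + |a|) ^ β * ((1 + |x|) ^ β * cauchyWeight x) := by ring
        _ ≤ _ := mul_le_mul_of_nonneg_left (cauchyWeight_mul_rpow_le x) (by positivity)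
  refine (lintegral_mono hpt).trans ?_
  rw [lintegral_add_right _ (by fun_prop), lintegral_const_mul _ (by fun_prop),
    lintegral_add_right_eq_self (fun x => (Icc (-x₀) x₀).indicator (fun y => ‖K y‖ₑ) x),
    lintegral_indicator measurableSet_Icc, ← ofReal_integral_norm_eq_lintegral_enorm hloc,
    ← ofReal_integral_eq_lintegral_ofReal hIi
      (Filter.Eventually.of_forall fun x => by positivity),
    ← ENNReal.ofReal_mul (by positivity), ← ENNReal.ofReal_add hJ (by positivity)]
  refine ENNReal.ofReal_le_ofReal ?_
  have : J ≤ J * (1 + |a|) ^ β := le_mul_of_one_le_right hJ hone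
  calc J + |c| * (1 + |a|) ^ β * I ≤ J * (1 + |a|) ^ β + |c| * (1 + |a|) ^ β * I := by gcongr
    _ = _ := by ring

lemma IsTame.lintegral_translate_le {β C : ℝ} (hβ : 0 ≤ β) {K : ℝ → ℝ} (h : IsTame β C K)
    (a y : ℝ) :
    ∫⁻ x, ‖K (x + y)‖ₑ * ENNReal.ofReal (cauchyWeight x + cauchyWeight (x + a)) ≤
      ENNReal.ofReal (2 * C * (1 + |a|) ^ β) * ENNReal.ofReal ((1 + |y|) ^ β) := by
  have hC := h.nonneg
  have hK := h.measurable
  have hg : Measurable cauchyWeight := continuous_cauchyWeight.measurable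
  have h1 : ∫⁻ x, ‖K (x + y)‖ₑ * ENNReal.ofReal (cauchyWeight (x + a)) =
      ∫⁻ x, ‖K (x + (y - a))‖ₑ * ENNReal.ofReal (cauchyWeight x) := by
    rw [← lintegral_add_right_eq_self
      (fun x => ‖K (x + (y - a))‖ₑ * ENNReal.ofReal (cauchyWeight x)) a]
    congr 1; funext x; congr 3; ring
  simp_rw [ENNReal.ofReal_add (cauchyWeight_pos _).le (cauchyWeight_pos _).le, mul_add]
  rw [lintegral_add_left (by fun_prop), h1]
  refine (add_le_add (h.lintegral_le y) (h.lintegral_le (y - a))).trans ?_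
  rw [← ENNReal.ofReal_add (by positivity) (by positivity), ← ENNReal.ofReal_mul (by positivity)]
  refine ENNReal.ofReal_le_ofReal ?_
  have h2 := one_add_abs_add_rpow_le hβ y (-a)
  rw [abs_neg, ← sub_eq_add_neg] at h2
  have h3 : 1 ≤ (1 + |a|) ^ β := Real.one_le_rpow (by simp) hβ
  have h4 : 0 ≤ (1 + |y|) ^ β := by positivity
  calc C * (1 + |y|) ^ β + C * (1 + |y - a|) ^ β
      ≤ C * ((1 + |y|) ^ β * (1 + |a|) ^ β) + C * ((1 + |y|) ^ β * (1 + |a|) ^ β) := by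
        gcongr
        exact le_mul_of_one_le_right h4 h3
    _ = _ := by ring

end Tame

section Pairing

open scoped RealInnerProductSpace ENNReal ContDiff FourierTransform

lemma lintegral_plane_mul {φ ψ : ℝ → ℝ≥0∞} (hφ : Measurable φ) (hψ : Measurable ψ) :
    ∫⁻ z : Plane, φ z.fst * ψ z.snd = (∫⁻ x, φ x) * ∫⁻ y, ψ y := by
  rw [← lintegral_prod_mul hφ.aemeasurable hψ.aemeasurable, ← Measure.volume_eq_prod]
  exact (WithLp.volume_preserving_ofLp ℝ ℝ).lintegral_comp
    (f := fun z : ℝ × ℝ => φ z.1 * ψ z.2) (by fun_prop)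

/-- The submultiplicative weight `(1 + |x|)^β (1 + |y|)^β`. -/
noncomputable def growthWeight (β : ℝ) (z : Plane) : ℝ≥0∞ :=
  ENNReal.ofReal ((1 + |z.fst|) ^ β) * ENNReal.ofReal ((1 + |z.snd|) ^ β)

lemma measurable_fst_plane : Measurable fun z : Plane => z.fst :=
  measurable_fst.comp (WithLp.measurable_ofLp 2 (ℝ × ℝ))

lemma measurable_snd_plane : Measurable fun z : Plane => z.snd :=
  measurable_snd.comp (WithLp.measurable_ofLp 2 (ℝ × ℝ))

lemma measurable_growthWeight (β : ℝ) : Measurable (growthWeight β) := by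
  have h1 := measurable_fst_plane
  have h2 := measurable_snd_plane
  unfold growthWeight
  fun_prop

/-- The law of the large jumps integrates the growth weight, uniformly. -/
lemma lintegral_compoundPoisson_growthWeight_le {α β M c : ℝ} (hα : 0 < α) (hβ : 0 ≤ β)
    (hβα : β < α / 2) (hM : 0 ≤ M) {Γ : Measure Plane} (hΓ : IsSpectral α M c Γ) :
    ∫⁻ y, growthWeight β y ∂(compoundPoisson (largeLevy α Γ)) ≤
      ENNReal.ofReal (Real.exp (2 ^ (2 * β) * radialMoment α (α + 1) (2 * β) * M)) := by
  have := hΓ.isFiniteMeasure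
  have := hΓ.isFiniteMeasure_largeLevy hα
  have hm := radialMoment_nonneg α (α + 1) (2 * β)
  refine lintegral_compoundPoisson_le _ (measurable_growthWeight β) (by simp [growthWeight])
    (fun x y => ?_) (by positivity) ?_
  · unfold growthWeight
    refine (mul_le_mul' (ENNReal.ofReal_le_ofReal (one_add_abs_add_rpow_le hβ x.fst y.fst))
      (ENNReal.ofReal_le_ofReal (one_add_abs_add_rpow_le hβ x.snd y.snd))).trans (le_of_eq ?_)
    rw [ENNReal.ofReal_mul (by positivity), ENNReal.ofReal_mul (by positivity)]
    ring
  · rw [lintegral_largeLevy (measurable_growthWeight β) (fun x => by simp [growthWeight]),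
      lintegral_polar (measurable_growthWeight β)]
    calc _ ≤ ∫⁻ _, ENNReal.ofReal (2 ^ (2 * β)) *
            ENNReal.ofReal (radialMoment α (α + 1) (2 * β)) ∂Γ := by
          refine lintegral_mono_ae (hΓ.bdd.mono fun θ hθ => ?_)
          refine lintegral_radialLarge_le (by linarith) fun r hr => ?_
          have hr0 : 0 < r := one_pos.trans hr
          have h1 : ∀ t : ℝ, |t| ≤ 1 → (1 + |r * t|) ^ β ≤ (2 * r) ^ β := fun t ht => by
            refine Real.rpow_le_rpow (by positivity) ?_ hβ
            rw [abs_mul, abs_of_pos hr0]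
            nlinarith
          unfold growthWeight
          rw [← ENNReal.ofReal_mul (by positivity), ← ENNReal.ofReal_mul (by positivity)]
          refine ENNReal.ofReal_le_ofReal ?_
          rw [← Real.mul_rpow (by norm_num) hr0.le, two_mul β,
            Real.rpow_add (by positivity : (0 : ℝ) < 2 * r)]
          simp only [WithLp.smul_fst, WithLp.smul_snd, smul_eq_mul]
          exact mul_le_mul (h1 _ hθ.1) (h1 _ hθ.2) (by positivity) (by positivity)
      _ ≤ _ := by
          rw [lintegral_const, ← ENNReal.ofReal_mul (by positivity),
            ENNReal.ofReal_mul (q := M) (by positivity)]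
          exact mul_le_mul_right hΓ.mass _

/-- Translates of tame functions are integrated against the factor `q` of the convolution
`H = q * Λ`, and the resulting growth in the translation parameter against `Λ`. -/
lemma lintegral_pairing_le {β : ℝ} {K L : ℝ → ℝ} (hK : Measurable K) (hL : Measurable L)
    {Λ : Measure Plane} [IsFiniteMeasure Λ] {q H : Plane → ℂ} (hq : Continuous q)
    (hH : ∀ z, H z = ∫ y, q (z - y) ∂Λ) {A X₁ X₂ : ℝ≥0∞} {g₁ g₂ : ℝ → ℝ≥0∞}
    (hg₁ : Measurable g₁) (hg₂ : Measurable g₂)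
    (hqle : ∀ z, ‖q z‖ₑ ≤ A * (g₁ z.fst * g₂ z.snd))
    (h₁ : ∀ y, ∫⁻ x, ‖K (x + y)‖ₑ * g₁ x ≤ X₁ * ENNReal.ofReal ((1 + |y|) ^ β))
    (h₂ : ∀ y, ∫⁻ x, ‖L (x + y)‖ₑ * g₂ x ≤ X₂ * ENNReal.ofReal ((1 + |y|) ^ β)) :
    ∫⁻ z : Plane, ‖K z.fst‖ₑ * ‖L z.snd‖ₑ * ‖H z‖ₑ ≤
      A * X₁ * X₂ * ∫⁻ y, growthWeight β y ∂Λ := by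
  have m1 := measurable_fst_plane
  have m2 := measurable_snd_plane
  have hqm := hq.measurable
  calc ∫⁻ z : Plane, ‖K z.fst‖ₑ * ‖L z.snd‖ₑ * ‖H z‖ₑ
      ≤ ∫⁻ z : Plane, ∫⁻ y : Plane, ‖K z.fst‖ₑ * ‖L z.snd‖ₑ * ‖q (z - y)‖ₑ ∂Λ := by
        refine lintegral_mono fun z => ?_
        rw [lintegral_const_mul _ (by fun_prop), hH]
        gcongr
        exact enorm_integral_le_lintegral_enorm _
    _ = ∫⁻ y, (∫⁻ z : Plane, ‖K z.fst‖ₑ * ‖L z.snd‖ₑ * ‖q (z - y)‖ₑ) ∂Λ := by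
        refine lintegral_lintegral_swap (Measurable.aemeasurable ?_)
        have : Measurable fun p : Plane × Plane => q (p.1 - p.2) := (by fun_prop :
          Continuous fun p : Plane × Plane => q (p.1 - p.2)).measurable
        fun_prop
    _ = ∫⁻ y, (∫⁻ z : Plane, ‖K (z.fst + y.fst)‖ₑ * ‖L (z.snd + y.snd)‖ₑ * ‖q z‖ₑ) ∂Λ := by
        refine lintegral_congr fun y => ?_
        rw [← lintegral_add_right_eq_self _ y]
        simp
    _ ≤ ∫⁻ y, A * ((X₁ * ENNReal.ofReal ((1 + |y.fst|) ^ β)) *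
          (X₂ * ENNReal.ofReal ((1 + |y.snd|) ^ β))) ∂Λ := by
        refine lintegral_mono fun y => ?_
        calc _ ≤ ∫⁻ z : Plane, A * ((‖K (z.fst + y.fst)‖ₑ * g₁ z.fst) *
              (‖L (z.snd + y.snd)‖ₑ * g₂ z.snd)) := by
              refine lintegral_mono fun z => ?_
              refine (mul_le_mul_right (hqle z) _).trans (le_of_eq ?_)
              ring
          _ ≤ _ := by
              rw [lintegral_const_mul _ (by fun_prop),
                lintegral_plane_mul (φ := fun x => ‖K (x + y.fst)‖ₑ * g₁ x)
                  (ψ := fun x => ‖L (x + y.snd)‖ₑ * g₂ x) (by fun_prop) (by fun_prop)]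
              gcongr
              · exact h₁ _
              · exact h₂ _
    _ = A * X₁ * X₂ * ∫⁻ y, growthWeight β y ∂Λ := by
        rw [← lintegral_const_mul _ (measurable_growthWeight β)]
        refine lintegral_congr fun y => ?_
        unfold growthWeight; ring

/-- The density of the stable law with spectral measure `Γ`. -/
noncomputable def stableDensity (α : ℝ) (Γ : Measure Plane) : Plane → ℂ := 𝓕 (stableCF α Γ)

/-- The size `min 1 |a| (1 + |a|)^β` of the effect of a jump `a`: the increment over a short step
is of the order of the step, and a translation by `a` costs the factor `(1 + |a|)^β`. -/
noncomputable def jumpSize (β a : ℝ) : ℝ := min 1 |a| * (1 + |a|) ^ β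

lemma jumpSize_nonneg (β a : ℝ) : 0 ≤ jumpSize β a := by unfold jumpSize; positivity

/-- Stable densities and their mixed second differences, tested against tame functions.
The bounds are uniform over the spectral measures with the same parameters. -/
lemma exists_lintegral_stableDensity_le {α β M c C₁ C₂ : ℝ} (hα : 1 < α) (hα' : α < 2)
    (hc : 0 < c) (hM : 0 ≤ M) (hβ : 0 ≤ β) (hβα : β < α / 2) {K L : ℝ → ℝ} (hK : IsTame β C₁ K)
    (hL : IsTame β C₂ L) :
    ∃ C : ℝ, 0 ≤ C ∧ ∀ Γ : Measure Plane, IsSpectral α M c Γ →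
      (∫⁻ z : Plane, ‖K z.fst‖ₑ * ‖L z.snd‖ₑ * ‖stableDensity α Γ z‖ₑ ≤ ENNReal.ofReal C) ∧
      ∀ a : Plane, ∫⁻ z : Plane, ‖K z.fst‖ₑ * ‖L z.snd‖ₑ * ‖mixedDiff (stableDensity α Γ) a z‖ₑ ≤
        ENNReal.ofReal (C * (jumpSize β a.fst * jumpSize β a.snd)) := by
  have hα0 : 0 < α := by linarith
  obtain ⟨B', hB'⟩ := exists_norm_iteratedFDeriv_small_le (M := M) hα hα' hc
  let B := |B'|
  let W : ℝ := Real.exp (2 ^ (2 * β) * radialMoment α (α + 1) (2 * β) * M)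
  have hW : 0 < W := Real.exp_pos _
  have hC₁ := hK.nonneg
  have hC₂ := hL.nonneg
  refine ⟨9 * B * (2 * C₁) * (2 * C₂) * W, by positivity, fun Γ hΓ => ?_⟩
  obtain ⟨hint, hsm, hbd'⟩ := hB' Γ hΓ
  have hbd : ∀ k ≤ 2, ∀ z : Plane, ‖iteratedFDeriv ℝ k (𝓕 (levyCF (smallLevy α Γ))) z‖ ≤
      B * cauchyWeight z.fst * cauchyWeight z.snd := fun k hk z =>
    (hbd' k hk z).trans (by
      have := (cauchyWeight_pos z.fst).le
      have := (cauchyWeight_pos z.snd).le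
      gcongr; exact le_abs_self _)
  have hfin := hΓ.isFiniteMeasure_largeLevy hα0
  set p := 𝓕 (levyCF (smallLevy α Γ)) with hp
  set Λ := compoundPoisson (largeLevy α Γ) with hΛ
  have hpc : Continuous p := hsm.continuous
  have hW' : ∫⁻ y, growthWeight β y ∂Λ ≤ ENNReal.ofReal W :=
    lintegral_compoundPoisson_growthWeight_le hα0 hβ hβα hM hΓ
  have hconv : ∀ z, stableDensity α Γ z = ∫ y, p (z - y) ∂Λ := fun z => by
    rw [stableDensity, funext (stableCF_eq_mul hα0 hα' hΓ), fourier_mul_charFun hint]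
  have hp0 : ∀ z, ‖p z‖ ≤ B * cauchyWeight z.fst * cauchyWeight z.snd := fun z => by
    simpa using hbd 0 (by norm_num) z
  have hpi : ∀ z, Integrable (fun y => p (z - y)) Λ := fun z => by
    refine (integrable_const B).mono' (Continuous.aestronglyMeasurable (by fun_prop))
      (Filter.Eventually.of_forall fun y => (hp0 _).trans ?_)
    rw [mul_assoc]
    refine mul_le_of_le_one_right (abs_nonneg _) ?_
    exact mul_le_one₀ (cauchyWeight_le_one _) (cauchyWeight_pos _).le (cauchyWeight_le_one _)
  have hgm : Measurable cauchyWeight := continuous_cauchyWeight.measurable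
  constructor
  · have h := lintegral_pairing_le (β := β) hK.measurable hL.measurable hpc hconv
      (A := ENNReal.ofReal B) (X₁ := ENNReal.ofReal C₁) (X₂ := ENNReal.ofReal C₂)
      (g₁ := fun x => ENNReal.ofReal (cauchyWeight x))
      (g₂ := fun x => ENNReal.ofReal (cauchyWeight x)) (by fun_prop) (by fun_prop)
      (fun z => by
        rw [← ENNReal.ofReal_mul (cauchyWeight_pos _).le, ← ENNReal.ofReal_mul (abs_nonneg _),
          ← ofReal_norm, ← mul_assoc]
        exact ENNReal.ofReal_le_ofReal (hp0 z))
      (fun y => by rw [← ENNReal.ofReal_mul hC₁]; exact hK.lintegral_le y)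
      (fun y => by rw [← ENNReal.ofReal_mul hC₂]; exact hL.lintegral_le y)
    refine h.trans ((mul_le_mul_right hW' _).trans ?_)
    rw [← ENNReal.ofReal_mul (abs_nonneg _), ← ENNReal.ofReal_mul (by positivity),
      ← ENNReal.ofReal_mul (by positivity)]
    refine ENNReal.ofReal_le_ofReal ?_
    have : 0 ≤ B * C₁ * C₂ * W := by positivity
    nlinarith
  · intro a
    have hmc : Continuous (mixedDiff p a) := by unfold mixedDiff; fun_prop
    have h := lintegral_pairing_le (β := β) (H := mixedDiff (stableDensity α Γ) a)
      (Λ := Λ) hK.measurable hL.measurable hmc (fun z => by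
        simp only [mixedDiff, hconv]
        have i1 := hpi (z + a)
        have i2 := hpi (z + pt a.fst 0)
        have i3 := hpi (z + pt 0 a.snd)
        have i12 : Integrable (fun y => p (z + a - y) - p (z + pt a.fst 0 - y)) Λ := i1.sub i2
        have i123 : Integrable (fun y => p (z + a - y) - p (z + pt a.fst 0 - y) -
          p (z + pt 0 a.snd - y)) Λ := i12.sub i3
        rw [← integral_sub i1 i2, ← integral_sub i12 i3, ← integral_add i123 (hpi z)]
        simp only [add_sub_right_comm])
      (A := ENNReal.ofReal (9 * B * (min 1 |a.fst| * min 1 |a.snd|)))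
      (X₁ := ENNReal.ofReal (2 * C₁ * (1 + |a.fst|) ^ β))
      (X₂ := ENNReal.ofReal (2 * C₂ * (1 + |a.snd|) ^ β))
      (g₁ := fun x => ENNReal.ofReal (cauchyWeight x + cauchyWeight (x + a.fst)))
      (g₂ := fun x => ENNReal.ofReal (cauchyWeight x + cauchyWeight (x + a.snd)))
      (by fun_prop) (by fun_prop)
      (fun z => by
        have g1 := (cauchyWeight_pos z.fst).le
        have g2 := (cauchyWeight_pos (z.fst + a.fst)).le
        rw [← ENNReal.ofReal_mul (by positivity), ← ENNReal.ofReal_mul (by positivity),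
          ← ofReal_norm]
        exact ENNReal.ofReal_le_ofReal (norm_mixedDiff_le hsm hbd a z))
      (hK.lintegral_translate_le hβ a.fst) (hL.lintegral_translate_le hβ a.snd)
    refine h.trans ((mul_le_mul_right hW' _).trans (le_of_eq ?_))
    rw [← ENNReal.ofReal_mul (by positivity), ← ENNReal.ofReal_mul (by positivity),
      ← ENNReal.ofReal_mul (by positivity)]
    congr 1
    unfold jumpSize; ring

end Pairing

/-! ### Stable laws and their densities -/

section Law

open scoped RealInnerProductSpace ENNReal ContDiff FourierTransform ComplexConjugate

lemma norm_stableCF_le {α M c : ℝ} (hα : 1 ≤ α) (hc : 0 < c) {Γ : Measure Plane}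
    (hΓ : IsSpectral α M c Γ) (u : Plane) :
    ‖stableCF α Γ u‖ ≤ Real.exp (2 * c) * Real.exp (-(c * ‖u‖)) := by
  rw [stableCF, Complex.norm_real, Real.norm_eq_abs, Real.abs_exp, ← Real.exp_add]
  refine Real.exp_le_exp.2 ?_
  linarith [hΓ.le_stableExp_two_pi_smul hα hc u]

lemma integrable_pow_mul_exp_neg_norm (m : ℕ) {c : ℝ} (hc : 0 < c) :
    Integrable fun u : Plane => (1 + ‖u‖) ^ m * Real.exp (-(c * ‖u‖)) := by
  obtain ⟨S, -, hS⟩ := exists_pow_mul_exp_neg_le (m + 3) hc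
  have hJ : Integrable (fun v : Plane => (1 + ‖v‖) ^ (-(3 : ℝ))) :=
    integrable_one_add_norm (by
      rw [(WithLp.linearEquiv 2 ℝ (ℝ × ℝ)).finrank_eq]; norm_num)
  refine (hJ.const_mul S).mono' (Continuous.aestronglyMeasurable (by fun_prop))
    (Filter.Eventually.of_forall fun u => ?_)
  have h1 : 0 < 1 + ‖u‖ := by positivity
  rw [Real.norm_eq_abs, abs_of_nonneg (by positivity), Real.rpow_neg h1.le, ← div_eq_mul_inv,
    le_div_iff₀ (by positivity)]
  refine le_trans (le_of_eq ?_) (hS ‖u‖ (norm_nonneg _))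
  rw [show (3 : ℝ) = ((3 : ℕ) : ℝ) by norm_num, Real.rpow_natCast, pow_add]
  ring

lemma stronglyMeasurable_stableExp (α : ℝ) (Γ : Measure Plane) [SFinite Γ] :
    StronglyMeasurable (stableExp α Γ) := by
  unfold stableExp
  refine StronglyMeasurable.integral_prod_right
    (f := fun (u θ : Plane) => |⟪θ, u⟫| ^ α) (Measurable.stronglyMeasurable ?_)
  have : Measurable fun q : Plane × Plane => ⟪q.2, q.1⟫ := by fun_prop
  simp only [Function.uncurry_def]
  fun_prop

lemma measurable_stableCF (α : ℝ) (Γ : Measure Plane) [SFinite Γ] :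
    Measurable (stableCF α Γ) := by
  have := (stronglyMeasurable_stableExp α Γ).measurable
  unfold stableCF
  fun_prop

lemma integrable_stableCF {α M c : ℝ} (hα : 1 ≤ α) (hc : 0 < c) {Γ : Measure Plane}
    (hΓ : IsSpectral α M c Γ) : Integrable (stableCF α Γ) := by
  have := hΓ.isFiniteMeasure
  have h := (integrable_pow_mul_exp_neg_norm 0 hc).const_mul (Real.exp (2 * c))
  refine h.mono' (measurable_stableCF α Γ).aestronglyMeasurable
    (Filter.Eventually.of_forall fun u => ?_)
  simpa using norm_stableCF_le hα hc hΓ u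

lemma stableExp_neg (α : ℝ) (Γ : Measure Plane) (u : Plane) :
    stableExp α Γ (-u) = stableExp α Γ u := by
  simp only [stableExp, inner_neg_right, abs_neg]

lemma fourierInv_stableCF (α : ℝ) (Γ : Measure Plane) :
    𝓕⁻ (stableCF α Γ) = stableDensity α Γ := by
  rw [Real.fourierInv_eq_fourier_comp_neg, stableDensity]
  congr 1
  funext u
  simp [stableCF, stableExp_neg]

lemma conj_stableDensity (α : ℝ) (Γ : Measure Plane) (z : Plane) :
    conj (stableDensity α Γ z) = stableDensity α Γ z := by
  conv_rhs => rw [← fourierInv_stableCF]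
  rw [stableDensity, Real.fourier_eq', Real.fourierInv_eq', ← integral_conj]
  refine integral_congr_ae (Filter.Eventually.of_forall fun u => ?_)
  simp only [smul_eq_mul, map_mul, stableCF, Complex.conj_ofReal, ← Complex.exp_conj,
    Complex.conj_I]
  congr 2
  push_cast; ring

lemma continuous_stableDensity {α M c : ℝ} (hα : 1 ≤ α) (hc : 0 < c) {Γ : Measure Plane}
    (hΓ : IsSpectral α M c Γ) : Continuous (stableDensity α Γ) := by
  have h := integrable_stableCF hα hc hΓ
  exact (Real.contDiff_fourier (N := 0) (f := stableCF α Γ) fun n hn => by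
    have : n = 0 := by simpa using hn
    subst this
    simpa using h.norm).continuous

/-- A law whose characteristic function is the one of a stable law with nondegenerate spectral
measure has the density `stableDensity`.  Positivity of the density is not needed: the law plus
the negative part of the density has the same characteristic function as the positive part. -/
lemma integral_eq_integral_stableDensity {α M c : ℝ} (hα : 1 < α) (hα' : α < 2) (hc : 0 < c)
    {Γ : Measure Plane} (hΓ : IsSpectral α M c Γ) {ρ : Measure Plane} [IsFiniteMeasure ρ]
    (hρ : ∀ u, charFun ρ u = (Real.exp (-stableExp α Γ u) : ℝ)) {F : Plane → ℝ}
    (hF : Measurable F) (hFi : ∫⁻ z, ‖F z‖ₑ * ‖stableDensity α Γ z‖ₑ < ⊤) :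
    Integrable F ρ ∧ Integrable (fun z => F z * (stableDensity α Γ z).re) ∧
      ∫ z, F z ∂ρ = ∫ z, F z * (stableDensity α Γ z).re := by
  have hα0 : 0 < α := by linarith
  have hM := hΓ.mass_nonneg hα0 hc
  set h := stableDensity α Γ with hh
  have hcont : Continuous h := continuous_stableDensity hα.le hc hΓ
  have hcf := integrable_stableCF hα.le hc hΓ
  have hint : Integrable h := by
    obtain ⟨C₀, ht⟩ := isTame_one
    obtain ⟨C, -, hC⟩ := exists_lintegral_stableDensity_le hα hα' hc hM le_rfl (by linarith) ht ht
    have := (hC Γ hΓ).1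
    simp only [enorm_one, one_mul] at this
    exact ⟨hcont.aestronglyMeasurable, this.trans_lt ENNReal.ofReal_lt_top⟩
  have hcfc : Continuous (stableCF α Γ) := by
    have : stableCF α Γ = fun u => charFun ρ ((2 * Real.pi) • u) := funext fun u => (hρ _).symm
    rw [this]
    exact continuous_charFun.comp (by fun_prop)
  have hinv : 𝓕 h = stableCF α Γ := by
    have := hcfc.fourier_fourierInv_eq hcf (by exact hint)
    rwa [fourierInv_stableCF] at this
  have hre : ∀ z, ((h z).re : ℂ) = h z := fun z =>
    Complex.conj_eq_iff_re.1 (conj_stableDensity α Γ z)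
  have hrm : Measurable fun z => (h z).re := Complex.measurable_re.comp hcont.measurable
  have hri : Integrable fun z => (h z).re := hint.re
  let P : Measure Plane := volume.withDensity fun z => ENNReal.ofReal (h z).re
  let N : Measure Plane := volume.withDensity fun z => ENNReal.ofReal (-(h z).re)
  have : IsFiniteMeasure P := isFiniteMeasure_withDensity_ofReal hri.2
  have : IsFiniteMeasure N := isFiniteMeasure_withDensity_ofReal hri.neg.2
  -- the difference of the integrals against `P` and `N` is the integral against the density
  have hdiff : ∀ {E : Type} [NormedAddCommGroup E] [NormedSpace ℝ E] (G : Plane → E),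
      Integrable G P → Integrable G N →
      Integrable (fun z => (h z).re • G z) ∧ ∫ z, G z ∂P - ∫ z, G z ∂N = ∫ z, (h z).re • G z := by
    intro E _ _ G hP hN
    have hP' := (integrable_withDensity_iff_integrable_smul' (by fun_prop) (by simp)).1 hP
    have hN' := (integrable_withDensity_iff_integrable_smul' (by fun_prop) (by simp)).1 hN
    have e : ∀ z, (ENNReal.ofReal (h z).re).toReal • G z -
        (ENNReal.ofReal (-(h z).re)).toReal • G z = (h z).re • G z := fun z => by
      rw [← sub_smul, ENNReal.toReal_ofReal', ENNReal.toReal_ofReal', max_zero_sub_eq_self]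
    refine ⟨(hP'.sub hN').congr (Filter.Eventually.of_forall e), ?_⟩
    rw [integral_withDensity_eq_integral_toReal_smul (by fun_prop) (by simp),
      integral_withDensity_eq_integral_toReal_smul (by fun_prop) (by simp),
      ← integral_sub hP' hN']
    simp only [e]
  have hexp : ∀ (m : Measure Plane) [IsFiniteMeasure m] (u : Plane),
      Integrable (fun x : Plane => Complex.exp (⟪x, u⟫ * Complex.I)) m := fun m _ u =>
    (integrable_const (1 : ℝ)).mono' (Continuous.aestronglyMeasurable (by fun_prop))
      (Filter.Eventually.of_forall fun x => by rw [Complex.norm_exp_ofReal_mul_I])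
  have hsum : ρ + N = P := by
    refine Measure.ext_of_charFun (funext fun u => ?_)
    have h1 := (hdiff _ (hexp P u) (hexp N u)).2
    have h2 : charFun (ρ + N) u = charFun ρ u + charFun N u := by
      rw [charFun_apply, integral_add_measure (hexp ρ u) (hexp N u)]; rfl
    rw [h2, ← eq_sub_iff_add_eq, hρ, charFun_apply, charFun_apply, h1]
    have h3 : 𝓕 h (-((2 * Real.pi)⁻¹ • u)) = (Real.exp (-stableExp α Γ u) : ℝ) := by
      rw [hinv, stableCF, smul_neg, smul_smul, mul_inv_cancel₀ (by positivity), one_smul,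
        stableExp_neg]
    rw [← h3, Real.fourier_eq']
    refine integral_congr_ae (Filter.Eventually.of_forall fun z => ?_)
    simp only
    rw [Complex.real_smul, hre, smul_eq_mul, mul_comm, inner_neg_right, real_inner_smul_right]
    congr 3
    have := Real.pi_pos
    field_simp
  have hle : ∀ s : ℝ, |s| = 1 → Integrable F
      (volume.withDensity fun z => ENNReal.ofReal (s * (h z).re)) := fun s hs => by
    refine ⟨hF.aestronglyMeasurable, ?_⟩
    rw [HasFiniteIntegral, lintegral_withDensity_eq_lintegral_mul _ (by fun_prop) (by fun_prop)]
    refine lt_of_le_of_lt (lintegral_mono fun z => ?_) hFi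
    rw [Pi.mul_apply, mul_comm, ← ofReal_norm (h z)]
    refine mul_le_mul_right (ENNReal.ofReal_le_ofReal ?_) _
    refine (le_abs_self _).trans ?_
    rw [abs_mul, hs, one_mul]
    exact Complex.abs_re_le_norm _
  have hFP : Integrable F P := by simpa using hle 1 (by simp)
  have hFN : Integrable F N := by simpa using hle (-1) (by simp)
  have hFρ : Integrable F ρ := hFP.mono_measure (hsum ▸ Measure.le_add_right le_rfl)
  obtain ⟨h1, h2⟩ := hdiff F hFP hFN
  refine ⟨hFρ, by simpa [mul_comm] using h1, ?_⟩
  have h3 : ∫ z, F z ∂P = ∫ z, F z ∂ρ + ∫ z, F z ∂N := by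
    rw [← hsum]; exact integral_add_measure hFρ hFN
  rw [h3, add_sub_cancel_right] at h2
  rw [h2]
  simp [mul_comm]

end Law

/-! ### Interpolation between a pair and its independent counterpart -/

section Interpolation

open scoped RealInnerProductSpace ENNReal ContDiff FourierTransform

lemma plane_inner (x y : Plane) : ⟪x, y⟫ = x.fst * y.fst + x.snd * y.snd := by
  simp [mul_comm]

/-- The mixed second difference of `cos`, i.e. the real part of `(exp (i a) - 1) (exp (i b) - 1)`
with `a = x₁ u₁` and `b = x₂ u₂`. -/
noncomputable def mixedCos (x u : Plane) : ℝ :=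
  Real.cos ⟪u, x⟫ - Real.cos ⟪u, pt x.fst 0⟫ - Real.cos ⟪u, pt 0 x.snd⟫ + 1

lemma one_sub_cos_le_two_mul_min (a : ℝ) : 1 - Real.cos a ≤ 2 * min 1 |a| := by
  rcases le_total |a| 1 with h | h
  · rw [min_eq_right h]
    have := one_sub_cos_le_sq a
    nlinarith [sq_abs a, abs_nonneg a]
  · rw [min_eq_left h]
    linarith [Real.neg_one_le_cos a]

lemma abs_sin_le_min (a : ℝ) : |Real.sin a| ≤ min 1 |a| :=
  le_min (Real.abs_sin_le_one a) Real.abs_sin_le_abs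

lemma min_one_abs_mul_le (x u : ℝ) : min 1 |x * u| ≤ min 1 |x| * (1 + |u|) := by
  rw [abs_mul]
  rcases le_total |x| 1 with h | h
  · rw [min_eq_right h]
    exact (min_le_right _ _).trans (by nlinarith [abs_nonneg x, abs_nonneg u])
  · rw [min_eq_left h]
    exact (min_le_left _ _).trans (by linarith [abs_nonneg u])

lemma abs_fst_le_norm (u : Plane) : |u.fst| ≤ ‖u‖ := by
  have h := WithLp.prod_norm_sq_eq_of_L2 u
  rw [Real.norm_eq_abs, Real.norm_eq_abs] at h
  exact abs_le_of_sq_le_sq (by nlinarith [sq_nonneg |u.snd|, sq_abs u.fst]) (norm_nonneg u)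

lemma abs_snd_le_norm (u : Plane) : |u.snd| ≤ ‖u‖ := by
  have h := WithLp.prod_norm_sq_eq_of_L2 u
  rw [Real.norm_eq_abs, Real.norm_eq_abs] at h
  exact abs_le_of_sq_le_sq (by nlinarith [sq_nonneg |u.fst|, sq_abs u.snd]) (norm_nonneg u)

lemma abs_mixedCos_le (x u : Plane) :
    |mixedCos x u| ≤ 5 * (min 1 |x.fst| * min 1 |x.snd|) * (1 + ‖u‖) ^ 2 := by
  have e : mixedCos x u = (1 - Real.cos (x.fst * u.fst)) * (1 - Real.cos (x.snd * u.snd)) -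
      Real.sin (x.fst * u.fst) * Real.sin (x.snd * u.snd) := by
    simp only [mixedCos, plane_inner, WithLp.toLp_fst, WithLp.toLp_snd, Real.cos_add,
      mul_comm u.fst, mul_comm u.snd, mul_zero, zero_mul, Real.cos_zero, Real.sin_zero]
    ring
  set a := min 1 |x.fst * u.fst|
  set b := min 1 |x.snd * u.snd|
  have ha0 : 0 ≤ a := by positivity
  have hb0 : 0 ≤ b := by positivity
  have h1 := one_sub_cos_le_two_mul_min (x.fst * u.fst)
  have h2 := one_sub_cos_le_two_mul_min (x.snd * u.snd)
  have h3 : 0 ≤ 1 - Real.cos (x.fst * u.fst) := sub_nonneg.2 (Real.cos_le_one _)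
  have h4 : 0 ≤ 1 - Real.cos (x.snd * u.snd) := sub_nonneg.2 (Real.cos_le_one _)
  have h5 : |Real.sin (x.fst * u.fst) * Real.sin (x.snd * u.snd)| ≤ a * b := by
    rw [abs_mul]
    exact mul_le_mul (abs_sin_le_min _) (abs_sin_le_min _) (abs_nonneg _) ha0
  have h6 : (1 - Real.cos (x.fst * u.fst)) * (1 - Real.cos (x.snd * u.snd)) ≤
      (2 * a) * (2 * b) := mul_le_mul h1 h2 h4 (by positivity)
  calc |mixedCos x u| ≤ 5 * (a * b) := by
        rw [e]
        refine (abs_sub _ _).trans ?_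
        rw [abs_of_nonneg (mul_nonneg h3 h4)]
        linarith
    _ ≤ 5 * ((min 1 |x.fst| * (1 + ‖u‖)) * (min 1 |x.snd| * (1 + ‖u‖))) := by
        gcongr
        · exact (min_one_abs_mul_le _ _).trans (by gcongr; exact abs_fst_le_norm u)
        · exact (min_one_abs_mul_le _ _).trans (by gcongr; exact abs_snd_le_norm u)
    _ = _ := by ring

/-- Multiplication by `cos ⟪2π u, y⟫` on the Fourier side is a symmetrised translation. -/
lemma integral_fourier_mul_cos {f : Plane → ℂ} (hf : Integrable f) (z y : Plane) :
    Integrable (fun u => Complex.exp ((-2 * Real.pi * ⟪u, z⟫ : ℝ) * Complex.I) *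
      (f u * Real.cos ⟪(2 * Real.pi) • u, y⟫)) ∧
    ∫ u, Complex.exp ((-2 * Real.pi * ⟪u, z⟫ : ℝ) * Complex.I) *
      (f u * Real.cos ⟪(2 * Real.pi) • u, y⟫) = (𝓕 f (z + y) + 𝓕 f (z - y)) / 2 := by
  have hi : ∀ w : Plane, Integrable fun u =>
      Complex.exp ((-2 * Real.pi * ⟪u, w⟫ : ℝ) * Complex.I) * f u := fun w => by
    refine hf.norm.mono' (AEStronglyMeasurable.mul (Continuous.aestronglyMeasurable (by fun_prop))
      hf.aestronglyMeasurable) (Filter.Eventually.of_forall fun u => ?_)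
    rw [norm_mul, Complex.norm_exp_ofReal_mul_I, one_mul]
  have e : ∀ u, Complex.exp ((-2 * Real.pi * ⟪u, z⟫ : ℝ) * Complex.I) *
      (f u * Real.cos ⟪(2 * Real.pi) • u, y⟫) =
      (Complex.exp ((-2 * Real.pi * ⟪u, z + y⟫ : ℝ) * Complex.I) * f u +
        Complex.exp ((-2 * Real.pi * ⟪u, z - y⟫ : ℝ) * Complex.I) * f u) / 2 := fun u => by
    rw [Complex.ofReal_cos, Complex.cos, inner_add_right, inner_sub_right, real_inner_smul_left]
    have h1 : Complex.exp ((-2 * Real.pi * (⟪u, z⟫ + ⟪u, y⟫) : ℝ) * Complex.I) =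
        Complex.exp ((-2 * Real.pi * ⟪u, z⟫ : ℝ) * Complex.I) *
          Complex.exp (-((2 * Real.pi * ⟪u, y⟫ : ℝ) : ℂ) * Complex.I) := by
      rw [← Complex.exp_add]; congr 1; push_cast; ring
    have h2 : Complex.exp ((-2 * Real.pi * (⟪u, z⟫ - ⟪u, y⟫) : ℝ) * Complex.I) =
        Complex.exp ((-2 * Real.pi * ⟪u, z⟫ : ℝ) * Complex.I) *
          Complex.exp (((2 * Real.pi * ⟪u, y⟫ : ℝ) : ℂ) * Complex.I) := by
      rw [← Complex.exp_add]; congr 1; push_cast; ring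
    rw [h1, h2]; ring
  simp only [e]
  refine ⟨((hi _).add (hi _)).div_const 2, ?_⟩
  rw [integral_div, integral_add (hi _) (hi _)]
  simp only [Real.fourier_eq', smul_eq_mul]

lemma integral_fourier_mul_mixedCos {f : Plane → ℂ} (hf : Integrable f) (z x : Plane) :
    ∫ u, Complex.exp ((-2 * Real.pi * ⟪u, z⟫ : ℝ) * Complex.I) *
      (f u * mixedCos x ((2 * Real.pi) • u)) =
      (mixedDiff (𝓕 f) x z + mixedDiff (𝓕 f) (-x) z) / 2 := by
  obtain ⟨i1, e1⟩ := integral_fourier_mul_cos hf z x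
  obtain ⟨i2, e2⟩ := integral_fourier_mul_cos hf z (pt x.fst 0)
  obtain ⟨i3, e3⟩ := integral_fourier_mul_cos hf z (pt 0 x.snd)
  obtain ⟨i4, e4⟩ := integral_fourier_mul_cos hf z 0
  have e : ∀ u, Complex.exp ((-2 * Real.pi * ⟪u, z⟫ : ℝ) * Complex.I) *
      (f u * mixedCos x ((2 * Real.pi) • u)) =
      Complex.exp ((-2 * Real.pi * ⟪u, z⟫ : ℝ) * Complex.I) *
        (f u * Real.cos ⟪(2 * Real.pi) • u, x⟫) -
      Complex.exp ((-2 * Real.pi * ⟪u, z⟫ : ℝ) * Complex.I) *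
        (f u * Real.cos ⟪(2 * Real.pi) • u, pt x.fst 0⟫) -
      Complex.exp ((-2 * Real.pi * ⟪u, z⟫ : ℝ) * Complex.I) *
        (f u * Real.cos ⟪(2 * Real.pi) • u, pt 0 x.snd⟫) +
      Complex.exp ((-2 * Real.pi * ⟪u, z⟫ : ℝ) * Complex.I) *
        (f u * Real.cos ⟪(2 * Real.pi) • u, (0 : Plane)⟫) := fun u => by
    rw [inner_zero_right, Real.cos_zero, mixedCos]
    push_cast; ring
  have i12 := i1.sub i2
  have i123 := i12.sub i3
  simp only [e]
  rw [integral_add (by exact i123) i4, integral_sub (by exact i12) i3, integral_sub i1 i2,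
    e1, e2, e3, e4]
  have n1 : z + pt (-x).fst 0 = z - pt x.fst 0 := by
    rw [sub_eq_add_neg]; congr 1; exact plane_ext (by simp) (by simp)
  have n2 : z + pt 0 (-x).snd = z - pt 0 x.snd := by
    rw [sub_eq_add_neg]; congr 1; exact plane_ext (by simp) (by simp)
  simp only [mixedDiff, n1, n2, add_zero, sub_zero, ← sub_eq_add_neg]
  ring

/-- The spectral measure `t Γ₁ + (1 - t) Γ₀`. -/
noncomputable def mixSpectral (t : ℝ) (Γ₁ Γ₀ : Measure Plane) : Measure Plane :=
  ENNReal.ofReal t • Γ₁ + ENNReal.ofReal (1 - t) • Γ₀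

lemma integrable_abs_inner_rpow {α : ℝ} (hα : 0 ≤ α) {Γ : Measure Plane} [IsFiniteMeasure Γ]
    (hΓ : ∀ᵐ θ ∂Γ, |θ.fst| ≤ 1 ∧ |θ.snd| ≤ 1) (u : Plane) :
    Integrable (fun θ => |⟪θ, u⟫| ^ α) Γ := by
  have hm : Measurable fun θ : Plane => ⟪θ, u⟫ := by fun_prop
  refine (integrable_const ((2 * ‖u‖) ^ α)).mono' (Measurable.aestronglyMeasurable (by fun_prop))
    (hΓ.mono fun θ hθ => ?_)
  rw [Real.norm_eq_abs, abs_of_nonneg (by positivity)]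
  refine Real.rpow_le_rpow (abs_nonneg _) ((abs_real_inner_le_norm _ _).trans ?_) hα
  gcongr
  exact norm_le_two_of_abs_le_one hθ.1 hθ.2

lemma stableExp_mixSpectral {α : ℝ} (hα : 0 ≤ α) {Γ₁ Γ₀ : Measure Plane} [IsFiniteMeasure Γ₁]
    [IsFiniteMeasure Γ₀] (h₁ : ∀ᵐ θ ∂Γ₁, |θ.fst| ≤ 1 ∧ |θ.snd| ≤ 1)
    (h₀ : ∀ᵐ θ ∂Γ₀, |θ.fst| ≤ 1 ∧ |θ.snd| ≤ 1) {t : ℝ} (ht : t ∈ Icc (0 : ℝ) 1) (u : Plane) :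
    stableExp α (mixSpectral t Γ₁ Γ₀) u = t * stableExp α Γ₁ u + (1 - t) * stableExp α Γ₀ u := by
  have i1 := integrable_abs_inner_rpow hα h₁ u
  have i0 := integrable_abs_inner_rpow hα h₀ u
  rw [stableExp, mixSpectral, integral_add_measure (i1.smul_measure (by simp))
    (i0.smul_measure (by simp)), integral_smul_measure, integral_smul_measure,
    ENNReal.toReal_ofReal ht.1, ENNReal.toReal_ofReal (sub_nonneg.2 ht.2)]
  rfl

lemma IsSpectral.mixSpectral {α M c : ℝ} (hα : 0 < α) (hc : 0 < c) {Γ₁ Γ₀ : Measure Plane}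
    (h₁ : IsSpectral α M c Γ₁) (h₀ : IsSpectral α M c Γ₀) {t : ℝ} (ht : t ∈ Icc (0 : ℝ) 1) :
    IsSpectral α M c (mixSpectral t Γ₁ Γ₀) := by
  have := h₁.isFiniteMeasure
  have := h₀.isFiniteMeasure
  have hM := h₁.mass_nonneg hα hc
  have ht' : 0 ≤ 1 - t := sub_nonneg.2 ht.2
  refine ⟨?_, ?_, fun u => ?_⟩
  · rw [StableCov.mixSpectral, Measure.add_apply, Measure.smul_apply, Measure.smul_apply]
    calc _ ≤ ENNReal.ofReal t * ENNReal.ofReal M + ENNReal.ofReal (1 - t) * ENNReal.ofReal M :=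
          add_le_add (mul_le_mul_right h₁.mass _) (mul_le_mul_right h₀.mass _)
      _ = ENNReal.ofReal M := by
          rw [← add_mul, ← ENNReal.ofReal_add ht.1 ht']; simp
  · rw [StableCov.mixSpectral, ae_add_measure_iff]
    exact ⟨Measure.ae_smul_measure h₁.bdd _, Measure.ae_smul_measure h₀.bdd _⟩
  · rw [stableExp_mixSpectral hα.le h₁.bdd h₀.bdd ht]
    have := h₁.lower u
    have := h₀.lower u
    nlinarith [ht.1]

lemma integral_exp_segment (A B : ℝ) :
    (∫ t in Ioc (0 : ℝ) 1, Real.exp (-(t * A + (1 - t) * B))) * (B - A) =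
      Real.exp (-A) - Real.exp (-B) := by
  have h : ∀ t ∈ uIcc (0 : ℝ) 1, HasDerivAt (fun t => Real.exp (-(t * A + (1 - t) * B)))
      (Real.exp (-(t * A + (1 - t) * B)) * (B - A)) t := fun t _ => by
    have h1 : HasDerivAt (fun t : ℝ => -(t * A + (1 - t) * B)) (B - A) t := by
      have := (((hasDerivAt_id t).mul_const A).add
        (((hasDerivAt_id t).const_sub 1).mul_const B)).neg
      exact this.congr_deriv (by ring)
    exact h1.exp
  have := intervalIntegral.integral_eq_sub_of_hasDerivAt h
    (Continuous.intervalIntegrable (by fun_prop) _ _)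
  rw [intervalIntegral.integral_of_le zero_le_one, integral_mul_const] at this
  rw [this]; simp

/-- The product-type spectral measure: the images of `Γ` under the two coordinate projections,
which is the spectral measure of a pair with independent components having the same marginals. -/
noncomputable def indepSpectral (Γ : Measure Plane) : Measure Plane :=
  Γ.map (fun θ => pt θ.fst 0) + Γ.map (fun θ => pt 0 θ.snd)

lemma measurable_pt_fst : Measurable fun θ : Plane => pt θ.fst 0 :=
  (WithLp.measurable_toLp 2 (ℝ × ℝ)).comp (measurable_fst_plane.prodMk measurable_const)

lemma measurable_pt_snd : Measurable fun θ : Plane => pt 0 θ.snd :=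
  (WithLp.measurable_toLp 2 (ℝ × ℝ)).comp (measurable_const.prodMk measurable_snd_plane)

instance isFiniteMeasure_indepSpectral (Γ : Measure Plane) [IsFiniteMeasure Γ] :
    IsFiniteMeasure (indepSpectral Γ) := by
  unfold indepSpectral; infer_instance

lemma bdd_indepSpectral {Γ : Measure Plane} (h : ∀ᵐ θ ∂Γ, |θ.fst| ≤ 1 ∧ |θ.snd| ≤ 1) :
    ∀ᵐ θ ∂(indepSpectral Γ), |θ.fst| ≤ 1 ∧ |θ.snd| ≤ 1 := by
  have hm : MeasurableSet {θ : Plane | |θ.fst| ≤ 1 ∧ |θ.snd| ≤ 1} := by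
    have h1 := measurable_fst_plane
    have h2 := measurable_snd_plane
    exact (measurableSet_le (continuous_abs.measurable.comp h1) measurable_const).inter
      (measurableSet_le (continuous_abs.measurable.comp h2) measurable_const)
  rw [indepSpectral, ae_add_measure_iff]
  constructor
  · rw [ae_map_iff measurable_pt_fst.aemeasurable hm]
    exact h.mono fun θ hθ => by simpa using hθ.1
  · rw [ae_map_iff measurable_pt_snd.aemeasurable hm]
    exact h.mono fun θ hθ => by simpa using hθ.2

lemma stableExp_indepSpectral {α : ℝ} (hα : 0 < α) {Γ : Measure Plane} [IsFiniteMeasure Γ]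
    (h : ∀ᵐ θ ∂Γ, |θ.fst| ≤ 1 ∧ |θ.snd| ≤ 1) (u : Plane) :
    stableExp α (indepSpectral Γ) u =
      stableExp α Γ (pt u.fst 0) + stableExp α Γ (pt 0 u.snd) := by
  have hi := integrable_abs_inner_rpow hα.le (bdd_indepSpectral h) u
  have hm : Measurable fun θ : Plane => ⟪θ, u⟫ := by fun_prop
  have hm' : Measurable fun θ : Plane => |⟪θ, u⟫| ^ α := by fun_prop
  unfold indepSpectral at hi
  rw [stableExp, indepSpectral, integral_add_measure (hi.mono_measure (Measure.le_add_right le_rfl))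
    (hi.mono_measure (Measure.le_add_left le_rfl)),
    integral_map measurable_pt_fst.aemeasurable hm'.aestronglyMeasurable,
    integral_map measurable_pt_snd.aemeasurable hm'.aestronglyMeasurable]
  simp [stableExp]

/-- The difference of the exponents of the independent and the dependent pair is the integral of
`mixedCos` against the Lévy measure. -/
lemma integral_mixedCos {α : ℝ} (hα : 0 < α) (hα' : α < 2) {Γ : Measure Plane}
    [IsFiniteMeasure Γ] (h : ∀ᵐ θ ∂Γ, |θ.fst| ≤ 1 ∧ |θ.snd| ≤ 1) (u : Plane) :
    ∫ x, mixedCos x u ∂(polar (radialLevy α) Γ) =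
      stableExp α (indepSpectral Γ) u - stableExp α Γ u := by
  have i0 := integrable_one_sub_cos_polar hα hα' h u
  have i1 := integrable_one_sub_cos_polar hα hα' h (pt u.fst 0)
  have i2 := integrable_one_sub_cos_polar hα hα' h (pt 0 u.snd)
  have e : ∀ x : Plane, mixedCos x u = (1 - Real.cos ⟪x, pt u.fst 0⟫) +
      (1 - Real.cos ⟪x, pt 0 u.snd⟫) - (1 - Real.cos ⟪x, u⟫) := fun x => by
    have h1 : ⟪u, pt x.fst 0⟫ = ⟪x, pt u.fst 0⟫ := by simp [mul_comm]
    have h2 : ⟪u, pt 0 x.snd⟫ = ⟪x, pt 0 u.snd⟫ := by simp [mul_comm]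
    rw [mixedCos, h1, h2, real_inner_comm]; ring
  simp only [e]
  rw [integral_sub (by exact i1.add i2) i0, integral_add i1 i2, stableExp_indepSpectral hα h,
    ← levyExp_polar_radialLevy hα hα' h, ← levyExp_polar_radialLevy hα hα' h,
    ← levyExp_polar_radialLevy hα hα' h]
  rfl

lemma jumpSize_neg (β a : ℝ) : jumpSize β (-a) = jumpSize β a := by simp [jumpSize]

lemma min_one_abs_le_jumpSize {β : ℝ} (hβ : 0 ≤ β) (a : ℝ) : min 1 |a| ≤ jumpSize β a :=
  le_mul_of_one_le_right (by positivity) (Real.one_le_rpow (by simp) hβ)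

lemma continuous_jumpSize {β : ℝ} (hβ : 0 ≤ β) : Continuous (jumpSize β) := by
  unfold jumpSize
  exact (by fun_prop : Continuous fun a : ℝ => min 1 |a|).mul
    ((by fun_prop : Continuous fun a : ℝ => 1 + |a|).rpow_const fun a => Or.inr hβ)

/-- The characteristic function of the stable law with spectral measure `t Γ₁ + (1 - t) Γ₀`,
written such that it makes sense for all `t`. -/
noncomputable def segmentCF (α : ℝ) (Γ₁ Γ₀ : Measure Plane) (t : ℝ) (u : Plane) : ℂ :=
  (Real.exp (-(t * stableExp α Γ₁ ((2 * Real.pi) • u) +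
    (1 - t) * stableExp α Γ₀ ((2 * Real.pi) • u))) : ℝ)

lemma segmentCF_eq {α : ℝ} (hα : 0 ≤ α) {Γ₁ Γ₀ : Measure Plane} [IsFiniteMeasure Γ₁]
    [IsFiniteMeasure Γ₀] (h₁ : ∀ᵐ θ ∂Γ₁, |θ.fst| ≤ 1 ∧ |θ.snd| ≤ 1)
    (h₀ : ∀ᵐ θ ∂Γ₀, |θ.fst| ≤ 1 ∧ |θ.snd| ≤ 1) {t : ℝ} (ht : t ∈ Ioc (0 : ℝ) 1) :
    segmentCF α Γ₁ Γ₀ t = stableCF α (mixSpectral t Γ₁ Γ₀) := by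
  funext u
  rw [segmentCF, stableCF, stableExp_mixSpectral hα h₁ h₀ (Ioc_subset_Icc_self ht)]

lemma measurable_segmentCF (α : ℝ) (Γ₁ Γ₀ : Measure Plane) [SFinite Γ₁] [SFinite Γ₀] :
    Measurable fun q : ℝ × Plane => segmentCF α Γ₁ Γ₀ q.1 q.2 := by
  have e1 := (stronglyMeasurable_stableExp α Γ₁).measurable
  have e0 := (stronglyMeasurable_stableExp α Γ₀).measurable
  unfold segmentCF
  fun_prop

lemma measurable_mixedCos :
    Measurable fun q : Plane × Plane => mixedCos q.1 ((2 * Real.pi) • q.2) := by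
  have a1 : Measurable fun q : Plane × Plane => pt q.1.fst 0 :=
    measurable_pt_fst.comp measurable_fst
  have a2 : Measurable fun q : Plane × Plane => pt 0 q.1.snd :=
    measurable_pt_snd.comp measurable_fst
  unfold mixedCos
  fun_prop

/-- The integrand, in the Fourier variable `u`, the time `q.1` and the jump `q.2`, of the
representation of the difference of two stable densities at `z`. -/
noncomputable def mixKernel (α : ℝ) (Γ₁ Γ₀ : Measure Plane) (z u : Plane) (q : ℝ × Plane) : ℂ :=
  Complex.exp ((-2 * Real.pi * ⟪u, z⟫ : ℝ) * Complex.I) *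
    (segmentCF α Γ₁ Γ₀ q.1 u * mixedCos q.2 ((2 * Real.pi) • u))

lemma measurable_mixKernel (α : ℝ) (Γ₁ Γ₀ : Measure Plane) [SFinite Γ₁] [SFinite Γ₀] :
    Measurable fun r : (Plane × (ℝ × Plane)) × Plane => mixKernel α Γ₁ Γ₀ r.1.1 r.2 r.1.2 := by
  have a1 := (measurable_segmentCF α Γ₁ Γ₀).comp
    (by fun_prop : Measurable fun r : (Plane × (ℝ × Plane)) × Plane => (r.1.2.1, r.2))
  have a2 := measurable_mixedCos.comp
    (by fun_prop : Measurable fun r : (Plane × (ℝ × Plane)) × Plane => (r.1.2.2, r.2))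
  have a3 : Measurable fun r : (Plane × (ℝ × Plane)) × Plane =>
      Complex.exp ((-2 * Real.pi * ⟪r.2, r.1.1⟫ : ℝ) * Complex.I) := by fun_prop
  simp only [Function.comp_def] at a1 a2
  exact a3.mul (a1.mul (Complex.measurable_ofReal.comp a2))

/-- Integrability in all variables, which justifies exchanging the order of integration. -/
lemma integrable_mixKernel {α β M c : ℝ} (hα : 1 < α) (hc : 0 < c) (hβ : 0 ≤ β)
    {Γ₁ Γ₀ κ : Measure Plane} [SFinite κ] (h₁ : IsSpectral α M c Γ₁) (h₀ : IsSpectral α M c Γ₀)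
    (hκ : ∫⁻ x, ENNReal.ofReal (jumpSize β x.fst * jumpSize β x.snd) ∂κ < ⊤) (z : Plane) :
    Integrable (Function.uncurry (mixKernel α Γ₁ Γ₀ z))
      (volume.prod ((volume.restrict (Ioc 0 1)).prod κ)) := by
  have hα0 : 0 < α := by linarith
  have := h₁.isFiniteMeasure
  have := h₀.isFiniteMeasure
  have m1 := measurable_fst_plane
  have m2 := measurable_snd_plane
  have mj := (continuous_jumpSize hβ).measurable
  have hu : Integrable fun u : Plane => (1 + 2 * Real.pi * ‖u‖) ^ 2 *
      (Real.exp (2 * c) * Real.exp (-(c * ‖u‖))) := by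
    refine ((integrable_pow_mul_exp_neg_norm 2 hc).const_mul
      ((2 * Real.pi) ^ 2 * Real.exp (2 * c))).mono' (Continuous.aestronglyMeasurable (by fun_prop))
      (Filter.Eventually.of_forall fun u => ?_)
    have hpi := Real.pi_gt_three
    rw [Real.norm_eq_abs, abs_of_nonneg (by positivity)]
    calc (1 + 2 * Real.pi * ‖u‖) ^ 2 * (Real.exp (2 * c) * Real.exp (-(c * ‖u‖)))
        ≤ ((2 * Real.pi) * (1 + ‖u‖)) ^ 2 * (Real.exp (2 * c) * Real.exp (-(c * ‖u‖))) := by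
          gcongr
          nlinarith
      _ = _ := by ring
  have hx : Integrable (fun x : Plane => jumpSize β x.fst * jumpSize β x.snd) κ := by
    refine ⟨Measurable.aestronglyMeasurable (by fun_prop), ?_⟩
    rwa [hasFiniteIntegral_iff_ofReal (Filter.Eventually.of_forall fun x =>
      mul_nonneg (jumpSize_nonneg _ _) (jumpSize_nonneg _ _))]
  have ht : Integrable (fun _ : ℝ => (1 : ℝ)) (volume.restrict (Ioc 0 1)) := by simp
  refine ((hu.mul_prod (ht.mul_prod hx)).const_mul 5).mono' ?_ ?_
  · have := (measurable_mixKernel α Γ₁ Γ₀).comp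
      (by fun_prop : Measurable fun r : Plane × (ℝ × Plane) => ((z, r.2), r.1))
    exact this.aestronglyMeasurable
  · have hae : ∀ᵐ q ∂((volume.restrict (Ioc 0 1)).prod κ), q.1 ∈ Ioc (0 : ℝ) 1 :=
      Measure.quasiMeasurePreserving_fst.ae (ae_restrict_mem measurableSet_Ioc)
    have hae' : ∀ᵐ r ∂(volume : Measure Plane).prod ((volume.restrict (Ioc 0 1)).prod κ),
        r.2.1 ∈ Ioc (0 : ℝ) 1 := Measure.quasiMeasurePreserving_snd.ae hae
    filter_upwards [hae'] with r hr
    rw [Function.uncurry, mixKernel, norm_mul, Complex.norm_exp_ofReal_mul_I, one_mul, norm_mul,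
      segmentCF_eq hα0.le h₁.bdd h₀.bdd hr, Complex.norm_real, Real.norm_eq_abs]
    have b1 := norm_stableCF_le hα.le hc (h₁.mixSpectral hα0 hc h₀ (Ioc_subset_Icc_self hr)) r.1
    have b2 := abs_mixedCos_le r.2.2 ((2 * Real.pi) • r.1)
    rw [norm_smul, Real.norm_eq_abs, abs_of_pos Real.two_pi_pos] at b2
    have b3 := min_one_abs_le_jumpSize hβ r.2.2.fst
    have b4 := min_one_abs_le_jumpSize hβ r.2.2.snd
    have j1 := jumpSize_nonneg β r.2.2.fst
    have j2 := jumpSize_nonneg β r.2.2.snd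
    calc _ ≤ (Real.exp (2 * c) * Real.exp (-(c * ‖r.1‖))) *
          (5 * (jumpSize β r.2.2.fst * jumpSize β r.2.2.snd) *
            (1 + 2 * Real.pi * ‖r.1‖) ^ 2) := by
          gcongr
          refine b2.trans ?_
          gcongr
      _ = _ := by ring

/-- The difference between the densities of a stable pair and of the pair with independent
components, tested against tame functions.  The densities are joined by the path
`t Γ + (1 - t) indepSpectral Γ` of spectral measures; along it the derivative of the density is
an average of mixed second differences over the Lévy measure of `Γ`. -/
lemma lintegral_stableDensity_sub_le {α β M c : ℝ} (hα : 1 < α) (hα' : α < 2)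
    (hc : 0 < c) (hβ : 0 ≤ β) {K L : ℝ → ℝ} (hK : Measurable K) (hL : Measurable L)
    {C : ℝ} (hC : ∀ Γ : Measure Plane, IsSpectral α M c Γ → ∀ a : Plane,
      ∫⁻ z : Plane, ‖K z.fst‖ₑ * ‖L z.snd‖ₑ * ‖mixedDiff (stableDensity α Γ) a z‖ₑ ≤
        ENNReal.ofReal (C * (jumpSize β a.fst * jumpSize β a.snd)))
    {Γ : Measure Plane} (h₁ : IsSpectral α M c Γ) (h₀ : IsSpectral α M c (indepSpectral Γ))
    (hκ : ∫⁻ x, ENNReal.ofReal (jumpSize β x.fst * jumpSize β x.snd)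
      ∂(polar (radialLevy α) Γ) < ⊤) :
    ∫⁻ z : Plane, ‖K z.fst‖ₑ * ‖L z.snd‖ₑ *
        ‖stableDensity α Γ z - stableDensity α (indepSpectral Γ) z‖ₑ ≤
      ∫⁻ x, ENNReal.ofReal (C * (jumpSize β x.fst * jumpSize β x.snd))
        ∂(polar (radialLevy α) Γ) := by
  have hα0 : 0 < α := by linarith
  have := h₁.isFiniteMeasure
  have m1 := measurable_fst_plane
  have m2 := measurable_snd_plane
  have mj := (continuous_jumpSize hβ).measurable
  set κ := polar (radialLevy α) Γ with hκdef
  set Γ₀ := indepSpectral Γ with hΓ₀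
  let Θ : Measure (ℝ × Plane) := (volume.restrict (Ioc 0 1)).prod κ
  let Φ := mixKernel α Γ Γ₀
  have hΦm := measurable_mixKernel α Γ Γ₀
  have hΦi : ∀ z, Integrable (Function.uncurry (Φ z)) (volume.prod Θ) :=
    integrable_mixKernel hα hc hβ h₁ h₀ hκ
  have hq : ∀ z, stableDensity α Γ z - stableDensity α Γ₀ z = ∫ q, (∫ u, Φ z u q) ∂Θ := fun z => by
    rw [← integral_integral_swap (hΦi z), stableDensity, stableDensity, Real.fourier_eq',
      Real.fourier_eq']
    simp only [smul_eq_mul]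
    have hi : ∀ Γ' : Measure Plane, IsSpectral α M c Γ' → Integrable fun u =>
        Complex.exp ((-2 * Real.pi * ⟪u, z⟫ : ℝ) * Complex.I) * stableCF α Γ' u := fun Γ' h' => by
      have hf' := integrable_stableCF hα.le hc h'
      refine hf'.norm.mono' (AEStronglyMeasurable.mul
        (Continuous.aestronglyMeasurable (by fun_prop)) hf'.aestronglyMeasurable)
        (Filter.Eventually.of_forall fun u => ?_)
      rw [norm_mul, Complex.norm_exp_ofReal_mul_I, one_mul]
    rw [← integral_sub (hi Γ h₁) (hi Γ₀ h₀)]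
    refine integral_congr_ae (Filter.Eventually.of_forall fun u => ?_)
    simp only [Φ, mixKernel]
    rw [integral_const_mul, ← mul_sub]
    congr 1
    rw [integral_prod_mul (fun t => segmentCF α Γ Γ₀ t u)
        (fun x => (mixedCos x ((2 * Real.pi) • u) : ℂ)),
      integral_complex_ofReal]
    simp only [segmentCF]
    rw [integral_complex_ofReal, integral_mixedCos hα0 hα' h₁.bdd,
      ← Complex.ofReal_mul, integral_exp_segment, stableCF, stableCF, Complex.ofReal_sub]
  have hΨm : Measurable fun r : Plane × (ℝ × Plane) => ∫ u, Φ r.1 u r.2 :=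
    (StronglyMeasurable.integral_prod_right' hΦm.stronglyMeasurable).measurable
  calc ∫⁻ z : Plane, ‖K z.fst‖ₑ * ‖L z.snd‖ₑ * ‖stableDensity α Γ z - stableDensity α Γ₀ z‖ₑ
      ≤ ∫⁻ z : Plane, ∫⁻ q, ‖K z.fst‖ₑ * ‖L z.snd‖ₑ * ‖∫ u, Φ z u q‖ₑ ∂Θ := by
        refine lintegral_mono fun z => ?_
        rw [lintegral_const_mul, hq]
        · gcongr
          exact enorm_integral_le_lintegral_enorm _
        · exact (hΨm.comp (by fun_prop : Measurable fun q : ℝ × Plane => (z, q))).enorm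
    _ = ∫⁻ q, (∫⁻ z : Plane, ‖K z.fst‖ₑ * ‖L z.snd‖ₑ * ‖∫ u, Φ z u q‖ₑ) ∂Θ := by
        refine lintegral_lintegral_swap (Measurable.aemeasurable ?_)
        simp only [Function.uncurry_def]
        have := hΨm.enorm
        fun_prop
    _ ≤ ∫⁻ q, ENNReal.ofReal (C * (jumpSize β q.2.fst * jumpSize β q.2.snd)) ∂Θ := by
        have hae : ∀ᵐ q ∂Θ, q.1 ∈ Ioc (0 : ℝ) 1 :=
          Measure.quasiMeasurePreserving_fst.ae (ae_restrict_mem measurableSet_Ioc)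
        refine lintegral_mono_ae (hae.mono fun q hqt => ?_)
        have hsp := h₁.mixSpectral hα0 hc h₀ (Ioc_subset_Icc_self hqt)
        set h := stableDensity α (mixSpectral q.1 Γ Γ₀) with hh
        have hhc : Continuous h := continuous_stableDensity hα.le hc hsp
        have hmd : ∀ a, Measurable (mixedDiff h a) := fun a =>
          Continuous.measurable (by unfold mixedDiff; fun_prop)
        have e : ∀ z, ∫ u, Φ z u q = (mixedDiff h q.2 z + mixedDiff h (-q.2) z) / 2 := fun z => by
          simp only [Φ, mixKernel, segmentCF_eq hα0.le h₁.bdd h₀.bdd hqt]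
          exact integral_fourier_mul_mixedCos (integrable_stableCF hα.le hc hsp) z q.2
        have hb1 := hC _ hsp q.2
        have hb2 := hC _ hsp (-q.2)
        simp only [WithLp.neg_fst, WithLp.neg_snd, jumpSize_neg] at hb2
        calc ∫⁻ z : Plane, ‖K z.fst‖ₑ * ‖L z.snd‖ₑ * ‖∫ u, Φ z u q‖ₑ
            ≤ ∫⁻ z : Plane, 2⁻¹ * (‖K z.fst‖ₑ * ‖L z.snd‖ₑ * ‖mixedDiff h q.2 z‖ₑ +
                ‖K z.fst‖ₑ * ‖L z.snd‖ₑ * ‖mixedDiff h (-q.2) z‖ₑ) := by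
              refine lintegral_mono fun z => ?_
              have h2 : ‖(2 : ℂ)⁻¹‖ₑ = 2⁻¹ := by
                rw [enorm_inv two_ne_zero]
                congr 1
                rw [← ofReal_norm]; norm_num
              rw [e, div_eq_mul_inv, enorm_mul, h2]
              calc _ ≤ ‖K z.fst‖ₑ * ‖L z.snd‖ₑ *
                    ((‖mixedDiff h q.2 z‖ₑ + ‖mixedDiff h (-q.2) z‖ₑ) * 2⁻¹) :=
                    mul_le_mul_right (mul_le_mul_left (enorm_add_le _ _) _) _
                _ = _ := by ring
          _ ≤ 2⁻¹ * (ENNReal.ofReal (C * (jumpSize β q.2.fst * jumpSize β q.2.snd)) +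
                ENNReal.ofReal (C * (jumpSize β q.2.fst * jumpSize β q.2.snd))) := by
              have hm1 := hmd q.2
              rw [lintegral_const_mul' _ _ (by simp), lintegral_add_left (by fun_prop)]
              gcongr
          _ = _ := by
              rw [← two_mul, ← mul_assoc, ENNReal.inv_mul_cancel (by simp) (by simp), one_mul]
    _ = ∫⁻ x, ENNReal.ofReal (C * (jumpSize β x.fst * jumpSize β x.snd)) ∂κ := by
        rw [lintegral_prod _ (Measurable.aemeasurable (by fun_prop))]
        simp

end Interpolation

/-! ### Spectral measures -/

section JumpIntegral

open scoped RealInnerProductSpace ENNReal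

lemma two_mul_rpow_le {β r : ℝ} (hβ1 : β ≤ 1) (hr : 0 ≤ r) : (2 * r) ^ β ≤ 2 * r ^ β := by
  rw [Real.mul_rpow zero_le_two hr]
  gcongr
  calc (2 : ℝ) ^ β ≤ 2 ^ (1 : ℝ) := Real.rpow_le_rpow_of_exponent_le one_le_two hβ1
    _ = 2 := Real.rpow_one 2

lemma jumpSize_le_of_le_one {β a : ℝ} (hβ : 0 ≤ β) (hβ1 : β ≤ 1) (h : |a| ≤ 1) :
    jumpSize β a ≤ 2 * |a| := by
  rw [jumpSize, min_eq_right h, mul_comm]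
  have h1 : (1 + |a|) ^ β ≤ (2 * 1) ^ β :=
    Real.rpow_le_rpow (by positivity) (by linarith) hβ
  have h2 : ((2 : ℝ) * 1) ^ β ≤ 2 := by simpa using two_mul_rpow_le hβ1 zero_le_one
  exact mul_le_mul_of_nonneg_right (h1.trans h2) (abs_nonneg a)

lemma jumpSize_le_of_one_le {β a : ℝ} (hβ : 0 ≤ β) (hβ1 : β ≤ 1) (h : 1 ≤ |a|) :
    jumpSize β a ≤ 2 * |a| ^ β := by
  rw [jumpSize, min_eq_left h, one_mul]
  exact (Real.rpow_le_rpow (by positivity) (by linarith) hβ).trans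
    (two_mul_rpow_le hβ1 (abs_nonneg a))

lemma jumpSize_le_rpow {β γ a : ℝ} (hβ : 0 ≤ β) (hβγ : β ≤ γ) (hγ : 0 < γ) (hγ1 : γ ≤ 1) :
    jumpSize β a ≤ 2 * |a| ^ γ := by
  rcases le_total |a| 1 with h | h
  · refine (jumpSize_le_of_le_one hβ (hβγ.trans hγ1) h).trans ?_
    gcongr
    rcases (abs_nonneg a).eq_or_lt' with h0 | h0
    · rw [h0, Real.zero_rpow hγ.ne']
    · simpa using Real.rpow_le_rpow_of_exponent_ge h0 h hγ1
  · refine (jumpSize_le_of_one_le hβ (hβγ.trans hγ1) h).trans ?_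
    gcongr

/-- Interpolating between `|a|` and `|a|^β` with the exponent `α / 2` turns the integral of the
jump sizes over the Lévy measure into the dependence measure `∫ |xy|^(α/2)`.  The assumption
`β < α / 2` gives convergence at infinity and `α < 2` gives convergence near the origin. -/
lemma lintegral_jumpSize_le {α β : ℝ} (hα : 0 < α) (hα' : α < 2) (hβ : 0 ≤ β)
    (hβα : β < α / 2) {Γ : Measure Plane} [SFinite Γ]
    (hΓ : ∀ᵐ θ ∂Γ, max |θ.fst| |θ.snd| = 1) :
    ∫⁻ x, ENNReal.ofReal (jumpSize β x.fst * jumpSize β x.snd) ∂(polar (radialLevy α) Γ) ≤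
      ENNReal.ofReal (4 * radialMoment α (1 + α / 2) (β + α / 2)) *
        ∫⁻ θ, ENNReal.ofReal (|θ.fst * θ.snd| ^ (α / 2)) ∂Γ := by
  have m1 := measurable_fst_plane
  have m2 := measurable_snd_plane
  have mj := (continuous_jumpSize hβ).measurable
  have hβ1 : β ≤ 1 := by linarith
  have hm := radialMoment_nonneg α (1 + α / 2) (β + α / 2)
  rw [lintegral_polar (by fun_prop), ← lintegral_const_mul _ (by fun_prop)]
  refine lintegral_mono_ae (hΓ.mono fun θ hθ => ?_)
  -- the product of jump sizes when `x` is the dominating coordinate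
  have small : ∀ x y r : ℝ, |x| = 1 → 0 < r → r ≤ 1 → jumpSize β (r * x) * jumpSize β (r * y) ≤
      4 * |x * y| ^ (α / 2) * r ^ (1 + α / 2) := fun x y r hx hr hr1 => by
    have e1 := jumpSize_le_of_le_one (a := r * x) hβ hβ1 (by
      rw [abs_mul, hx, mul_one, abs_of_pos hr]; exact hr1)
    have e2 := jumpSize_le_rpow (a := r * y) hβ hβα.le (by linarith) (by linarith)
    rw [abs_mul, hx, mul_one, abs_of_pos hr] at e1
    rw [abs_mul, abs_of_pos hr, Real.mul_rpow hr.le (abs_nonneg y)] at e2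
    rw [abs_mul, hx, one_mul, Real.rpow_add hr, Real.rpow_one]
    calc _ ≤ (2 * r) * (2 * (r ^ (α / 2) * |y| ^ (α / 2))) :=
          mul_le_mul e1 e2 (jumpSize_nonneg _ _) (by positivity)
      _ = _ := by ring
  have large : ∀ x y r : ℝ, |x| = 1 → 1 < r → jumpSize β (r * x) * jumpSize β (r * y) ≤
      4 * |x * y| ^ (α / 2) * r ^ (β + α / 2) := fun x y r hx hr => by
    have hr0 : 0 < r := one_pos.trans hr
    have e1 := jumpSize_le_of_one_le (a := r * x) hβ hβ1 (by
      rw [abs_mul, hx, mul_one, abs_of_pos hr0]; exact hr.le)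
    have e2 := jumpSize_le_rpow (a := r * y) hβ hβα.le (by linarith) (by linarith)
    rw [abs_mul, hx, mul_one, abs_of_pos hr0] at e1
    rw [abs_mul, abs_of_pos hr0, Real.mul_rpow hr0.le (abs_nonneg y)] at e2
    rw [abs_mul, hx, one_mul, Real.rpow_add hr0]
    calc _ ≤ (2 * r ^ β) * (2 * (r ^ (α / 2) * |y| ^ (α / 2))) :=
          mul_le_mul e1 e2 (jumpSize_nonneg _ _) (by positivity)
      _ = _ := by ring
  have hor : |θ.fst| = 1 ∨ |θ.snd| = 1 := by
    rcases max_choice |θ.fst| |θ.snd| with h | h <;> rw [h] at hθ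
    · exact Or.inl hθ
    · exact Or.inr hθ
  have key := lintegral_radial_le (α := α) (s := 1 + α / 2) (t := β + α / 2)
    (F := fun r => ENNReal.ofReal (jumpSize β (r • θ).fst * jumpSize β (r • θ).snd))
    (A := ENNReal.ofReal (4 * |θ.fst * θ.snd| ^ (α / 2))) (by linarith) (by linarith)
    (fun r hr hr1 => by
      rw [← ENNReal.ofReal_mul (by positivity)]
      refine ENNReal.ofReal_le_ofReal ?_
      simp only [WithLp.smul_fst, WithLp.smul_snd, smul_eq_mul]
      rcases hor with h | h
      · exact small _ _ r h hr hr1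
      · rw [mul_comm, mul_comm θ.fst]; exact small _ _ r h hr hr1)
    (fun r hr => by
      rw [← ENNReal.ofReal_mul (by positivity)]
      refine ENNReal.ofReal_le_ofReal ?_
      simp only [WithLp.smul_fst, WithLp.smul_snd, smul_eq_mul]
      rcases hor with h | h
      · exact large _ _ r h hr
      · rw [mul_comm, mul_comm θ.fst]; exact large _ _ r h hr)
  refine key.trans (le_of_eq ?_)
  rw [ENNReal.ofReal_mul zero_le_four, ENNReal.ofReal_mul zero_le_four]
  ring

end JumpIntegral

section SpectralMeasure

open scoped RealInnerProductSpace ENNReal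

variable {S : Type*} [MeasurableSpace S]

/-- The spectral measure on the unit sphere of the supremum norm of the pair represented by
`f` and `g`: the image of `max(|f|, |g|)^α • μ` under the normalised pair `(f, g)`.  Points where
`f = g = 0` carry no mass, so division by zero is harmless. -/
noncomputable def spectralMeasure (α : ℝ) (μ : Measure S) (f g : S → ℝ) : Measure Plane :=
  (μ.withDensity fun s => ENNReal.ofReal (max |f s| |g s| ^ α)).map
    fun s => pt (f s / max |f s| |g s|) (g s / max |f s| |g s|)

lemma aemeasurable_normalised {μ : Measure S} {f g : S → ℝ} (hf : AEMeasurable f μ)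
    (hg : AEMeasurable g μ) :
    AEMeasurable (fun s => pt (f s / max |f s| |g s|) (g s / max |f s| |g s|)) μ := by
  have h : AEMeasurable (fun s => max |f s| |g s|) μ :=
    (continuous_abs.measurable.comp_aemeasurable hf).max
      (continuous_abs.measurable.comp_aemeasurable hg)
  exact (WithLp.measurable_toLp 2 (ℝ × ℝ)).comp_aemeasurable ((hf.div h).prodMk (hg.div h))

lemma aemeasurable_max_rpow {μ : Measure S} {f g : S → ℝ} (α : ℝ) (hf : AEMeasurable f μ)
    (hg : AEMeasurable g μ) :
    AEMeasurable (fun s => ENNReal.ofReal (max |f s| |g s| ^ α)) μ := by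
  have h : AEMeasurable (fun s => max |f s| |g s|) μ :=
    (continuous_abs.measurable.comp_aemeasurable hf).max
      (continuous_abs.measurable.comp_aemeasurable hg)
  exact (h.pow_const α).ennreal_ofReal

lemma lintegral_spectralMeasure {α : ℝ} {μ : Measure S} {f g : S → ℝ} (hf : AEMeasurable f μ)
    (hg : AEMeasurable g μ) {F : Plane → ℝ≥0∞} (hF : Measurable F) :
    ∫⁻ θ, F θ ∂(spectralMeasure α μ f g) =
      ∫⁻ s, ENNReal.ofReal (max |f s| |g s| ^ α) *
        F (pt (f s / max |f s| |g s|) (g s / max |f s| |g s|)) ∂μ := by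
  have hac := withDensity_absolutelyContinuous μ fun s => ENNReal.ofReal (max |f s| |g s| ^ α)
  have hm := aemeasurable_normalised hf hg
  rw [spectralMeasure, lintegral_map' hF.aemeasurable (hm.mono_ac hac)]
  exact lintegral_withDensity_eq_lintegral_mul₀ (aemeasurable_max_rpow α hf hg)
    (hF.comp_aemeasurable hm)

lemma integral_spectralMeasure {α : ℝ} {μ : Measure S} {f g : S → ℝ} (hf : AEMeasurable f μ)
    (hg : AEMeasurable g μ) {F : Plane → ℝ} (hF : Measurable F) :
    ∫ θ, F θ ∂(spectralMeasure α μ f g) =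
      ∫ s, max |f s| |g s| ^ α *
        F (pt (f s / max |f s| |g s|) (g s / max |f s| |g s|)) ∂μ := by
  have hac := withDensity_absolutelyContinuous μ fun s => ENNReal.ofReal (max |f s| |g s| ^ α)
  have hm := aemeasurable_normalised hf hg
  rw [spectralMeasure, integral_map (hm.mono_ac hac) hF.aestronglyMeasurable,
    integral_withDensity_eq_integral_toReal_smul₀ (aemeasurable_max_rpow α hf hg) (by simp)]
  refine integral_congr_ae (Filter.Eventually.of_forall fun s => ?_)
  simp only [smul_eq_mul]
  rw [ENNReal.toReal_ofReal (by positivity)]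

/-- Homogeneity: a factor `max(|x|, |y|)^α` is absorbed by functions of degree `α`. -/
lemma max_rpow_mul_abs_rpow {α : ℝ} (hα : 0 < α) (x y u v : ℝ) :
    max |x| |y| ^ α * |x / max |x| |y| * u + y / max |x| |y| * v| ^ α = |u * x + v * y| ^ α := by
  rcases (le_max_of_le_left (abs_nonneg x) : 0 ≤ max |x| |y|).eq_or_lt' with h | h
  · have hx : x = 0 := abs_nonpos_iff.1 (h ▸ le_max_left _ _)
    have hy : y = 0 := abs_nonpos_iff.1 (h ▸ le_max_right _ _)
    simp [hx, hy, Real.zero_rpow hα.ne']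
  · rw [← Real.mul_rpow h.le (abs_nonneg _)]
    congr 1
    rw [← abs_of_pos h, ← abs_mul, abs_of_pos h]
    congr 1
    field_simp

lemma max_rpow_mul_abs_mul_rpow {α : ℝ} (hα : 0 < α) (x y : ℝ) :
    max |x| |y| ^ α * |x / max |x| |y| * (y / max |x| |y|)| ^ (α / 2) = |x * y| ^ (α / 2) := by
  rcases (le_max_of_le_left (abs_nonneg x) : 0 ≤ max |x| |y|).eq_or_lt' with h | h
  · have hx : x = 0 := abs_nonpos_iff.1 (h ▸ le_max_left _ _)
    simp [hx, Real.zero_rpow (half_pos hα).ne']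
  · set n := max |x| |y|
    have e : n ^ α = (n ^ 2) ^ (α / 2) := by
      rw [← Real.rpow_natCast, ← Real.rpow_mul h.le]; congr 1; push_cast; ring
    rw [e, ← Real.mul_rpow (by positivity) (abs_nonneg _)]
    congr 1
    rw [← abs_of_nonneg (by positivity : 0 ≤ n ^ 2), ← abs_mul]
    congr 1
    field_simp

lemma aNorm_rpow {α : ℝ} (hα : 0 < α) (μ : Measure S) (f : S → ℝ) :
    aNorm α μ f ^ α = ∫ s, |f s| ^ α ∂μ := by
  rw [aNorm, ← Real.rpow_mul (integral_nonneg fun s => by positivity),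
    one_div_mul_cancel hα.ne', Real.rpow_one]

lemma aNorm_nonneg (α : ℝ) (μ : Measure S) (f : S → ℝ) : 0 ≤ aNorm α μ f :=
  Real.rpow_nonneg (integral_nonneg fun s => by positivity) _

lemma aNorm_const_mul_rpow {α : ℝ} (hα : 0 < α) (μ : Measure S) (f : S → ℝ) (u : ℝ) :
    aNorm α μ (fun s => u * f s) ^ α = |u| ^ α * aNorm α μ f ^ α := by
  rw [aNorm_rpow hα, aNorm_rpow hα, ← integral_const_mul]
  simp only [abs_mul, Real.mul_rpow (abs_nonneg _) (abs_nonneg _)]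

lemma integrable_abs_rpow {α : ℝ} (hα : 0 < α) {μ : Measure S} {f : S → ℝ}
    (hf : MemLp f (ENNReal.ofReal α) μ) : Integrable (fun s => |f s| ^ α) μ := by
  have := hf.integrable_norm_rpow (by simpa using hα) (by simp)
  simpa [ENNReal.toReal_ofReal hα.le] using this

variable {α : ℝ} {μ : Measure S} {f g : S → ℝ}

lemma stableExp_spectralMeasure (hα : 0 < α) (hf : AEMeasurable f μ) (hg : AEMeasurable g μ)
    (u : Plane) :
    stableExp α (spectralMeasure α μ f g) u =
      aNorm α μ (fun s => u.fst * f s + u.snd * g s) ^ α := by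
  have hm : Measurable fun θ : Plane => ⟪θ, u⟫ := by fun_prop
  rw [stableExp, integral_spectralMeasure hf hg (by fun_prop), aNorm_rpow hα]
  refine integral_congr_ae (Filter.Eventually.of_forall fun s => ?_)
  simp only [plane_inner, WithLp.toLp_fst, WithLp.toLp_snd]
  exact max_rpow_mul_abs_rpow hα _ _ _ _

lemma spectralMeasure_univ_le (hα : 0 < α) (hf : MemLp f (ENNReal.ofReal α) μ)
    (hg : MemLp g (ENNReal.ofReal α) μ) :
    spectralMeasure α μ f g univ ≤ ENNReal.ofReal (aNorm α μ f ^ α + aNorm α μ g ^ α) := by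
  have hfi := integrable_abs_rpow hα hf
  have hgi := integrable_abs_rpow hα hg
  have hsum : Integrable (fun s => |f s| ^ α + |g s| ^ α) μ := hfi.add hgi
  rw [← lintegral_one, lintegral_spectralMeasure hf.1.aemeasurable hg.1.aemeasurable
    measurable_const, aNorm_rpow hα, aNorm_rpow hα, ← integral_add hfi hgi,
    ofReal_integral_eq_lintegral_ofReal hsum (Filter.Eventually.of_forall fun s => by positivity)]
  refine lintegral_mono fun s => ?_
  rw [mul_one]
  refine ENNReal.ofReal_le_ofReal ?_
  have h1 : 0 ≤ |f s| ^ α := by positivity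
  have h2 : 0 ≤ |g s| ^ α := by positivity
  rcases max_choice |f s| |g s| with h | h <;> rw [h] <;> linarith

lemma ae_spectralMeasure_max (hα : 0 < α) (hf : AEMeasurable f μ) (hg : AEMeasurable g μ) :
    ∀ᵐ θ ∂(spectralMeasure α μ f g), max |θ.fst| |θ.snd| = 1 := by
  have hm : Measurable fun θ : Plane => max |θ.fst| |θ.snd| :=
    (continuous_abs.measurable.comp measurable_fst_plane).max
      (continuous_abs.measurable.comp measurable_snd_plane)
  have hset : MeasurableSet {θ : Plane | max |θ.fst| |θ.snd| = 1} := hm (measurableSet_singleton 1)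
  have hac := withDensity_absolutelyContinuous μ fun s => ENNReal.ofReal (max |f s| |g s| ^ α)
  rw [spectralMeasure, ae_map_iff ((aemeasurable_normalised hf hg).mono_ac hac) hset,
    ae_withDensity_iff' (aemeasurable_max_rpow α hf hg)]
  refine Filter.Eventually.of_forall fun s hs => ?_
  have hpos : 0 < max |f s| |g s| := by
    refine lt_of_le_of_ne (le_max_of_le_left (abs_nonneg _)) fun h => hs ?_
    rw [← h, Real.zero_rpow hα.ne', ENNReal.ofReal_zero]
  simp only [WithLp.toLp_fst, WithLp.toLp_snd, abs_div, abs_of_pos hpos]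
  exact (max_div_div_right hpos.le _ _).trans (div_self hpos.ne')

lemma lintegral_spectralMeasure_dep2 (hα : 0 < α) (hf : MemLp f (ENNReal.ofReal α) μ)
    (hg : MemLp g (ENNReal.ofReal α) μ) :
    ∫⁻ θ, ENNReal.ofReal (|θ.fst * θ.snd| ^ (α / 2)) ∂(spectralMeasure α μ f g) =
      ENNReal.ofReal (dep2 α μ f g) := by
  have m1 := measurable_fst_plane
  have m2 := measurable_snd_plane
  have hfm := hf.1.aemeasurable
  have hgm := hg.1.aemeasurable
  have hint : Integrable (fun s => |f s * g s| ^ (α / 2)) μ := by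
    refine ((integrable_abs_rpow hα hf).add (integrable_abs_rpow hα hg)).mono' ?_
      (Filter.Eventually.of_forall fun s => ?_)
    · exact ((continuous_abs.measurable.comp_aemeasurable (hfm.mul hgm)).pow_const
        _).aestronglyMeasurable
    · rw [Real.norm_eq_abs, abs_of_nonneg (by positivity), abs_mul,
        Real.mul_rpow (abs_nonneg _) (abs_nonneg _), Pi.add_apply]
      have e : ∀ x : ℝ, |x| ^ α = (|x| ^ (α / 2)) ^ 2 := fun x => by
        rw [← Real.rpow_natCast, ← Real.rpow_mul (abs_nonneg x)]; congr 1; push_cast; ring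
      rw [e, e]
      nlinarith [sq_nonneg (|f s| ^ (α / 2) - |g s| ^ (α / 2)), sq_nonneg (|f s| ^ (α / 2)),
        sq_nonneg (|g s| ^ (α / 2))]
  rw [lintegral_spectralMeasure hfm hgm (by fun_prop), dep2,
    ofReal_integral_eq_lintegral_ofReal hint (Filter.Eventually.of_forall fun s => by positivity)]
  refine lintegral_congr fun s => ?_
  rw [← ENNReal.ofReal_mul (by positivity)]
  simp only [WithLp.toLp_fst, WithLp.toLp_snd]
  rw [max_rpow_mul_abs_mul_rpow hα]

lemma bdd_of_max_eq_one {Γ : Measure Plane} (h : ∀ᵐ θ ∂Γ, max |θ.fst| |θ.snd| = 1) :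
    ∀ᵐ θ ∂Γ, |θ.fst| ≤ 1 ∧ |θ.snd| ≤ 1 :=
  h.mono fun _ hθ => ⟨hθ ▸ le_max_left _ _, hθ ▸ le_max_right _ _⟩

end SpectralMeasure

/-! ### Covariance of functions of a stable pair -/

section OneDimensional

open scoped RealInnerProductSpace ENNReal

lemma stableExp_axes {α a : ℝ} (ha : 0 ≤ a) (u : Plane) :
    stableExp α (ENNReal.ofReal a • (Measure.dirac (pt 1 0) + Measure.dirac (pt 0 1))) u =
      a * (|u.fst| ^ α + |u.snd| ^ α) := by
  have hi : ∀ x : Plane, Integrable (fun θ : Plane => |⟪θ, u⟫| ^ α) (Measure.dirac x) :=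
    fun x => integrable_dirac (by simp)
  rw [stableExp, integral_smul_measure, integral_add_measure (hi _) (hi _), integral_dirac,
    integral_dirac, ENNReal.toReal_ofReal ha]
  simp

lemma isSpectral_axes {α a : ℝ} (ha : 0 ≤ a) :
    IsSpectral α (2 * a) a
      (ENNReal.ofReal a • (Measure.dirac (pt 1 0) + Measure.dirac (pt 0 1))) where
  mass := by
    have : ENNReal.ofReal (2 * a) = ENNReal.ofReal a * 2 := by
      rw [mul_comm, ENNReal.ofReal_mul ha]; simp
    rw [this]
    simp [mul_two]
  bdd := by
    refine Measure.ae_smul_measure ?_ _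
    rw [ae_add_measure_iff]
    constructor <;> rw [ae_dirac_eq] <;> simp
  lower u := (stableExp_axes ha u).ge

lemma eq_dirac_of_charFun_eq_one {m : Measure ℝ} [IsFiniteMeasure m]
    (h : ∀ u, charFun m u = 1) : m = Measure.dirac 0 :=
  Measure.ext_of_charFun (funext fun u => by rw [h, charFun_dirac]; simp)

/-- A tame function is integrable for every symmetric `α`-stable law on the line.  The law is
viewed as a factor of a product law on the plane; the scale `a = 0` gives the point mass. -/
lemma IsTame.integrable_of_charFun {α β C a : ℝ} (hα : 1 < α) (hα' : α < 2) (hβ : 0 ≤ β)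
    (hβα : β < α / 2) {K : ℝ → ℝ} (hK : IsTame β C K) (ha : 0 ≤ a) {m : Measure ℝ}
    [IsProbabilityMeasure m] (hm : ∀ u : ℝ, charFun m u = (Real.exp (-(|u| ^ α * a)) : ℝ)) :
    Integrable K m := by
  rcases ha.eq_or_lt' with h0 | h0
  · have e : m = Measure.dirac 0 := eq_dirac_of_charFun_eq_one fun u => by rw [hm, h0]; simp
    rw [e]
    exact integrable_dirac (by simp)
  -- Two independent copies of `m`, and the constant function `1` in the second variable.
  obtain ⟨C₂, h2⟩ := isTame_one
  obtain ⟨D, -, hD⟩ := exists_lintegral_stableDensity_le (M := 2 * a) hα hα' h0 (by positivity) hβ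
    hβα hK (h2.mono hβ)
  set Γ := ENNReal.ofReal a • (Measure.dirac (pt 1 0) + Measure.dirac (pt 0 1)) with hΓ
  have hs : IsSpectral α (2 * a) a Γ := isSpectral_axes ha
  have hfin := (hD Γ hs).1.trans_lt ENNReal.ofReal_lt_top
  have hρ : ∀ u : Plane, charFun ((m.prod m).map (WithLp.toLp 2)) u =
      (Real.exp (-stableExp α Γ u) : ℝ) := fun u => by
    rw [charFun_prod, hm, hm, stableExp_axes ha, ← Complex.ofReal_mul, ← Real.exp_add]
    congr 2
    simp only [WithLp.ofLp_fst, WithLp.ofLp_snd]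
    ring
  have key := (integral_eq_integral_stableDensity hα hα' h0 hs
    (ρ := (m.prod m).map (WithLp.toLp 2)) hρ (F := fun z => K z.fst)
    (hK.measurable.comp measurable_fst_plane) (by simpa using hfin)).1
  have key' := (integrable_map_measure key.1
    (WithLp.measurable_toLp 2 (ℝ × ℝ)).aemeasurable).1 key
  exact (measurePreserving_fst (μ := m) (ν := m)).integrable_comp
    hK.measurable.aestronglyMeasurable |>.1 key'

end OneDimensional

section StablePair

open scoped RealInnerProductSpace ENNReal

variable {Ω S : Type*} [MeasurableSpace Ω] [MeasurableSpace S] {α : ℝ} {P : Measure Ω}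
  {ξ η : Ω → ℝ} {μ : Measure S} {f g : S → ℝ}

lemma IsStablePair.charFun_fst (hα : 0 < α) (h : IsStablePair α P ξ η μ f g) (u : ℝ) :
    charFun (P.map ξ) u = (Real.exp (-(|u| ^ α * aNorm α μ f ^ α)) : ℝ) := by
  have := h.charFun_eq u 0
  simp only [zero_mul, add_zero] at this
  rw [aNorm_const_mul_rpow hα] at this
  rw [charFun_apply_real, integral_map h.aemeasurable_fst (by fun_prop), Complex.ofReal_exp, ← this]
  congr 1 with ω
  congr 1
  push_cast
  ring

lemma IsStablePair.charFun_snd (hα : 0 < α) (h : IsStablePair α P ξ η μ f g) (v : ℝ) :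
    charFun (P.map η) v = (Real.exp (-(|v| ^ α * aNorm α μ g ^ α)) : ℝ) := by
  have := h.charFun_eq 0 v
  simp only [zero_mul, zero_add] at this
  rw [aNorm_const_mul_rpow hα] at this
  rw [charFun_apply_real, integral_map h.aemeasurable_snd (by fun_prop), Complex.ofReal_exp, ← this]
  congr 1 with ω
  congr 1
  push_cast
  ring

lemma IsStablePair.integrable_comp_fst [IsProbabilityMeasure P] {β C : ℝ} (hα : 1 < α)
    (hα' : α < 2) (hβ : 0 ≤ β) (hβα : β < α / 2) {K : ℝ → ℝ} (hK : IsTame β C K)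
    (h : IsStablePair α P ξ η μ f g) : Integrable (fun ω => K (ξ ω)) P := by
  have := Measure.isProbabilityMeasure_map h.aemeasurable_fst
  exact (integrable_map_measure hK.measurable.aestronglyMeasurable h.aemeasurable_fst).1
    (hK.integrable_of_charFun hα hα' hβ hβα (Real.rpow_nonneg (aNorm_nonneg α μ f) α)
      (h.charFun_fst (by linarith)))

lemma IsStablePair.integrable_comp_snd [IsProbabilityMeasure P] {β C : ℝ} (hα : 1 < α)
    (hα' : α < 2) (hβ : 0 ≤ β) (hβα : β < α / 2) {L : ℝ → ℝ} (hL : IsTame β C L)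
    (h : IsStablePair α P ξ η μ f g) : Integrable (fun ω => L (η ω)) P := by
  have := Measure.isProbabilityMeasure_map h.aemeasurable_snd
  exact (integrable_map_measure hL.measurable.aestronglyMeasurable h.aemeasurable_snd).1
    (hL.integrable_of_charFun hα hα' hβ hβα (Real.rpow_nonneg (aNorm_nonneg α μ g) α)
      (h.charFun_snd (by linarith)))

lemma IsStablePair.aemeasurable_pt (h : IsStablePair α P ξ η μ f g) :
    AEMeasurable (fun ω => pt (ξ ω) (η ω)) P :=
  (WithLp.measurable_toLp 2 (ℝ × ℝ)).comp_aemeasurable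
    (h.aemeasurable_fst.prodMk h.aemeasurable_snd)

lemma IsStablePair.charFun_joint (hα : 0 < α) (h : IsStablePair α P ξ η μ f g) (u : Plane) :
    charFun (P.map fun ω => pt (ξ ω) (η ω)) u =
      (Real.exp (-stableExp α (spectralMeasure α μ f g) u) : ℝ) := by
  rw [stableExp_spectralMeasure hα h.memLp_fst.1.aemeasurable h.memLp_snd.1.aemeasurable,
    Complex.ofReal_exp, ← h.charFun_eq, charFun_apply, integral_map h.aemeasurable_pt (by fun_prop)]
  congr 1 with ω
  congr 1
  simp only [plane_inner, WithLp.toLp_fst, WithLp.toLp_snd]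
  push_cast
  ring

lemma stableExp_spectralMeasure_fst (hα : 0 < α) (h : IsStablePair α P ξ η μ f g) (x : ℝ) :
    stableExp α (spectralMeasure α μ f g) (pt x 0) = |x| ^ α * aNorm α μ f ^ α := by
  rw [stableExp_spectralMeasure hα h.memLp_fst.1.aemeasurable h.memLp_snd.1.aemeasurable]
  simp only [WithLp.toLp_fst, WithLp.toLp_snd, zero_mul, add_zero]
  exact aNorm_const_mul_rpow hα μ f x

lemma stableExp_spectralMeasure_snd (hα : 0 < α) (h : IsStablePair α P ξ η μ f g) (y : ℝ) :
    stableExp α (spectralMeasure α μ f g) (pt 0 y) = |y| ^ α * aNorm α μ g ^ α := by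
  rw [stableExp_spectralMeasure hα h.memLp_fst.1.aemeasurable h.memLp_snd.1.aemeasurable]
  simp only [WithLp.toLp_fst, WithLp.toLp_snd, zero_mul, zero_add]
  exact aNorm_const_mul_rpow hα μ g y

/-- A component of vanishing scale parameter is almost surely zero. -/
lemma ae_eq_zero_of_charFun [IsProbabilityMeasure P] {X : Ω → ℝ} (hX : AEMeasurable X P)
    (h : ∀ u, charFun (P.map X) u = 1) : ∀ᵐ ω ∂P, X ω = 0 := by
  have := Measure.isProbabilityMeasure_map hX
  have e := eq_dirac_of_charFun_eq_one h
  have : ∀ᵐ x ∂(P.map X), x = 0 := by rw [e, ae_dirac_eq]; simp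
  exact ae_of_ae_map hX this

lemma dep1_nonneg (α : ℝ) (μ : Measure S) (f g : S → ℝ) : 0 ≤ dep1 α μ f g :=
  add_nonneg (integral_nonneg fun s => by positivity) (integral_nonneg fun s => by positivity)

lemma dep2_nonneg (α : ℝ) (μ : Measure S) (f g : S → ℝ) : 0 ≤ dep2 α μ f g :=
  integral_nonneg fun s => by positivity

/-- The product formula under integrability alone: `covariance_eq_sub` asks for square
integrability, which fails when `K` or `L` has an integrable but not square integrable
singularity. -/
lemma covariance_eq_integral_mul_sub [IsProbabilityMeasure P] {X Y : Ω → ℝ} (hX : Integrable X P)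
    (hY : Integrable Y P) (hXY : Integrable (fun ω => X ω * Y ω) P) :
    cov[X, Y; P] = (∫ ω, X ω * Y ω ∂P) - (∫ ω, X ω ∂P) * ∫ ω, Y ω ∂P := by
  rw [covariance]
  set a := ∫ ω, X ω ∂P
  set b := ∫ ω, Y ω ∂P
  have e : ∀ ω, (X ω - a) * (Y ω - b) = X ω * Y ω - X ω * b - a * Y ω + a * b := fun ω => by ring
  have h1 : Integrable (fun ω => X ω * Y ω - X ω * b) P := hXY.sub (hX.mul_const b)
  have h2 : Integrable (fun ω => X ω * Y ω - X ω * b - a * Y ω) P := h1.sub (hY.const_mul a)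
  simp only [e]
  rw [integral_add h2 (integrable_const _), integral_sub h1 (hY.const_mul a),
    integral_sub hXY (hX.mul_const b), integral_mul_const, integral_const_mul, integral_const,
    probReal_univ, one_smul]
  ring

lemma covariance_ae_const_left [IsProbabilityMeasure P] {X Y : Ω → ℝ} {k : ℝ}
    (hX : ∀ᵐ ω ∂P, X ω = k) : cov[X, Y; P] = 0 := by
  have e : ∫ ω, X ω ∂P = k := by rw [integral_congr_ae hX]; simp
  rw [covariance, e]
  refine integral_eq_zero_of_ae (hX.mono fun ω hω => ?_)
  simp [hω]

/-- The spectral measure and its independent counterpart satisfy the uniform bounds, with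
constants depending only on the scale parameters and on `ε`. -/
lemma IsStablePair.isSpectral {ε : ℝ} (hα : 0 < α) (hε : 0 ≤ ε)
    (h : IsStablePair α P ξ η μ f g) (hA : AssumptionA2 α μ f g ε) :
    IsSpectral α (2 * (aNorm α μ f ^ α + aNorm α μ g ^ α))
      (min ε 1 * min (aNorm α μ f ^ α) (aNorm α μ g ^ α)) (spectralMeasure α μ f g) ∧
    IsSpectral α (2 * (aNorm α μ f ^ α + aNorm α μ g ^ α))
      (min ε 1 * min (aNorm α μ f ^ α) (aNorm α μ g ^ α))
      (indepSpectral (spectralMeasure α μ f g)) := by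
  have hfm := h.memLp_fst.1.aemeasurable
  have hgm := h.memLp_snd.1.aemeasurable
  have hmass := spectralMeasure_univ_le hα h.memLp_fst h.memLp_snd
  have hbdd := bdd_of_max_eq_one (ae_spectralMeasure_max hα hfm hgm)
  have hfin : IsFiniteMeasure (spectralMeasure α μ f g) :=
    ⟨hmass.trans_lt ENNReal.ofReal_lt_top⟩
  have hs : 0 ≤ aNorm α μ f ^ α := Real.rpow_nonneg (aNorm_nonneg _ _ _) _
  have ht : 0 ≤ aNorm α μ g ^ α := Real.rpow_nonneg (aNorm_nonneg _ _ _) _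
  have hlow : ∀ u : Plane, min (aNorm α μ f ^ α) (aNorm α μ g ^ α) *
      (|u.fst| ^ α + |u.snd| ^ α) ≤
        |u.fst| ^ α * aNorm α μ f ^ α + |u.snd| ^ α * aNorm α μ g ^ α := fun u => by
    rw [mul_add, mul_comm, mul_comm _ (|u.snd| ^ α)]
    gcongr
    · exact min_le_left _ _
    · exact min_le_right _ _
  have hpos : ∀ u : Plane,
      0 ≤ |u.fst| ^ α * aNorm α μ f ^ α + |u.snd| ^ α * aNorm α μ g ^ α := fun u => by
    positivity
  have hmin : 0 ≤ min ε 1 := le_min hε zero_le_one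
  have ofReal_two : ENNReal.ofReal (2 * (aNorm α μ f ^ α + aNorm α μ g ^ α)) =
      ENNReal.ofReal (aNorm α μ f ^ α + aNorm α μ g ^ α) +
        ENNReal.ofReal (aNorm α μ f ^ α + aNorm α μ g ^ α) := by
    rw [← ENNReal.ofReal_add (by positivity) (by positivity), two_mul]
  refine ⟨⟨?_, hbdd, fun u => ?_⟩, ⟨?_, bdd_indepSpectral hbdd, fun u => ?_⟩⟩
  · exact hmass.trans (ENNReal.ofReal_le_ofReal (by linarith))
  · rw [stableExp_spectralMeasure hα hfm hgm, mul_assoc]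
    refine (mul_le_mul_of_nonneg_left (hlow u) hmin).trans ?_
    refine (mul_le_mul_of_nonneg_right (min_le_left ε 1) (hpos u)).trans ?_
    simpa only [aNorm_const_mul_rpow hα] using hA u.fst u.snd
  · rw [indepSpectral, Measure.add_apply, Measure.map_apply measurable_pt_fst MeasurableSet.univ,
      Measure.map_apply measurable_pt_snd MeasurableSet.univ, preimage_univ, preimage_univ,
      ofReal_two]
    exact add_le_add hmass hmass
  · rw [stableExp_indepSpectral hα hbdd, stableExp_spectralMeasure_fst hα h,
      stableExp_spectralMeasure_snd hα h, mul_assoc]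
    refine (mul_le_mul_of_nonneg_left (hlow u) hmin).trans ?_
    exact (mul_le_mul_of_nonneg_right (min_le_right ε 1) (hpos u)).trans_eq (one_mul _)

lemma IsStablePair.charFun_indep [IsProbabilityMeasure P] (hα : 0 < α)
    (h : IsStablePair α P ξ η μ f g) (u : Plane) :
    charFun (((P.map ξ).prod (P.map η)).map (WithLp.toLp 2)) u =
      (Real.exp (-stableExp α (indepSpectral (spectralMeasure α μ f g)) u) : ℝ) := by
  have hfm := h.memLp_fst.1.aemeasurable
  have hgm := h.memLp_snd.1.aemeasurable
  have hfin : IsFiniteMeasure (spectralMeasure α μ f g) :=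
    ⟨(spectralMeasure_univ_le hα h.memLp_fst h.memLp_snd).trans_lt ENNReal.ofReal_lt_top⟩
  have := Measure.isProbabilityMeasure_map h.aemeasurable_fst
  have := Measure.isProbabilityMeasure_map h.aemeasurable_snd
  rw [charFun_prod, h.charFun_fst hα, h.charFun_snd hα,
    stableExp_indepSpectral hα (bdd_of_max_eq_one (ae_spectralMeasure_max hα hfm hgm)),
    stableExp_spectralMeasure_fst hα h, stableExp_spectralMeasure_snd hα h, ← Complex.ofReal_mul,
    ← Real.exp_add, neg_add]
  rfl

/-- Covariance bound for nondegenerate pairs: the covariance is the integral of `K(x) L(y)` against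
the difference of the densities of the pair and of its independent counterpart. -/
lemma exists_abs_covariance_le {β C₁ C₂ ε : ℝ} (hα : 1 < α) (hα' : α < 2) (hβ : 0 ≤ β)
    (hβα : β < α / 2) {K L : ℝ → ℝ} (hK : IsTame β C₁ K) (hL : IsTame β C₂ L) (hε : 0 < ε)
    {σ τ : ℝ} (hσ : 0 < σ) (hτ : 0 < τ) :
    ∃ C : ℝ, 0 ≤ C ∧ ∀ (Ω : Type*) [MeasurableSpace Ω] (P : Measure Ω) [IsProbabilityMeasure P]
      (ξ η : Ω → ℝ) (S : Type*) [MeasurableSpace S] (μ : Measure S) (f g : S → ℝ),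
      IsStablePair α P ξ η μ f g → aNorm α μ f = σ → aNorm α μ g = τ → AssumptionA2 α μ f g ε →
      Integrable (fun ω => K (ξ ω)) P → Integrable (fun ω => L (η ω)) P →
      Integrable (fun ω => K (ξ ω) * L (η ω)) P ∧
        |cov[fun ω => K (ξ ω), fun ω => L (η ω); P]| ≤ C * dep2 α μ f g := by
  have hα0 : 0 < α := by linarith
  have hσα : 0 < σ ^ α := Real.rpow_pos_of_pos hσ _
  have hτα : 0 < τ ^ α := Real.rpow_pos_of_pos hτ _
  have hc : 0 < min ε 1 * min (σ ^ α) (τ ^ α) :=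
    mul_pos (lt_min hε one_pos) (lt_min hσα hτα)
  obtain ⟨D, hD, hdens⟩ := exists_lintegral_stableDensity_le (M := 2 * (σ ^ α + τ ^ α)) hα hα' hc
    (by positivity) hβ hβα hK hL
  have hmom := radialMoment_nonneg α (1 + α / 2) (β + α / 2)
  refine ⟨D * (4 * radialMoment α (1 + α / 2) (β + α / 2)), by positivity, ?_⟩
  intro Ω _ P _ ξ η S _ μ f g h hf hg hA hX hY
  have hfm := h.memLp_fst.1.aemeasurable
  have hgm := h.memLp_snd.1.aemeasurable
  obtain ⟨s₁, s₀⟩ := h.isSpectral hα0 hε.le hA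
  rw [hf, hg] at s₁ s₀
  set Γ := spectralMeasure α μ f g with hΓ
  have := s₁.isFiniteMeasure
  have := Measure.isProbabilityMeasure_map h.aemeasurable_fst
  have := Measure.isProbabilityMeasure_map h.aemeasurable_snd
  have := Measure.isProbabilityMeasure_map h.aemeasurable_pt
  have hFm : Measurable fun z : Plane => K z.fst * L z.snd :=
    (hK.measurable.comp measurable_fst_plane).mul (hL.measurable.comp measurable_snd_plane)
  have hlt : ∀ Γ', IsSpectral α (2 * (σ ^ α + τ ^ α)) (min ε 1 * min (σ ^ α) (τ ^ α)) Γ' →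
      ∫⁻ z : Plane, ‖K z.fst * L z.snd‖ₑ * ‖stableDensity α Γ' z‖ₑ < ⊤ := fun Γ' hΓ' => by
    simp only [enorm_mul]
    exact (hdens Γ' hΓ').1.trans_lt ENNReal.ofReal_lt_top
  obtain ⟨a₁, b₁, e₁⟩ := integral_eq_integral_stableDensity hα hα' hc s₁ (h.charFun_joint hα0) hFm
    (hlt _ s₁)
  obtain ⟨-, b₀, e₀⟩ := integral_eq_integral_stableDensity hα hα' hc s₀ (h.charFun_indep hα0) hFm
    (hlt _ s₀)
  have hXY : Integrable (fun ω => K (ξ ω) * L (η ω)) P :=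
    (integrable_map_measure a₁.1 h.aemeasurable_pt).1 a₁
  refine ⟨hXY, ?_⟩
  have i₁ : ∫ z, K z.fst * L z.snd ∂(P.map fun ω => pt (ξ ω) (η ω)) =
      ∫ ω, K (ξ ω) * L (η ω) ∂P := integral_map h.aemeasurable_pt a₁.1
  have i₀ : ∫ z : Plane, K z.fst * L z.snd ∂(((P.map ξ).prod (P.map η)).map (WithLp.toLp 2)) =
      (∫ ω, K (ξ ω) ∂P) * ∫ ω, L (η ω) ∂P := by
    rw [integral_map (WithLp.measurable_toLp 2 (ℝ × ℝ)).aemeasurable hFm.aestronglyMeasurable]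
    simp only [WithLp.toLp_fst, WithLp.toLp_snd]
    rw [integral_prod_mul, integral_map h.aemeasurable_fst hK.measurable.aestronglyMeasurable,
      integral_map h.aemeasurable_snd hL.measurable.aestronglyMeasurable]
  rw [covariance_eq_integral_mul_sub hX hY hXY, ← i₁, ← i₀, e₁, e₀, ← integral_sub b₁ b₀]
  have hjump := lintegral_jumpSize_le hα0 hα' hβ hβα (ae_spectralMeasure_max (μ := μ) hα0 hfm hgm)
  rw [lintegral_spectralMeasure_dep2 hα0 h.memLp_fst h.memLp_snd, ← hΓ,
    ← ENNReal.ofReal_mul (by positivity)] at hjump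
  have hdiff := lintegral_stableDensity_sub_le hα hα' hc hβ hK.measurable hL.measurable
    (fun Γ' hΓ' => (hdens Γ' hΓ').2) s₁ s₀ (hjump.trans_lt ENNReal.ofReal_lt_top)
  have hd2 := dep2_nonneg α μ f g
  refine (Real.norm_eq_abs _).symm.le.trans ?_
  rw [← toReal_enorm]
  refine ENNReal.toReal_le_of_le_ofReal (by positivity) ?_
  calc ‖∫ z, (K z.fst * L z.snd * (stableDensity α Γ z).re -
          K z.fst * L z.snd * (stableDensity α (indepSpectral Γ) z).re)‖ₑ
      ≤ ∫⁻ z, ‖K z.fst * L z.snd * (stableDensity α Γ z).re -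
          K z.fst * L z.snd * (stableDensity α (indepSpectral Γ) z).re‖ₑ :=
        enorm_integral_le_lintegral_enorm _
    _ ≤ ∫⁻ z : Plane, ‖K z.fst‖ₑ * ‖L z.snd‖ₑ *
          ‖stableDensity α Γ z - stableDensity α (indepSpectral Γ) z‖ₑ := by
        refine lintegral_mono fun z => ?_
        rw [← mul_sub, enorm_mul, enorm_mul, ← Complex.sub_re]
        gcongr
        exact enorm_le_iff_norm_le.2 (Complex.abs_re_le_norm _)
    _ ≤ ∫⁻ x, ENNReal.ofReal (D * (jumpSize β x.fst * jumpSize β x.snd))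
          ∂(polar (radialLevy α) Γ) := hdiff
    _ = ENNReal.ofReal D * ∫⁻ x, ENNReal.ofReal (jumpSize β x.fst * jumpSize β x.snd)
          ∂(polar (radialLevy α) Γ) := by
        rw [← lintegral_const_mul' _ _ ENNReal.ofReal_ne_top]
        simp only [ENNReal.ofReal_mul hD]
    _ ≤ ENNReal.ofReal (D * (4 * radialMoment α (1 + α / 2) (β + α / 2)) * dep2 α μ f g) := by
        rw [mul_assoc D, ENNReal.ofReal_mul hD]
        gcongr

end StablePair

end StableCov

theorem theorem2p4 (α : ℝ) (hα : 1 < α) (hα' : α < 2)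
    (K L : ℝ → ℝ) (hK : StableCov.Admissible α K) (hL : StableCov.Admissible α L)
    (ε₁ ε₂ : ℝ) (hε₁ : 0 < ε₁) (hε₂ : 0 < ε₂) (σ τ : ℝ) :
    ∃ C : ℝ,
      ∀ (Ω : Type*) [MeasurableSpace Ω] (P : Measure Ω) [IsProbabilityMeasure P]
        (ξ η : Ω → ℝ) (S : Type*) [MeasurableSpace S] (μ : Measure S) (f g : S → ℝ),
        StableCov.IsStablePair α P ξ η μ f g →
        StableCov.aNorm α μ f = σ →
        StableCov.aNorm α μ g = τ →
        StableCov.AssumptionA1 α μ f g ε₁ →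
        StableCov.AssumptionA2 α μ f g ε₂ →
        Integrable (fun ω => K (ξ ω)) P ∧
        Integrable (fun ω => L (η ω)) P ∧
        Integrable (fun ω => K (ξ ω) * L (η ω)) P ∧
        |cov[fun ω => K (ξ ω), fun ω => L (η ω); P]| ≤
          C * (StableCov.dep1 α μ f g + StableCov.dep2 α μ f g) := by
  have hα0 : 0 < α := by linarith
  obtain ⟨β₁, C₁, hβ₁, hβ₁α, hK'⟩ := hK.isTame hα'
  obtain ⟨β₂, C₂, hβ₂, hβ₂α, hL'⟩ := hL.isTame hα'
  have hβ : 0 ≤ max β₁ β₂ := hβ₁.le.trans (le_max_left _ _)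
  have hβα : max β₁ β₂ < α / 2 := max_lt hβ₁α hβ₂α
  replace hK' := hK'.mono (le_max_left β₁ β₂)
  replace hL' := hL'.mono (le_max_right β₁ β₂)
  by_cases hst : 0 < σ ∧ 0 < τ
  · obtain ⟨C, hC, hcov⟩ := StableCov.exists_abs_covariance_le hα hα' hβ hβα hK' hL' hε₂ hst.1 hst.2
    refine ⟨C, ?_⟩
    intro Ω _ P _ ξ η S _ μ f g h hf hg hA1 hA2
    have hX := h.integrable_comp_fst hα hα' hβ hβα hK'
    have hY := h.integrable_comp_snd hα hα' hβ hβα hL'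
    obtain ⟨hXY, hle⟩ := hcov Ω P ξ η S μ f g h hf hg hA2 hX hY
    refine ⟨hX, hY, hXY, hle.trans (mul_le_mul_of_nonneg_left ?_ hC)⟩
    linarith [StableCov.dep1_nonneg α μ f g]
  · -- Scale parameters are nonnegative, so one of them is zero and the covariance is zero:
    -- one component vanishes almost surely, so its image under `K` or `L` is constant.
    refine ⟨0, ?_⟩
    intro Ω _ P _ ξ η S _ μ f g h hf hg hA1 hA2
    have hX := h.integrable_comp_fst hα hα' hβ hβα hK'
    have hY := h.integrable_comp_snd hα hα' hβ hβα hL'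
    refine ⟨hX, hY, ?_⟩
    rw [zero_mul, abs_nonpos_iff]
    rcases not_and_or.1 hst with h0 | h0
    · have hz : StableCov.aNorm α μ f = 0 := le_antisymm (hf.trans_le (not_lt.1 h0))
        (StableCov.aNorm_nonneg α μ f)
      have hξ := StableCov.ae_eq_zero_of_charFun h.aemeasurable_fst fun u => by
        rw [h.charFun_fst hα0, hz, Real.zero_rpow hα0.ne']; simp
      have hc : ∀ᵐ ω ∂P, K (ξ ω) = K 0 := hξ.mono fun ω hω => by rw [hω]
      exact ⟨(hY.const_mul (K 0)).congr (hc.mono fun ω hω => by simp only [hω]),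
        StableCov.covariance_ae_const_left hc⟩
    · have hz : StableCov.aNorm α μ g = 0 := le_antisymm (hg.trans_le (not_lt.1 h0))
        (StableCov.aNorm_nonneg α μ g)
      have hη := StableCov.ae_eq_zero_of_charFun h.aemeasurable_snd fun u => by
        rw [h.charFun_snd hα0, hz, Real.zero_rpow hα0.ne']; simp
      have hc : ∀ᵐ ω ∂P, L (η ω) = L 0 := hη.mono fun ω hω => by rw [hω]
      exact ⟨(hX.mul_const (L 0)).congr (hc.mono fun ω hω => by simp only [hω]),
        (covariance_comm _ _).trans (StableCov.covariance_ae_const_left hc)⟩
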